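/- Let $V$ be an oriented seven-dimensional real vector space with a non-degenerate metric $h$ of signature $(4,3)$ (four pluses, three minuses), let $\mathrm{SO}_0(4,3)$ be the identity component of the isometry group of $(V,h)$, let $*$ be the Hodge operator of $(V,h)$, given by $\alpha\wedge *\beta=\langle\alpha,\beta\rangle\,\nu$ with $\nu$ the volume form, let $\langle\cdot,\cdot\rangle$ be the inner product induced by $h$ on $\Lambda^3V^*$ (for which the $e^{i}\wedge e^j\wedge e^k$, $i<j<k$, of a pseudo-orthonormal basis are pseudo-orthonormal), and, for $\phi\in\Lambda^3V^*$, put $$\phi\,\triangle_1\phi=\sum_{i,j}h^{ij}\,(\iota_{e_i}\phi)\wedge(\iota_{e_j}\phi)\in\Lambda^4V^*$$ for any basis $(e_i)$ of $V$, where $(h^{ij})$ is the inverse of the matrix $(h(e_i,e_j))$. A subgroup of $\mathrm{Aut}(V)$ is said to be $\mathrm{G}_2^*\subset\mathrm{SO}_0(4,3)$ if it is contained in $\mathrm{SO}_0(4,3)$ and equals $\{A\in\mathrm{Aut}(V)\mid A^*\phi_0=\phi_0\}$ for the canonical three-form $$\phi_0=-e^{127}-e^{135}+e^{146}+e^{236}+e^{245}-e^{347}+e^{567}$$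 of some basis $(e^1,\dots,e^7)$ of $V^*$, where $e^{ijk}=e^i\wedge e^j\wedge e^k$. The metric induced by a three-form $\phi$ is the metric $g$ of signature $(4,3)$ such that $(\iota_u\phi)\wedge(\iota_v\phi)\wedge\phi=6\,g(u,v)\,\nu_g$ for all $u,v\in V$, where $\nu_g$ is the volume form of $g$ for one of the two orientations of $V$. **Theorem.** Let $l\in\{-1,+1\}$ and $\phi\in\Lambda^3V^*$. The stabilizer of $\phi$ is $\mathrm{G}_2^*\subset\mathrm{SO}_0(4,3)$ if and only if $\langle\phi,\phi\rangle<0$ and $$6\,\kappa\,\sqrt{-\frac{\langle\phi,\phi\rangle}{7}}\;\phi=l*(\phi\,\triangle_1\phi)\qquad\text{for some sign }\kappa\in\{-1,+1\}.$$ Here the stabilizer may be taken in $\mathrm{Aut}(V)$ or in $\mathrm{SO}_0(4,3)$: the equivalence holds for both. If this is the case, then $\phi$ induces exactly one metric and this metric is homothetic to $h$, that is, equal to $c\,h$ for some $c>0$. If in addition $\langle\phi,\phi\rangle=-7$, then the metric induced by $\phi$ is precisely $h$. -/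

import Mathlib

open Module

/-- The space `Λᵏ V*` of exterior `k`-forms on the real vector space `V`. -/
abbrev ExtForm (V : Type*) [AddCommGroup V] [Module ℝ V] (k : ℕ) : Type _ :=
  V [⋀^Fin k]→ₗ[ℝ] ℝ

namespace SplitG2

section General

variable {V : Type*} [AddCommGroup V] [Module ℝ V]

/-- `h` is a (symmetric) pseudo-Euclidean metric of signature `(4,3)`: four pluses and three
minuses. On a seven-dimensional space it is then automatically non-degenerate. -/
def HasSignature43 (h : LinearMap.BilinForm ℝ V) : Prop :=
  h.IsSymm ∧ sigPos h.toQuadraticMap = 4 ∧ sigNeg h.toQuadraticMap = 3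

/-- The wedge product of forms, in the convention `(α ∧ β)(x, y) = α(x) β(y) - α(y) β(x)` for
one-forms (a sum over shuffles). -/
noncomputable def wedge {p q : ℕ} (α : ExtForm V p) (β : ExtForm V q) : ExtForm V (p + q) :=
  ((LinearMap.mul' ℝ ℝ).compAlternatingMap (α.domCoprod β)).domDomCongr finSumFinEquiv

/-- The contract product `ι_v α`, which inserts `v` into the first slot of `α`. -/
def contract {k : ℕ} (v : V) (α : ExtForm V (k + 1)) : ExtForm V k :=
  AlternatingMap.curryLeft α v

/-- The `h`-reciprocal vectors `∑ j, h^{ij} e_j` of a basis `e`, where `h^{ij}` is the inverse of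
the Gram matrix `h(e_i, e_j)`; thus `h (recip h e i) (e j) = δ_{ij}` if `h` is non-degenerate. -/
noncomputable def recip (h : LinearMap.BilinForm ℝ V) (e : Basis (Fin 7) ℝ V) (i : Fin 7) : V :=
  ∑ j, (LinearMap.BilinForm.toMatrix e h)⁻¹ i j • e j

/-- The subgroup of all automorphisms `A` of `V` with `A* φ = φ`. -/
def stabilizer {k : ℕ} (φ : ExtForm V k) : Subgroup (V ≃ₗ[ℝ] V) where
  carrier := {A | φ.compLinearMap (A : V →ₗ[ℝ] V) = φ}
  one_mem' := by ext x; rfl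
  mul_mem' := by
    intro A B hA hB
    ext x
    have h1 := DFunLike.congr_fun hB x
    have h2 := DFunLike.congr_fun hA (fun i => B (x i))
    exact h2.trans h1
  inv_mem' := by
    intro A hA
    ext x
    have h1 := DFunLike.congr_fun hA (fun i => A⁻¹ (x i))
    refine h1.symm.trans ?_
    change φ (fun i => A (A⁻¹ (x i))) = φ x
    congr 1
    funext i
    exact A.apply_symm_apply (x i)

/-- The isometries of `h`, as a subset of the algebra of endomorphisms of `V`. -/
def isometries (h : LinearMap.BilinForm ℝ V) : Set (Module.End ℝ V) :=
  {A | ∀ x y, h (A x) (A y) = h x y}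

/-- The connected component of the identity in the set of isometries of `h`, for the canonical
topology of the real vector space `End V` (the Euclidean one if `V` is finite-dimensional). -/
def isometryComponent (h : LinearMap.BilinForm ℝ V) : Set (Module.End ℝ V) :=
  @connectedComponentIn (Module.End ℝ V) (moduleTopology ℝ (Module.End ℝ V)) (isometries h) 1

lemma one_mem_isometries (h : LinearMap.BilinForm ℝ V) : (1 : Module.End ℝ V) ∈ isometries h :=
  fun _ _ => rfl

lemma mul_image_subset {h : LinearMap.BilinForm ℝ V} {A B : Module.End ℝ V}
    (hA : A ∈ isometries h) (hB : B ∈ isometryComponent h) (h1 : A * B ∈ isometryComponent h) :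
    (fun C => A * C) '' isometryComponent h ⊆ isometryComponent h := by
  let _ : TopologicalSpace (Module.End ℝ V) := moduleTopology ℝ (Module.End ℝ V)
  have : IsModuleTopology ℝ (Module.End ℝ V) := ⟨rfl⟩
  have : ContinuousSMul ℝ (Module.End ℝ V) := IsModuleTopology.toContinuousSMul ℝ _
  have : ContinuousAdd (Module.End ℝ V) := IsModuleTopology.toContinuousAdd ℝ _
  have hc : Continuous (fun C : Module.End ℝ V => A * C) :=
    IsModuleTopology.continuous_of_linearMap (LinearMap.mulLeft ℝ A)
  have hp : IsPreconnected ((fun C => A * C) '' isometryComponent h) :=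
    isPreconnected_connectedComponentIn.image _ hc.continuousOn
  have hs : (fun C => A * C) '' isometryComponent h ⊆ isometries h := by
    rintro _ ⟨C, hC, rfl⟩ x y
    have hC' : C ∈ isometries h := connectedComponentIn_subset _ _ hC
    exact (hA _ _).trans (hC' x y)
  have := hp.subset_connectedComponentIn (x := A * B) ⟨B, hB, rfl⟩ hs
  rw [← connectedComponentIn_eq h1] at this
  exact this

lemma one_mem_isometryComponent (h : LinearMap.BilinForm ℝ V) :
    (1 : Module.End ℝ V) ∈ isometryComponent h :=
  @mem_connectedComponentIn _ (moduleTopology ℝ (Module.End ℝ V)) _ _ (one_mem_isometries h)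

/-- `SO₀(V, h)`: the identity component of the group of isometries of `h`. -/
def SO0 (h : LinearMap.BilinForm ℝ V) : Subgroup (V ≃ₗ[ℝ] V) where
  carrier := {A | (A : V →ₗ[ℝ] V) ∈ isometryComponent h}
  one_mem' := one_mem_isometryComponent h
  mul_mem' := by
    intro A B hA hB
    have hA' : (A : V →ₗ[ℝ] V) ∈ isometries h :=
      @connectedComponentIn_subset _ (moduleTopology ℝ (Module.End ℝ V)) _ _ _ hA
    exact mul_image_subset hA' (one_mem_isometryComponent h)
      ((mul_one (A : Module.End ℝ V)).symm ▸ hA) ⟨_, hB, rfl⟩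
  inv_mem' := by
    intro A hA
    have hA' : (A : V →ₗ[ℝ] V) ∈ isometries h :=
      @connectedComponentIn_subset _ (moduleTopology ℝ (Module.End ℝ V)) _ _ _ hA
    have hI : ((A⁻¹ : V ≃ₗ[ℝ] V) : V →ₗ[ℝ] V) ∈ isometries h := by
      intro x y
      have := hA' (A.symm x) (A.symm y)
      simp only [LinearEquiv.coe_coe, LinearEquiv.apply_symm_apply] at this
      exact this.symm
    have hone : ((A⁻¹ : V ≃ₗ[ℝ] V) : Module.End ℝ V) * (A : V →ₗ[ℝ] V) = 1 := by
      ext x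
      exact A.symm_apply_apply x
    have := mul_image_subset hI hA (hone ▸ one_mem_isometryComponent h)
      ⟨1, one_mem_isometryComponent h, rfl⟩
    simpa using this

/-- The decomposable three-form `e^{ijk} = eⁱ ∧ eʲ ∧ eᵏ`, that is
`(x₁, x₂, x₃) ↦ det (e^{i_a}(x_b))`, where `(eⁱ)` is the basis of `V*` dual to `e`. -/
noncomputable def basisThreeForm (e : Basis (Fin 7) ℝ V) (i j k : Fin 7) : ExtForm V 3 :=
  (Matrix.detRowAlternating (n := Fin 3) (R := ℝ)).compLinearMap
    (LinearMap.pi ![e.coord i, e.coord j, e.coord k])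

/-- The canonical three-form
`- e¹²⁷ - e¹³⁵ + e¹⁴⁶ + e²³⁶ + e²⁴⁵ - e³⁴⁷ + e⁵⁶⁷` of a basis `e¹, …, e⁷` of `V*`
(the indices `1, …, 7` are written here as `0, …, 6`). -/
noncomputable def canonicalThreeForm (e : Basis (Fin 7) ℝ V) : ExtForm V 3 :=
  - basisThreeForm e 0 1 6 - basisThreeForm e 0 2 4 + basisThreeForm e 0 3 5
    + basisThreeForm e 1 2 5 + basisThreeForm e 1 3 4 - basisThreeForm e 2 3 6
    + basisThreeForm e 4 5 6

/-- `H` is a subgroup `G₂* ⊂ SO₀(V, h)`: it is contained in `SO₀(V, h)` and it is the stabilizer in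
`Aut(V)` of the canonical three-form of an adequate basis. -/
def IsG2Star (h : LinearMap.BilinForm ℝ V) (H : Subgroup (V ≃ₗ[ℝ] V)) : Prop :=
  H ≤ SO0 h ∧ ∃ e : Basis (Fin 7) ℝ V, H = stabilizer (canonicalThreeForm e)

theorem recip_pair (h : LinearMap.BilinForm ℝ V) (hd : h.Nondegenerate)
    (e : Basis (Fin 7) ℝ V) (i j : Fin 7) : h (recip h e i) (e j) = if i = j then 1 else 0 := by
  have hu : IsUnit (LinearMap.BilinForm.toMatrix e h).det :=
    isUnit_iff_ne_zero.mpr ((LinearMap.BilinForm.nondegenerate_iff_det_ne_zero e).mp hd)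
  have := congrFun (congrFun (Matrix.nonsing_inv_mul _ hu) i) j
  rw [Matrix.mul_apply, Matrix.one_apply] at this
  simpa [recip, LinearMap.BilinForm.toMatrix_apply, LinearMap.sum_apply] using this

theorem eq_sum_recip (h : LinearMap.BilinForm ℝ V) (hd : h.Nondegenerate)
    (e : Basis (Fin 7) ℝ V) (x : V) : ∑ i, h (recip h e i) x • e i = x := by
  have : ∀ i, h (recip h e i) x = e.repr x i := by
    intro i
    calc h (recip h e i) x = h (recip h e i) (∑ j, e.repr x j • e j) := by rw [e.sum_repr]
      _ = ∑ j, e.repr x j * h (recip h e i) (e j) := by simp only [map_sum, map_smul, smul_eq_mul]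
      _ = e.repr x i := by simp [recip_pair h hd]
  simp only [this, e.sum_repr]

theorem recip_eq_sum (h : LinearMap.BilinForm ℝ V) (hd : h.Nondegenerate)
    (e : Basis (Fin 7) ℝ V) (x : V) : ∑ i, h x (e i) • recip h e i = x := by
  have key : ∀ y, h (∑ i, h x (e i) • recip h e i) y = h x y := by
    intro y
    conv_rhs => rw [← eq_sum_recip h hd e y]
    simp [LinearMap.sum_apply, mul_comm]
  have hz : ∀ y, h (∑ i, h x (e i) • recip h e i - x) y = 0 := by
    intro y; rw [map_sub, LinearMap.sub_apply, key, sub_self]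
  exact sub_eq_zero.mp (hd.1 _ hz)

theorem sum_recip_eq {W : Type*} [AddCommGroup W] [Module ℝ W] (h : LinearMap.BilinForm ℝ V)
    (hd : h.Nondegenerate) (e e' : Basis (Fin 7) ℝ V) (f : V →ₗ[ℝ] V →ₗ[ℝ] W) :
    ∑ i, f (e i) (recip h e i) = ∑ i, f (e' i) (recip h e' i) := by
  symm
  calc ∑ j, f (e' j) (recip h e' j)
      = ∑ j, ∑ i, h (recip h e' j) (e i) • f (e' j) (recip h e i) := by
        refine Finset.sum_congr rfl fun j _ => ?_
        conv_lhs => rw [← recip_eq_sum h hd e (recip h e' j)]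
        simp
    _ = ∑ i, f (∑ j, h (recip h e' j) (e i) • e' j) (recip h e i) := by
        rw [Finset.sum_comm]
        simp [LinearMap.sum_apply]
    _ = _ := by simp only [eq_sum_recip h hd]

theorem sum_recip_multi {W : Type*} [AddCommGroup W] [Module ℝ W] (h : LinearMap.BilinForm ℝ V)
    (hd : h.Nondegenerate) (e e' : Basis (Fin 7) ℝ V) {k : ℕ}
    (β : MultilinearMap ℝ (fun _ : Fin k => V) ℝ) (α : MultilinearMap ℝ (fun _ : Fin k => V) W) :
    ∑ i : Fin k → Fin 7, β (fun a => recip h e (i a)) • α (fun a => e (i a)) =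
      ∑ i : Fin k → Fin 7, β (fun a => recip h e' (i a)) • α (fun a => e' (i a)) := by
  induction k with
  | zero =>
    have : ∀ u v : Fin 0 → V, u = v := fun u v => Subsingleton.elim _ _
    refine Finset.sum_congr rfl fun i _ => ?_
    rw [this (fun a => recip h e (i a)) (fun a => recip h e' (i a)),
      this (fun a => e (i a)) (fun a => e' (i a))]
  | succ k ih =>
    have split : ∀ e : Basis (Fin 7) ℝ V,
        ∑ i : Fin (k + 1) → Fin 7, β (fun a => recip h e (i a)) • α (fun a => e (i a)) =
        ∑ j : Fin 7, ∑ i : Fin k → Fin 7, β.curryLeft (recip h e j) (fun a => recip h e (i a)) •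
          α.curryLeft (e j) (fun a => e (i a)) := by
      intro e
      rw [← (Fin.consEquiv (fun _ : Fin (k + 1) => Fin 7)).sum_comp, Fintype.sum_prod_type]
      refine Finset.sum_congr rfl fun j _ => Finset.sum_congr rfl fun i _ => ?_
      rw [MultilinearMap.curryLeft_apply, MultilinearMap.curryLeft_apply]
      congr 2 <;> · funext a; refine Fin.cases ?_ (fun b => ?_) a <;> simp [Fin.consEquiv]
    rw [split, split]
    simp only [fun j => ih (β.curryLeft (recip h e j)) (α.curryLeft (e j))]
    let f : V →ₗ[ℝ] V →ₗ[ℝ] W := LinearMap.mk₂ ℝ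
      (fun u v => ∑ i : Fin k → Fin 7, β.curryLeft v (fun a => recip h e' (i a)) •
          α.curryLeft u (fun a => e' (i a)))
      (by
        intro u u' v
        simp only [map_add, add_apply, smul_add, Finset.sum_add_distrib])
      (by
        intro c u v
        simp only [map_smul, smul_apply, Finset.smul_sum]
        exact Finset.sum_congr rfl fun i _ => smul_comm _ _ _)
      (by
        intro u v v'
        simp only [map_add, add_apply, add_smul, Finset.sum_add_distrib])
      (by
        intro c u v
        simp only [map_smul, smul_apply, Finset.smul_sum, smul_assoc])
    exact sum_recip_eq h hd e e' f

theorem wedge_add_left {p q : ℕ} (α α' : ExtForm V p) (β : ExtForm V q) :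
    wedge (α + α') β = wedge α β + wedge α' β := by
  have : (α + α').domCoprod β = α.domCoprod β + α'.domCoprod β := by
    simp only [← AlternatingMap.domCoprod'_apply, TensorProduct.add_tmul, map_add]
  ext x
  simp [wedge, this]

theorem wedge_add_right {p q : ℕ} (α : ExtForm V p) (β β' : ExtForm V q) :
    wedge α (β + β') = wedge α β + wedge α β' := by
  have : α.domCoprod (β + β') = α.domCoprod β + α.domCoprod β' := by
    simp only [← AlternatingMap.domCoprod'_apply, TensorProduct.tmul_add, map_add]
  ext x
  simp [wedge, this]

theorem wedge_smul_left {p q : ℕ} (c : ℝ) (α : ExtForm V p) (β : ExtForm V q) :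
    wedge (c • α) β = c • wedge α β := by
  have : (c • α).domCoprod β = c • α.domCoprod β := by
    simp only [← AlternatingMap.domCoprod'_apply, ← TensorProduct.smul_tmul', map_smul]
  ext x
  simp [wedge, this]

theorem wedge_smul_right {p q : ℕ} (c : ℝ) (α : ExtForm V p) (β : ExtForm V q) :
    wedge α (c • β) = c • wedge α β := by
  have : α.domCoprod (c • β) = c • α.domCoprod β := by
    simp only [← AlternatingMap.domCoprod'_apply, TensorProduct.tmul_smul, map_smul]
  ext x
  simp [wedge, this]

end General

section Seven

variable {V : Type*} [AddCommGroup V] [Module ℝ V] [Fact (finrank ℝ V = 7)]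

/-- An auxiliary basis of `V`; nothing defined below depends on its choice. -/
noncomputable def auxBasis (V : Type*) [AddCommGroup V] [Module ℝ V] [Fact (finrank ℝ V = 7)] :
    Basis (Fin 7) ℝ V :=
  haveI : Module.Finite ℝ V := Module.finite_of_finrank_eq_succ (n := 6) Fact.out
  finBasisOfFinrankEq ℝ V Fact.out

/-- The pseudo-Riemannian volume form `ν` of `(V, h)` for the orientation `o`:
`ν = √|det h(e_i, e_j)| e¹ ∧ ⋯ ∧ e⁷` for every positively oriented basis `e`. -/
noncomputable def volumeForm (h : LinearMap.BilinForm ℝ V) (o : Orientation ℝ V (Fin 7)) :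
    ExtForm V 7 :=
  √|(LinearMap.BilinForm.toMatrix ((auxBasis V).adjustToOrientation o) h).det| •
    ((auxBasis V).adjustToOrientation o).det

/-- The inner product of `k`-forms induced by `h`,
`⟨α, β⟩ = (1/k!) ∑ h^{i₁j₁} ⋯ h^{iₖjₖ} α(e_{i₁}, …, e_{iₖ}) β(e_{j₁}, …, e_{jₖ})`. -/
noncomputable def formInner (h : LinearMap.BilinForm ℝ V) {k : ℕ} (α β : ExtForm V k) : ℝ :=
  (k.factorial : ℝ)⁻¹ * ∑ i : Fin k → Fin 7,
    α (fun a => auxBasis V (i a)) * β (fun a => recip h (auxBasis V) (i a))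

/-- The first generalized product `α △₁ β = ∑ h^{ij} (ι_{e_i} α) ∧ (ι_{e_j} β)` of `(V*, h*)`. -/
noncomputable def triangleOne (h : LinearMap.BilinForm ℝ V) {p q : ℕ} (α : ExtForm V (p + 1))
    (β : ExtForm V (q + 1)) : ExtForm V (p + q) :=
  ∑ i, wedge (contract (auxBasis V i) α) (contract (recip h (auxBasis V) i) β)

/-- The Hodge operator `* : Λ⁴V* → Λ³V*` of the oriented metric vector space `(V, h, o)`:
`(*β)(x, y, z) = (1/4!) ∑ β^{i₁i₂i₃i₄} ν(e_{i₁}, e_{i₂}, e_{i₃}, e_{i₄}, x, y, z)`. It is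
characterized by `α ∧ *β = ⟨α, β⟩ ν`. -/
noncomputable def hodgeFour (h : LinearMap.BilinForm ℝ V) (o : Orientation ℝ V (Fin 7))
    (β : ExtForm V 4) : ExtForm V 3 :=
  ((Nat.factorial 4 : ℕ) : ℝ)⁻¹ • ∑ i : Fin 4 → Fin 7,
    β (fun a => recip h (auxBasis V) (i a)) •
      contract (auxBasis V (i 3)) (contract (auxBasis V (i 2))
        (contract (auxBasis V (i 1)) (contract (auxBasis V (i 0)) (volumeForm h o))))

/-- `g` is the metric induced by the three-form `φ`: the metric of signature `(4,3)` for which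
`(ι_u φ) ∧ (ι_v φ) ∧ φ = 6 g(u, v) ν_g` for all `u` and `v`, where `ν_g` is the volume form of `g`
for one of the two orientations of `V`. -/
def IsInducedMetric (φ : ExtForm V 3) (g : LinearMap.BilinForm ℝ V) : Prop :=
  HasSignature43 g ∧ ∃ o : Orientation ℝ V (Fin 7), ∀ u v : V,
    wedge (wedge (contract u φ) (contract v φ)) φ = (6 * g u v) • volumeForm g o

theorem HasSignature43.nondegenerate {h : LinearMap.BilinForm ℝ V} (hh : HasSignature43 h) :
    h.Nondegenerate := by
  have : FiniteDimensional ℝ V := Module.finite_of_finrank_eq_succ (n := 6) Fact.out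
  have h7 : finrank ℝ V = 7 := Fact.out
  have h1 := QuadraticForm.sigPos_add_sigNeg_add_radical (Q := h.toQuadraticMap)
  rw [hh.2.1, hh.2.2, h7] at h1
  have : h.toQuadraticMap.radical = ⊥ := Submodule.finrank_eq_zero.mp (by omega)
  have hl : h.SeparatingLeft := by
    intro x hx
    have hx' : x ∈ h.toQuadraticMap.radical := by
      rw [QuadraticMap.mem_radical_iff']
      refine ⟨hx x, fun n => ?_⟩
      have hn : h n x = 0 := (hh.1.eq x n).symm.trans (hx n)
      simp [LinearMap.BilinMap.toQuadraticMap_apply, hx, hn]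
    rw [this] at hx'
    simpa using hx'
  exact ⟨hl, fun y hy => hl y fun x => (hh.1.eq x y).symm.trans (hy x)⟩

/-- The definition of `△₁` is independent of the basis; likewise for the notions below. -/
theorem triangleOne_eq_sum {h : LinearMap.BilinForm ℝ V} (hh : HasSignature43 h)
    (e : Basis (Fin 7) ℝ V) {p q : ℕ}
    (α : ExtForm V (p + 1)) (β : ExtForm V (q + 1)) :
    triangleOne h α β = ∑ i, wedge (contract (e i) α) (contract (recip h e i) β) := by
  let f : V →ₗ[ℝ] V →ₗ[ℝ] ExtForm V (p + q) := LinearMap.mk₂ ℝ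
    (fun u v => wedge (contract u α) (contract v β))
    (by intros; simp only [contract, map_add, wedge_add_left])
    (by intros; simp only [contract, map_smul, wedge_smul_left])
    (by intros; simp only [contract, map_add, wedge_add_right])
    (by intros; simp only [contract, map_smul, wedge_smul_right])
  exact sum_recip_eq h hh.nondegenerate (auxBasis V) e f

theorem formInner_eq_sum {h : LinearMap.BilinForm ℝ V} (hh : HasSignature43 h)
    (e : Basis (Fin 7) ℝ V) {k : ℕ}
    (α β : ExtForm V k) :
    formInner h α β = (k.factorial : ℝ)⁻¹ * ∑ i : Fin k → Fin 7,
      α (fun a => e (i a)) * β (fun a => recip h e (i a)) := by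
  have := sum_recip_multi h hh.nondegenerate (auxBasis V) e (β : MultilinearMap ℝ (fun _ : Fin k => V) ℝ)
    (α : MultilinearMap ℝ (fun _ : Fin k => V) ℝ)
  simp only [AlternatingMap.coe_multilinearMap, smul_eq_mul, mul_comm (β _)] at this
  rw [formInner, this]

theorem hodgeFour_apply {h : LinearMap.BilinForm ℝ V} (hh : HasSignature43 h)
    (e : Basis (Fin 7) ℝ V)
    (o : Orientation ℝ V (Fin 7)) (β : ExtForm V 4) (x : Fin 3 → V) :
    hodgeFour h o β x = (24 : ℝ)⁻¹ * ∑ i : Fin 4 → Fin 7, β (fun a => recip h e (i a)) *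
      volumeForm h o ![e (i 0), e (i 1), e (i 2), e (i 3), x 0, x 1, x 2] := by
  let γ : MultilinearMap ℝ (fun _ : Fin 4 => V) (MultilinearMap ℝ (fun _ : Fin 3 => V) ℝ) :=
    MultilinearMap.currySum ((volumeForm h o : MultilinearMap ℝ (fun _ : Fin 7 => V) ℝ).domDomCongr
      (finSumFinEquiv (m := 4) (n := 3)).symm)
  have hγ : ∀ u : Fin 4 → V, γ u x = volumeForm h o ![u 0, u 1, u 2, u 3, x 0, x 1, x 2] := by
    intro u
    change volumeForm h o _ = volumeForm h o _
    congr 1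
    funext a
    fin_cases a <;> rfl
  have key := congrArg (fun F : MultilinearMap ℝ (fun _ : Fin 3 => V) ℝ => F x)
    (sum_recip_multi h hh.nondegenerate (auxBasis V) e (β : MultilinearMap ℝ (fun _ : Fin 4 => V) ℝ) γ)
  simp only [AlternatingMap.coe_multilinearMap, sum_apply,
    smul_apply, hγ, smul_eq_mul] at key
  rw [← key]
  have h24 : ((Nat.factorial 4 : ℕ) : ℝ) = 24 := by norm_num [Nat.factorial]
  have hx : x = ![x 0, x 1, x 2] := by
    funext a; fin_cases a <;> rfl
  let ev : ExtForm V 3 →ₗ[ℝ] ℝ :=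
    { toFun := fun α => α x, map_add' := fun _ _ => rfl, map_smul' := fun _ _ => rfl }
  have hev : hodgeFour h o β x = ev (hodgeFour h o β) := rfl
  rw [hev, hodgeFour, h24, map_smul, map_sum, smul_eq_mul]
  refine congrArg _ (Finset.sum_congr rfl fun i _ => ?_)
  rw [map_smul, smul_eq_mul]
  refine congrArg _ ?_
  have hc : ∀ u₀ u₁ u₂ u₃ : V,
      ev (contract u₃ (contract u₂ (contract u₁ (contract u₀ (volumeForm h o))))) =
        volumeForm h o ![u₀, u₁, u₂, u₃, x 0, x 1, x 2] := by
    intro u₀ u₁ u₂ u₃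
    refine (congrArg ev.toFun rfl).trans (congrArg (volumeForm h o) ?_ :
      volumeForm h o (Matrix.vecCons u₀ (Matrix.vecCons u₁ (Matrix.vecCons u₂
        (Matrix.vecCons u₃ x)))) = _)
    conv_lhs => rw [hx]
  exact hc _ _ _ _

theorem volumeForm_eq (h : LinearMap.BilinForm ℝ V) (o : Orientation ℝ V (Fin 7)) (e : Basis (Fin 7) ℝ V)
    (he : e.orientation = o) :
    volumeForm h o = √|(LinearMap.BilinForm.toMatrix e h).det| • e.det := by
  set b := (auxBasis V).adjustToOrientation o with hb
  have hbo : b.orientation = o := Basis.orientation_adjustToOrientation _ _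
  have hpos : 0 < b.det e := by
    rw [← Basis.orientation_eq_iff_det_pos, hbo, he]
  have h1 : LinearMap.BilinForm.toMatrix e h =
      (b.toMatrix e).transpose * LinearMap.BilinForm.toMatrix b h * b.toMatrix e := by
    simp
  have h2 : (LinearMap.BilinForm.toMatrix e h).det =
      (b.det e) ^ 2 * (LinearMap.BilinForm.toMatrix b h).det := by
    rw [h1, Matrix.det_mul, Matrix.det_mul, Matrix.det_transpose, Basis.det_apply]; ring
  have h3 : b.det = b.det e • e.det := AlternatingMap.eq_smul_basis_det _ _
  rw [volumeForm, ← hb, h2, abs_mul, abs_of_nonneg (sq_nonneg (b.det e)),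
    Real.sqrt_mul (sq_nonneg _), Real.sqrt_sq hpos.le]
  conv_lhs => rw [h3]
  rw [smul_smul, mul_comm]

end Seven

end SplitG2

/-!
The three conditions are all equivalent to one normal form, `IsSplitG2Form`: `φ` is a non-zero
multiple of the canonical three-form of a basis that is pseudo-orthonormal for `h`.

The equation is translated into one on spinors. The Clifford algebra of signature `(4,3)` acts on
`ℝ⁸`, the three-form `φ` acts as a traceless symmetric endomorphism `S`, and the Clifford square of
`φ` is `S² = -⟨φ, φ⟩ + S'`, where `S'` is the action of `*(φ △₁ φ)`
(`IsOrthonormalBasis.spinorMatrix_mul_self`). If `⟨φ, φ⟩ = -7t²` and `*(φ △₁ φ) = 6tφ`, then `S² =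
7t² + 6tS`, so that `S` has the eigenvalues `7t` and `-t`; as its trace vanishes, `7t` is simple,
and `S` is determined by a non-null eigenvector `η` (`exists_eigenvector_of_mul_self`). By the Fierz
identity (`spinorMatrix_threeForm`) this means that `φ` is a multiple of the three-form `(x, y, z) ↦
B(η, x y z η)`. Two non-null spinors differ, up to scale, by the Clifford product of two non-null
vectors, which acts on three-forms by reflections; hence the form of `η` is canonical in some
pseudo-orthonormal basis (`exists_basis_threeForm_eq`, `exists_canonical_of_hodge_eq`). Conversely,
`S² = 7 - 6S` for the canonical form (`IsOrthonormalBasis.formInner_hodgeFour_canonical`).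

The normal form implies the condition on the stabilizer because an automorphism `A` that preserves
the canonical form lies in `SO₀` (`IsOrthonormalBasis.stabilizer_le_SO0`). The identity `ι_u φ ∧ ι_v
φ ∧ φ = ± 6 h(u, v) ν` for that form (`wedge_contract_canonicalThreeForm`) shows that `A` multiplies
`h` by `d⁻¹`, where `d = det A`, whence `d⁹ = 1`. The other three components of the isometry group
are represented by reflections (`IsOrthonormalBasis.mem_SO0_cosets`), and they are excluded by the
signs of the determinant and of the values of the canonical form on triples of negative vectors.

Conversely, the invariants of the stabilizer of a canonical form of a basis are the multiples of
this form (`exists_smul_of_stabilizer_le`) and, among the bilinear forms, the multiples of the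
metric for which the basis is pseudo-orthonormal (`exists_smul_of_stabilizer_invariant`). If the
stabilizer, or its intersection with `SO₀`, is a group `G₂* ⊂ SO₀`, then both `φ` and `h` are
invariant under it, and the normal form follows (`IsG2Star.isSplitG2Form`).

By the same identity, a metric for which `e` is pseudo-orthonormal is the only metric induced by
minus the canonical form of `e` (`IsOrthonormalBasis.isInducedMetric_iff`), and a rescaling of the
basis yields the metric induced by any non-zero multiple of that form.
-/

namespace SplitG2

/-! ### Pseudo-orthonormal bases -/

/-- The signs of a pseudo-orthonormal basis of signature `(4,3)`, the positive vectors first. -/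
def eps : Fin 7 → ℝ := ![1, 1, 1, 1, -1, -1, -1]

lemma eps_mul_self (i : Fin 7) : eps i * eps i = 1 := by
  fin_cases i <;> simp [eps]

lemma eps_ne_zero (i : Fin 7) : eps i ≠ 0 := by
  fin_cases i <;> simp [eps]

section Metric

variable {V : Type*} [AddCommGroup V] [Module ℝ V]

/-- `e` is a pseudo-orthonormal basis of `(V, h)`, its positive vectors first. -/
def IsOrthonormalBasis (h : LinearMap.BilinForm ℝ V) (e : Basis (Fin 7) ℝ V) : Prop :=
  ∀ i j, h (e i) (e j) = if i = j then eps i else 0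

lemma bilin_eq_of_basis {h g : LinearMap.BilinForm ℝ V} {e : Basis (Fin 7) ℝ V}
    (H : ∀ i j, h (e i) (e j) = g (e i) (e j)) : h = g :=
  LinearMap.ext_basis e e H

lemma IsOrthonormalBasis.apply_eq_sum {h : LinearMap.BilinForm ℝ V} {e : Basis (Fin 7) ℝ V}
    (he : IsOrthonormalBasis h e) (x y : V) :
    h x y = ∑ i, eps i * e.repr x i * e.repr y i := by
  conv_lhs => rw [← e.sum_repr x, ← e.sum_repr y]
  simp only [map_sum, LinearMap.sum_apply, map_smul, LinearMap.smul_apply, smul_eq_mul, he _ _,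
    mul_ite, mul_zero, Finset.sum_ite_eq', Finset.mem_univ, if_true]
  exact Finset.sum_congr rfl fun i _ => by ring

lemma equivalent_weightedSumSquares_of_diagonal {h : LinearMap.BilinForm ℝ V} {w : Fin 7 → ℝ}
    (e : Basis (Fin 7) ℝ V) (he : ∀ i j, h (e i) (e j) = if i = j then w i else 0) :
    h.toQuadraticMap.Equivalent (QuadraticMap.weightedSumSquares ℝ w) := by
  refine ⟨{ e.equivFun with map_app' := fun x => ?_ }⟩
  conv_rhs => rw [LinearMap.BilinMap.toQuadraticMap_apply, ← e.sum_repr x]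
  simp only [map_sum, LinearMap.sum_apply, map_smul, LinearMap.smul_apply, smul_eq_mul, he _ _,
    mul_ite, mul_zero, Finset.sum_ite_eq', Finset.mem_univ, if_true]
  simp only [QuadraticMap.weightedSumSquares_apply, smul_eq_mul]
  exact Finset.sum_congr rfl fun i _ => by simp; ring

lemma isSymm_of_diagonal {h : LinearMap.BilinForm ℝ V} {w : Fin 7 → ℝ}
    (e : Basis (Fin 7) ℝ V) (he : ∀ i j, h (e i) (e j) = if i = j then w i else 0) :
    h.IsSymm := by
  have : h = LinearMap.flip h := bilin_eq_of_basis (e := e) fun i j => by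
    change _ = h (e j) (e i)
    rw [he, he]
    by_cases hij : i = j
    · simp [hij]
    · simp [hij, Ne.symm hij]
  exact ⟨fun x y => DFunLike.congr_fun (DFunLike.congr_fun this x) y⟩

lemma IsOrthonormalBasis.hasSignature {h : LinearMap.BilinForm ℝ V} {e : Basis (Fin 7) ℝ V}
    (he : IsOrthonormalBasis h e) : HasSignature43 h := by
  have hq := equivalent_weightedSumSquares_of_diagonal e he
  refine ⟨isSymm_of_diagonal e he, ?_, ?_⟩
  · rw [QuadraticForm.sigPos_of_equiv_weightedSumSquares hq]
    have : {i | 0 < eps i} = ((({0, 1, 2, 3} : Finset (Fin 7)) : Set (Fin 7))) := by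
      ext i; fin_cases i <;> simp [eps]
    rw [this, Set.ncard_coe_finset]; rfl
  · rw [QuadraticForm.sigNeg_of_equiv_weightedSumSquares hq]
    have : {i | eps i < 0} = ((({4, 5, 6} : Finset (Fin 7)) : Set (Fin 7))) := by
      ext i; fin_cases i <;> simp [eps]
    rw [this, Set.ncard_coe_finset]; rfl

/-- A metric that is a multiple of another one of the same signature `(4,3)` is a positive
multiple. -/
lemma pos_of_smul_hasSignature {h : LinearMap.BilinForm ℝ V} {e : Basis (Fin 7) ℝ V} {c : ℝ}
    (he : ∀ i j, h (e i) (e j) = if i = j then c * eps i else 0) (hh : HasSignature43 h) :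
    0 < c := by
  have hq := equivalent_weightedSumSquares_of_diagonal e he
  have h4 := hh.2.1
  rw [QuadraticForm.sigPos_of_equiv_weightedSumSquares hq] at h4
  by_contra hc
  have : {i | 0 < c * eps i} ⊆ ((({4, 5, 6} : Finset (Fin 7)) : Set (Fin 7))) := by
    intro i; fin_cases i <;> simp [eps] <;> linarith
  have := Set.ncard_le_ncard this (Finset.finite_toSet _)
  rw [h4, Set.ncard_coe_finset] at this
  exact absurd this (by decide)

lemma IsOrthonormalBasis.toMatrix_det {h : LinearMap.BilinForm ℝ V} {e : Basis (Fin 7) ℝ V}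
    (he : IsOrthonormalBasis h e) : (LinearMap.BilinForm.toMatrix e h).det = -1 := by
  have : LinearMap.BilinForm.toMatrix e h = Matrix.diagonal eps := by
    ext i j
    rw [LinearMap.BilinForm.toMatrix_apply, he, Matrix.diagonal_apply]
  rw [this, Matrix.det_diagonal]
  simp [Fin.prod_univ_succ, eps]

lemma IsOrthonormalBasis.adjustToOrientation {h : LinearMap.BilinForm ℝ V}
    {e : Basis (Fin 7) ℝ V} (he : IsOrthonormalBasis h e) (o : Orientation ℝ V (Fin 7)) :
    IsOrthonormalBasis h (e.adjustToOrientation o) := by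
  intro i j
  by_cases hij : i = j
  · subst hij
    rcases e.adjustToOrientation_apply_eq_or_eq_neg o i with h1 | h1 <;> rw [h1] <;> simp [he _ _]
  · rcases e.adjustToOrientation_apply_eq_or_eq_neg o i with h1 | h1 <;>
    rcases e.adjustToOrientation_apply_eq_or_eq_neg o j with h2 | h2 <;>
    rw [h1, h2] <;> simp [he _ _, hij]

end Metric

section Seven

variable {V : Type*} [AddCommGroup V] [Module ℝ V] [Fact (finrank ℝ V = 7)]

lemma HasSignature43.exists_orthonormalBasis {h : LinearMap.BilinForm ℝ V}
    (hh : HasSignature43 h) : ∃ e, IsOrthonormalBasis h e := by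
  have : FiniteDimensional ℝ V := Module.finite_of_finrank_eq_succ (n := 6) Fact.out
  have h7 : finrank ℝ V = 7 := Fact.out
  obtain ⟨v, hv⟩ := LinearMap.BilinForm.exists_orthogonal_basis (B := h) ⟨hh.1.eq⟩
  set b : Basis (Fin 7) ℝ V := v.reindex (finCongr h7) with hb
  have hbo : ∀ i j, h (b i) (b j) = if i = j then h (b i) (b i) else 0 := by
    intro i j
    split_ifs with hij
    · rw [hij]
    · rw [hb, Basis.reindex_apply, Basis.reindex_apply]
      exact hv fun H => hij (by simpa using H)
  have hq := equivalent_weightedSumSquares_of_diagonal b hbo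
  have hp := hh.2.1
  have hn := hh.2.2
  rw [QuadraticForm.sigPos_of_equiv_weightedSumSquares hq, Set.ncard_eq_toFinset_card'] at hp
  rw [QuadraticForm.sigNeg_of_equiv_weightedSumSquares hq, Set.ncard_eq_toFinset_card'] at hn
  have h0 : ∀ i, h (b i) (b i) ≠ 0 := by
    intro i hi
    refine b.ne_zero i (hh.nondegenerate.1 _ fun y => ?_)
    rw [← b.sum_repr y]
    simp only [map_sum, map_smul, smul_eq_mul]
    refine Finset.sum_eq_zero fun j _ => ?_
    rw [hbo, hi]; simp
  -- a permutation moving the positive vectors in front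
  have hcard : Fintype.card {i : Fin 7 // 0 < eps i} =
      Fintype.card {i // 0 < h (b i) (b i)} := by
    rw [Fintype.card_subtype, Fintype.card_subtype]
    have h1 : (Finset.univ.filter fun i => 0 < eps i) = {0, 1, 2, 3} := by
      ext i; rw [Finset.mem_filter_univ]; fin_cases i <;> simp [eps]
    rw [h1, show ({0, 1, 2, 3} : Finset (Fin 7)).card = 4 from rfl, ← hp]
    congr 1; ext i; simp only [Finset.mem_filter_univ, Set.mem_toFinset, Set.mem_ofPred_eq]
  let σ : Equiv.Perm (Fin 7) := (Fintype.equivOfCardEq hcard).extendSubtype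
  have hσ : ∀ i, 0 < eps i ↔ 0 < h (b (σ i)) (b (σ i)) := by
    intro i
    constructor
    · intro hi
      exact Equiv.extendSubtype_mem (Fintype.equivOfCardEq hcard) i hi
    · intro hi
      by_contra hi'
      exact Equiv.extendSubtype_not_mem (Fintype.equivOfCardEq hcard) i hi' hi
  -- normalize the vectors of the orthogonal basis
  have hs : ∀ i, √|h (b (σ i)) (b (σ i))| ≠ 0 := fun i =>
    (Real.sqrt_pos.mpr (abs_pos.mpr (h0 _))).ne'
  refine ⟨(b.reindex σ.symm).isUnitSMul (w := fun i => (√|h (b (σ i)) (b (σ i))|)⁻¹)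
    fun i => (inv_ne_zero (hs i)).isUnit, fun i j => ?_⟩
  simp only [Basis.isUnitSMul_apply, Basis.reindex_apply, Equiv.symm_symm, map_smul,
    LinearMap.smul_apply, smul_eq_mul]
  rw [hbo (σ i) (σ j)]
  by_cases hij : i = j
  · subst hij
    have h2 : √|h (b (σ i)) (b (σ i))| * √|h (b (σ i)) (b (σ i))| = |h (b (σ i)) (b (σ i))| :=
      Real.mul_self_sqrt (abs_nonneg _)
    have h3 : |h (b (σ i)) (b (σ i))| * eps i = h (b (σ i)) (b (σ i)) := by
      by_cases hi : 0 < eps i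
      · rw [abs_of_pos ((hσ i).mp hi)]
        have : eps i = 1 := by
          revert hi; fin_cases i <;> simp [eps]
        rw [this, mul_one]
      · have hn : ¬ 0 < h (b (σ i)) (b (σ i)) := fun H => hi ((hσ i).mpr H)
        rw [abs_of_nonpos (not_lt.mp hn)]
        have : eps i = -1 := by
          revert hi; fin_cases i <;> simp [eps]
        rw [this]; ring
    rw [if_pos rfl, ← mul_assoc, ← mul_inv, h2, if_pos rfl]
    nth_rewrite 2 [← h3]
    rw [← mul_assoc, inv_mul_cancel₀ (abs_ne_zero.mpr (h0 _)), one_mul]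
  · rw [if_neg fun H => hij (σ.injective H), if_neg hij]; simp

lemma IsOrthonormalBasis.recip_eq {h : LinearMap.BilinForm ℝ V} {e : Basis (Fin 7) ℝ V}
    (he : IsOrthonormalBasis h e) (i : Fin 7) : recip h e i = eps i • e i := by
  have hnd := he.hasSignature.nondegenerate
  refine sub_eq_zero.mp (hnd.1 _ fun y => ?_)
  rw [← e.sum_repr y]
  simp only [map_sum, map_smul, map_sub, LinearMap.sub_apply, recip_pair h hnd,
    LinearMap.smul_apply, he _ _, smul_eq_mul]
  refine Finset.sum_eq_zero fun j _ => ?_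
  by_cases hij : i = j
  · simp [hij, eps_mul_self]
  · simp [hij]

lemma IsOrthonormalBasis.volumeForm_eq {h : LinearMap.BilinForm ℝ V} {e : Basis (Fin 7) ℝ V}
    (he : IsOrthonormalBasis h e) (o : Orientation ℝ V (Fin 7)) :
    ∃ s : ℝ, (s = 1 ∨ s = -1) ∧ volumeForm h o = s • e.det := by
  rw [SplitG2.volumeForm_eq h o (e.adjustToOrientation o) (e.orientation_adjustToOrientation o),
    (he.adjustToOrientation o).toMatrix_det]
  rcases e.det_adjustToOrientation o with h1 | h1
  · exact ⟨1, Or.inl rfl, by rw [h1]; simp⟩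
  · exact ⟨-1, Or.inr rfl, by
      rw [h1, abs_neg, abs_one, Real.sqrt_one, one_smul]; exact (neg_one_smul ℝ _).symm⟩

end Seven

/-! ### Wedge products, three-forms and the Hodge operator in components -/

section Wedge

variable {V : Type*} [AddCommGroup V] [Module ℝ V]

lemma wedge_apply {p q : ℕ} (α : ExtForm V p) (β : ExtForm V q) (x : Fin (p + q) → V) :
    wedge α β x = ∑ σ : Equiv.Perm.ModSumCongr (Fin p) (Fin q),
      LinearMap.mul' ℝ ℝ (AlternatingMap.domCoprod.summand α β σ (x ∘ finSumFinEquiv)) := by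
  simp only [wedge, AlternatingMap.domDomCongr_apply, LinearMap.compAlternatingMap_apply,
    AlternatingMap.domCoprod_apply, sum_apply, map_sum]

lemma mul'_summand_mk {p q : ℕ} (α : ExtForm V p) (β : ExtForm V q) (x : Fin p ⊕ Fin q → V)
    (σ : Equiv.Perm (Fin p ⊕ Fin q)) :
    LinearMap.mul' ℝ ℝ (AlternatingMap.domCoprod.summand α β (Quotient.mk'' σ) x) =
      ((Equiv.Perm.sign σ : ℤ) : ℝ) *
        (α (fun a => x (σ (Sum.inl a))) * β (fun a => x (σ (Sum.inr a)))) := by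
  rw [AlternatingMap.domCoprod.summand_mk'', smul_apply, Units.smul_def, map_zsmul,
    zsmul_eq_mul]
  rfl

/-- If all shuffles but the trivial one contribute zero to `α ∧ β`, then `α ∧ β` is given by
inserting the first vectors into `α` and the last ones into `β`. -/
lemma wedge_apply_of_unique_shuffle {p q : ℕ} (α : ExtForm V p) (β : ExtForm V q)
    (x : Fin (p + q) → V)
    (H : ∀ (σ : Equiv.Perm (Fin p ⊕ Fin q)) (a : Fin q) (b : Fin p), σ (Sum.inr a) = Sum.inl b →
      β (fun a => x (finSumFinEquiv (σ (Sum.inr a)))) = 0) :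
    wedge α β x = α (fun a => x (Fin.castAdd q a)) * β (fun a => x (Fin.natAdd p a)) := by
  rw [wedge_apply]
  refine (Finset.sum_eq_single (Quotient.mk'' 1 : Equiv.Perm.ModSumCongr (Fin p) (Fin q))
    ?_ ?_).trans ?_
  · intro σ _ hσ
    induction σ using Quotient.inductionOn' with | _ σ
    rw [mul'_summand_mk]
    have : ¬ Set.MapsTo σ (Set.range Sum.inr) (Set.range Sum.inr) := by
      intro hm
      rw [← Equiv.Perm.perm_mapsTo_inl_iff_mapsTo_inr] at hm
      refine hσ (Quotient.sound' ?_)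
      rw [QuotientGroup.leftRel_apply, mul_one]
      exact inv_mem (Equiv.Perm.mem_sumCongrHom_range_of_perm_mapsTo_inl hm)
    simp only [Set.MapsTo, Set.mem_range, forall_exists_index, not_forall] at this
    obtain ⟨_, a, rfl, h2⟩ := this
    rcases hb : σ (Sum.inr a) with b | b
    · have := H σ a b hb
      simp only [Function.comp_apply]
      rw [this]; simp
    · exact absurd ⟨b, hb.symm⟩ h2
  · simp
  · rw [mul'_summand_mk]
    simp

/-- A sum over the symmetric group on four letters, written out. -/
lemma sum_perm_fin_four (F : Fin 4 → Fin 4 → Fin 4 → Fin 4 → ℝ) :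
    ∑ σ : Equiv.Perm (Fin 4), ((Equiv.Perm.sign σ : ℤ) : ℝ) * F (σ 0) (σ 1) (σ 2) (σ 3) =
      F 0 1 2 3 - F 0 1 3 2 - F 0 2 1 3 + F 0 2 3 1 - F 0 3 2 1 + F 0 3 1 2
      - F 1 0 2 3 + F 1 0 3 2 + F 1 2 0 3 - F 1 2 3 0 + F 1 3 2 0 - F 1 3 0 2
      - F 2 1 0 3 + F 2 1 3 0 + F 2 0 1 3 - F 2 0 3 1 + F 2 3 0 1 - F 2 3 1 0
      - F 3 1 2 0 + F 3 1 0 2 + F 3 2 1 0 - F 3 2 0 1 + F 3 0 2 1 - F 3 0 1 2 := by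
  have h2 : (2 : Fin 4) = Fin.succ 1 := rfl
  have h3 : (3 : Fin 4) = Fin.succ 2 := rfl
  have h1 : (1 : Fin 4) = Fin.succ 0 := rfl
  have h1' : (1 : Fin 3) = Fin.succ 0 := rfl
  have h2' : (2 : Fin 3) = Fin.succ 1 := rfl
  conv_lhs => rw [h3, h2, h1]
  simp only [Finset.univ_perm_fin_succ, Finset.sum_map, Equiv.coe_toEmbedding,
    Finset.univ_product_univ.symm, Finset.sum_product, Equiv.Perm.decomposeFin_symm_apply_succ,
    Equiv.Perm.decomposeFin_symm_apply_zero, Equiv.Perm.decomposeFin.symm_sign]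
  conv_lhs => rw [h2', h1']
  simp only [Equiv.Perm.decomposeFin_symm_apply_succ, Equiv.Perm.decomposeFin_symm_apply_zero]
  simp [Fin.sum_univ_succ, Equiv.swap_apply_def]
  ring

/-- The wedge product as a sum over all permutations instead of shuffles. -/
lemma factorial_smul_wedge_apply {p q : ℕ} (α : ExtForm V p) (β : ExtForm V q)
    (x : Fin (p + q) → V) :
    ((p.factorial * q.factorial : ℕ) : ℝ) * wedge α β x =
      ∑ σ : Equiv.Perm (Fin (p + q)), ((Equiv.Perm.sign σ : ℤ) : ℝ) *
        (α (fun a => x (σ (Fin.castAdd q a))) * β (fun a => x (σ (Fin.natAdd p a)))) := by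
  have key := congrArg (LinearMap.mul' ℝ ℝ) (DFunLike.congr_fun
    (MultilinearMap.domCoprod_alternization_eq α β) (x ∘ finSumFinEquiv))
  rw [MultilinearMap.alternatization_apply, map_sum, ← Nat.cast_smul_eq_nsmul ℝ,
    AlternatingMap.smul_apply, map_smul, smul_eq_mul, Fintype.card_fin, Fintype.card_fin] at key
  refine key.symm.trans (Fintype.sum_equiv (Equiv.permCongr finSumFinEquiv) _ _ fun σ => ?_)
  rw [Equiv.Perm.sign_permCongr, Units.smul_def, map_zsmul, zsmul_eq_mul]
  simp [MultilinearMap.domCoprod_apply]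

lemma wedge_two_two_apply (α β : ExtForm V 2) (x : Fin 4 → V) :
    wedge α β x =
      α ![x 0, x 1] * β ![x 2, x 3] - α ![x 0, x 2] * β ![x 1, x 3]
      + α ![x 0, x 3] * β ![x 1, x 2] + α ![x 1, x 2] * β ![x 0, x 3]
      - α ![x 1, x 3] * β ![x 0, x 2] + α ![x 2, x 3] * β ![x 0, x 1] := by
  have hc : ∀ (γ : ExtForm V 2) (u : Fin 2 → V), γ u = γ ![u 0, u 1] := fun γ u =>
    congrArg γ (by funext a; fin_cases a <;> rfl)
  have hs : ∀ (γ : ExtForm V 2) (u v : V), γ ![v, u] = -γ ![u, v] := by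
    intro γ u v
    have := γ.map_swap ![u, v] (i := 0) (j := 1) (by decide)
    rw [← this]
    exact congrArg γ (by funext a; fin_cases a <;> rfl)
  have key := (factorial_smul_wedge_apply α β x).trans (Finset.sum_congr rfl fun σ _ => show _ =
    ((Equiv.Perm.sign σ : ℤ) : ℝ) * (α ![x (σ 0), x (σ 1)] * β ![x (σ 2), x (σ 3)]) by
      rw [hc α, hc β]; rfl)
  have := key.trans (sum_perm_fin_four fun i j k l => α ![x i, x j] * β ![x k, x l])
  simp only [hs _ (x 0) (x 1), hs _ (x 0) (x 2), hs _ (x 0) (x 3), hs _ (x 1) (x 2),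
    hs _ (x 1) (x 3), hs _ (x 2) (x 3)] at this
  norm_num [Nat.factorial] at this
  linarith

lemma wedge_compLinearMap {p q : ℕ} (α : ExtForm V p) (β : ExtForm V q) (A : V →ₗ[ℝ] V) :
    wedge (α.compLinearMap A) (β.compLinearMap A) = (wedge α β).compLinearMap A := by
  ext x
  have h0 : ((p.factorial * q.factorial : ℕ) : ℝ) ≠ 0 := by positivity
  apply mul_left_cancel₀ h0
  rw [factorial_smul_wedge_apply, AlternatingMap.compLinearMap_apply, factorial_smul_wedge_apply]
  rfl

lemma alternatingMap_sum_apply {ι : Type*} {k : ℕ} (s : Finset ι) (f : ι → ExtForm V k)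
    (x : Fin k → V) : (∑ i ∈ s, f i) x = ∑ i ∈ s, f i x :=
  map_sum (⟨⟨fun α => α x, rfl⟩, fun _ _ => rfl⟩ : ExtForm V k →+ ℝ) f s

lemma contract_apply {k : ℕ} (v : V) (α : ExtForm V (k + 1)) (x : Fin k → V) :
    contract v α x = α (Matrix.vecCons v x) := rfl

end Wedge

section ThreeForm

variable {V : Type*} [AddCommGroup V] [Module ℝ V]

lemma threeForm_eq (φ : ExtForm V 3) (x : Fin 3 → V) : φ x = φ ![x 0, x 1, x 2] :=
  congrArg φ (by funext a; fin_cases a <;> rfl)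

lemma threeForm_swap_left (φ : ExtForm V 3) (x y z : V) : φ ![y, x, z] = -φ ![x, y, z] := by
  rw [← φ.map_swap ![x, y, z] (i := 0) (j := 1) (by decide)]
  exact congrArg φ (by funext a; fin_cases a <;> rfl)

lemma threeForm_swap_right (φ : ExtForm V 3) (x y z : V) : φ ![x, z, y] = -φ ![x, y, z] := by
  rw [← φ.map_swap ![x, y, z] (i := 1) (j := 2) (by decide)]
  exact congrArg φ (by funext a; fin_cases a <;> rfl)

/-- The totally antisymmetric extension of coefficients given for increasing indices. -/
def antisymm (w : Fin 7 → Fin 7 → Fin 7 → ℝ) (i j k : Fin 7) : ℝ :=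
  if i < j ∧ j < k then w i j k else if j < k ∧ k < i then w j k i
  else if k < i ∧ i < j then w k i j else if j < i ∧ i < k then -w j i k
  else if i < k ∧ k < j then -w i k j else if k < j ∧ j < i then -w k j i else 0

/-- The components of a three-form, reduced to those with increasing indices. -/
lemma antisymm_basis (φ : ExtForm V 3) (e : Fin 7 → V) (i j k : Fin 7) :
    φ ![e i, e j, e k] = antisymm (fun i j k => φ ![e i, e j, e k]) i j k := by
  have hl := threeForm_swap_left φ
  have hr := threeForm_swap_right φ
  have h0 : ∀ x y, φ ![x, x, y] = 0 := fun x y => by linarith [hl x x y]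
  have h1 : ∀ x y, φ ![y, x, x] = 0 := fun x y => by linarith [hr y x x]
  have h2 : ∀ x y, φ ![x, y, x] = 0 := fun x y => by linarith [hr x x y, h0 x y]
  unfold antisymm
  beta_reduce
  split_ifs with c1 c2 c3 c4 c5 c6
  · rfl
  · rw [hr (e j) (e i) (e k), hl]
  · rw [hl (e i) (e k) (e j), hr (e i)]
  · rw [hl (e i) (e j), neg_neg]
  · rw [hr (e i) (e j), neg_neg]
  · rw [hl (e j) (e k), hr (e j) (e i), hl (e i) (e j)]; ring
  · have : i = j ∨ j = k ∨ i = k := by omega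
    rcases this with rfl | rfl | rfl
    · exact h0 _ _
    · exact h1 _ _
    · exact h2 _ _

/-- A three-form is determined by its components with increasing indices. -/
lemma threeForm_ext {φ ψ : ExtForm V 3} (e : Basis (Fin 7) ℝ V)
    (H : ∀ i j k, i < j → j < k → φ ![e i, e j, e k] = ψ ![e i, e j, e k]) : φ = ψ := by
  refine e.ext_alternating fun v _ => ?_
  rw [threeForm_eq φ, threeForm_eq ψ, antisymm_basis φ, antisymm_basis ψ]
  unfold antisymm
  beta_reduce
  split_ifs with c1 c2 c3 c4 c5 c6
  · exact H _ _ _ c1.1 c1.2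
  · exact H _ _ _ c2.1 c2.2
  · exact H _ _ _ c3.1 c3.2
  · rw [H _ _ _ c4.1 c4.2]
  · rw [H _ _ _ c5.1 c5.2]
  · rw [H _ _ _ c6.1 c6.2]
  · rfl

end ThreeForm

section Seven

variable {V : Type*} [AddCommGroup V] [Module ℝ V] [Fact (finrank ℝ V = 7)]
  {h : LinearMap.BilinForm ℝ V} {e : Basis (Fin 7) ℝ V}

lemma IsOrthonormalBasis.formInner_eq (he : IsOrthonormalBasis h e) (φ : ExtForm V 3) :
    formInner h φ φ = (6 : ℝ)⁻¹ * ∑ i, ∑ j, ∑ k,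
      eps i * eps j * eps k * φ ![e i, e j, e k] ^ 2 := by
  rw [formInner_eq_sum he.hasSignature e]
  rw [show ((Nat.factorial 3 : ℕ) : ℝ) = 6 by norm_num [Nat.factorial]]
  congr 1
  rw [← (Fin.consEquiv fun _ : Fin 3 => Fin 7).sum_comp, Fintype.sum_prod_type]
  refine Finset.sum_congr rfl fun i _ => ?_
  rw [← (Fin.consEquiv fun _ : Fin 2 => Fin 7).sum_comp, Fintype.sum_prod_type]
  refine Finset.sum_congr rfl fun j _ => ?_
  rw [← (Equiv.funUnique (Fin 1) (Fin 7)).symm.sum_comp]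
  refine Finset.sum_congr rfl fun k _ => ?_
  have := (φ : MultilinearMap ℝ (fun _ : Fin 3 => V) ℝ).map_smul_univ ![eps i, eps j, eps k]
    ![e i, e j, e k]
  simp only [AlternatingMap.coe_multilinearMap, Fin.prod_univ_three, smul_eq_mul] at this
  rw [threeForm_eq φ, threeForm_eq φ fun a => recip h e _]
  simp only [he.recip_eq]
  rw [threeForm_eq φ] at this
  change φ ![e i, e j, e k] * φ ![eps i • e i, eps j • e j, eps k • e k] = _
  change φ ![eps i • e i, eps j • e j, eps k • e k] = eps i * eps j * eps k * _ at this
  rw [this]; ring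

lemma IsOrthonormalBasis.triangleOne_apply (he : IsOrthonormalBasis h e) (φ : ExtForm V 3)
    (x : Fin 4 → V) :
    triangleOne h φ φ x = 2 * ∑ m, eps m *
      (φ ![e m, x 0, x 1] * φ ![e m, x 2, x 3] - φ ![e m, x 0, x 2] * φ ![e m, x 1, x 3]
        + φ ![e m, x 0, x 3] * φ ![e m, x 1, x 2]) := by
  have hsm : ∀ m, contract (eps m • e m) φ = eps m • contract (e m) φ := fun m => by
    simp only [contract, map_smul]
  rw [triangleOne_eq_sum he.hasSignature e, alternatingMap_sum_apply, Finset.mul_sum]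
  refine Finset.sum_congr rfl fun m _ => ?_
  rw [he.recip_eq, hsm, wedge_smul_right, AlternatingMap.smul_apply, wedge_two_two_apply]
  simp only [contract_apply, smul_eq_mul]
  ring

/-- The components of the Hodge dual of a four-form in a pseudo-orthonormal basis. The `4!`
non-zero terms of the sum that defines it are those of the permutations of four basis vectors,
and they coincide. -/
lemma IsOrthonormalBasis.hodgeFour_apply_perm (he : IsOrthonormalBasis h e)
    {o : Orientation ℝ V (Fin 7)} {s : ℝ} (hs : volumeForm h o = s • e.det) (β : ExtForm V 4)
    (σ : Equiv.Perm (Fin 7)) :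
    hodgeFour h o β ![e (σ 4), e (σ 5), e (σ 6)] =
      s * ((Equiv.Perm.sign σ : ℤ) : ℝ) * (eps (σ 0) * eps (σ 1) * eps (σ 2) * eps (σ 3) *
        β ![e (σ 0), e (σ 1), e (σ 2), e (σ 3)]) := by
  -- the permutations of the first four vectors, as index maps
  have hinj : Function.Injective fun (τ : Equiv.Perm (Fin 4)) (a : Fin 4) =>
      σ (Fin.castAdd 3 (τ a)) := by
    intro τ τ' hτ
    ext a
    have := congrFun hτ a
    simp at this
    exact congrArg Fin.val (Fin.castAdd_injective _ _ this)
  have hβ : ∀ i : Fin 4 → Fin 7, β (fun a => recip h e (i a)) =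
      (∏ a, eps (i a)) * β (fun a => e (i a)) := by
    intro i
    simp only [he.recip_eq]
    exact (β : MultilinearMap ℝ (fun _ : Fin 4 => V) ℝ).map_smul_univ _ _
  rw [hodgeFour_apply he.hasSignature e, hs]
  rw [← Finset.sum_of_injOn (s := Finset.univ) (fun (τ : Equiv.Perm (Fin 4)) (a : Fin 4) =>
      σ (Fin.castAdd 3 (τ a))) (f := fun _ => s * ((Equiv.Perm.sign σ : ℤ) : ℝ) *
      (eps (σ 0) * eps (σ 1) * eps (σ 2) * eps (σ 3) *
        β ![e (σ 0), e (σ 1), e (σ 2), e (σ 3)])) hinj.injOn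
      (fun _ _ => Finset.mem_coe.mpr (Finset.mem_univ _))]
  · rw [Finset.sum_const, Finset.card_univ, Fintype.card_perm, Fintype.card_fin, nsmul_eq_mul]
    norm_num [Nat.factorial]
    ring
  -- all other index maps repeat a vector
  · intro i _ hi
    have : e.det ![e (i 0), e (i 1), e (i 2), e (i 3), e (σ 4), e (σ 5), e (σ 6)] = 0 := by
      by_contra hne
      have hinj7 : Function.Injective ![i 0, i 1, i 2, i 3, σ 4, σ 5, σ 6] := by
        intro a b hab
        by_contra hab'
        refine hne (e.det.map_eq_zero_of_eq _ ?_ hab')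
        have : ![e (i 0), e (i 1), e (i 2), e (i 3), e (σ 4), e (σ 5), e (σ 6)] =
            fun a => e (![i 0, i 1, i 2, i 3, σ 4, σ 5, σ 6] a) := by
          funext a; fin_cases a <;> rfl
        rw [this]
        exact congrArg e hab
      have hlt : ∀ a, (σ.symm (i a)).val < 4 := by
        intro a
        by_contra ha
        obtain ⟨b, hb⟩ : ∃ b : Fin 3, σ.symm (i a) = Fin.natAdd 4 b :=
          ⟨⟨(σ.symm (i a)).val - 4, by omega⟩, by ext; simp; omega⟩
        have hb' : i a = σ (Fin.natAdd 4 b) := by rw [← hb, Equiv.apply_symm_apply]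
        have h1 : ![i 0, i 1, i 2, i 3, σ 4, σ 5, σ 6] (Fin.castAdd 3 a) = i a := by
          fin_cases a <;> rfl
        have h2 : ![i 0, i 1, i 2, i 3, σ 4, σ 5, σ 6] (Fin.natAdd 4 b) =
            σ (Fin.natAdd 4 b) := by
          fin_cases b <;> rfl
        have h3 := hinj7 (h1.trans (hb'.trans h2.symm))
        have := congrArg Fin.val h3
        simp at this
        omega
      have hinj4 : Function.Injective fun a : Fin 4 => (⟨(σ.symm (i a)).val, hlt a⟩ : Fin 4) := by
        intro a b hab
        have h0 : i a = i b := σ.symm.injective (Fin.ext (by simpa using hab))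
        have h1 : ∀ a : Fin 4, ![i 0, i 1, i 2, i 3, σ 4, σ 5, σ 6] (Fin.castAdd 3 a) = i a := by
          intro a; fin_cases a <;> rfl
        exact Fin.castAdd_injective _ _ (hinj7 ((h1 a).trans (h0.trans (h1 b).symm)))
      refine hi ⟨Equiv.ofBijective _ (Finite.injective_iff_bijective.mp hinj4), by simp, ?_⟩
      funext a
      have : Fin.castAdd 3 (⟨(σ.symm (i a)).val, hlt a⟩ : Fin 4) = σ.symm (i a) := rfl
      simp [this]
    rw [AlternatingMap.smul_apply]
    simp only [Matrix.cons_val_zero, Matrix.cons_val_one, Matrix.cons_val]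
    rw [this]; simp
  · intro τ _
    rw [hβ]
    have h1 : β (fun a => e (σ (Fin.castAdd 3 (τ a)))) =
        ((Equiv.Perm.sign τ : ℤ) : ℝ) * β ![e (σ 0), e (σ 1), e (σ 2), e (σ 3)] := by
      have := β.map_perm ![e (σ 0), e (σ 1), e (σ 2), e (σ 3)] τ
      rw [Units.smul_def, zsmul_eq_mul] at this
      rw [← this]
      congr 1
      funext a
      simp only [Function.comp_apply]
      generalize τ a = b
      fin_cases b <;> rfl
    have h2 : ∏ a, eps (σ (Fin.castAdd 3 (τ a))) =
        eps (σ 0) * eps (σ 1) * eps (σ 2) * eps (σ 3) := by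
      rw [Equiv.prod_comp τ fun a => eps (σ (Fin.castAdd 3 a)), Fin.prod_univ_four]
      rfl
    have h3 : e.det ![e (σ (Fin.castAdd 3 (τ 0))), e (σ (Fin.castAdd 3 (τ 1))),
        e (σ (Fin.castAdd 3 (τ 2))), e (σ (Fin.castAdd 3 (τ 3))), e (σ 4), e (σ 5), e (σ 6)] =
        ((Equiv.Perm.sign τ : ℤ) : ℝ) * ((Equiv.Perm.sign σ : ℤ) : ℝ) := by
      set τ' : Equiv.Perm (Fin 7) := finSumFinEquiv.permCongr (τ.sumCongr (1 : Equiv.Perm (Fin 3)))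
        with hτ'
      have hv : ![e (σ (Fin.castAdd 3 (τ 0))), e (σ (Fin.castAdd 3 (τ 1))),
        e (σ (Fin.castAdd 3 (τ 2))), e (σ (Fin.castAdd 3 (τ 3))), e (σ 4), e (σ 5), e (σ 6)] =
          e ∘ (σ * τ') := by
        funext a; fin_cases a <;> rfl
      rw [hv, e.det.map_perm, e.det_self, Equiv.Perm.sign_mul, hτ', Equiv.Perm.sign_permCongr,
        Equiv.Perm.sign_sumCongr, Units.smul_def]
      simp [mul_comm]
    have h4 : ((Equiv.Perm.sign τ : ℤ) : ℝ) * ((Equiv.Perm.sign τ : ℤ) : ℝ) = 1 := by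
      rw [← Int.cast_mul, ← Units.val_mul, Int.units_mul_self]; simp
    rw [AlternatingMap.smul_apply]
    simp only [Matrix.cons_val_zero, Matrix.cons_val_one, Matrix.cons_val]
    rw [h1, h2, h3, smul_eq_mul]
    linear_combination (-(s * ((Equiv.Perm.sign σ : ℤ) : ℝ)) * (eps (σ 0) * eps (σ 1) * eps (σ 2) *
      eps (σ 3) * β ![e (σ 0), e (σ 1), e (σ 2), e (σ 3)])) * h4

end Seven

/-! ### Spinors: the action of vectors and of three-forms -/

/-- Clifford multiplication by `v` on the spinors `ℝ⁸ = ℝ ⊕ ℝ⁷`. In terms of the cross product of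
the canonical three-form it is given by `γ_v 1 = v` and `γ_v w = h(v, w) + v × w`. -/
def gamma (v : Fin 7 → ℝ) : Matrix (Fin 8) (Fin 8) ℝ :=
  !![0, v 0, v 1, v 2, v 3, -v 4, -v 5, -v 6;
    v 0, 0, v 6, v 4, -v 5, -v 2, v 3, -v 1;
    v 1, -v 6, 0, -v 5, -v 4, v 3, v 2, v 0;
    v 2, -v 4, v 5, 0, v 6, v 0, -v 1, -v 3;
    v 3, v 5, v 4, -v 6, 0, -v 1, -v 0, v 2;
    v 4, -v 2, v 3, v 0, -v 1, 0, v 6, -v 5;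
    v 5, v 3, v 2, -v 1, -v 0, -v 6, 0, v 4;
    v 6, -v 1, v 0, -v 3, v 2, v 5, -v 4, 0]

/-- The endomorphism `∑ ε_i ε_j ε_k c_{ijk} γ_i γ_j γ_k`, summed over `i < j < k`, by which the
three-form with the components `c` acts on spinors. Only the components with increasing indices
enter, and the matrix is written out in them. -/
def spinorMatrix (c : Fin 7 → Fin 7 → Fin 7 → ℝ) : Matrix (Fin 8) (Fin 8) ℝ :=
  !![c 0 1 6 + c 0 2 4 - c 0 3 5 - c 1 2 5 - c 1 3 4 + c 2 3 6 - c 4 5 6,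
      c 1 2 3 - c 1 4 5 - c 2 5 6 - c 3 4 6, -c 0 2 3 + c 0 4 5 - c 2 4 6 + c 3 5 6,
      c 0 1 3 + c 0 5 6 + c 1 4 6 - c 3 4 5, -c 0 1 2 + c 0 4 6 - c 1 5 6 + c 2 4 5,
      c 0 1 5 + c 0 3 6 + c 1 2 6 + c 2 3 5, -c 0 1 4 + c 0 2 6 - c 1 3 6 - c 2 3 4,
      -c 0 2 5 - c 0 3 4 - c 1 2 4 + c 1 3 5;
    -c 1 2 3 + c 1 4 5 + c 2 5 6 + c 3 4 6,
      c 0 1 6 + c 0 2 4 - c 0 3 5 + c 1 2 5 + c 1 3 4 - c 2 3 6 + c 4 5 6,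
      -c 0 2 5 - c 0 3 4 + c 1 2 4 - c 1 3 5, c 0 1 5 + c 0 3 6 - c 1 2 6 - c 2 3 5,
      c 0 1 4 - c 0 2 6 - c 1 3 6 - c 2 3 4, c 0 1 3 + c 0 5 6 - c 1 4 6 + c 3 4 5,
      c 0 1 2 - c 0 4 6 - c 1 5 6 + c 2 4 5, -c 0 2 3 + c 0 4 5 + c 2 4 6 - c 3 5 6;
    c 0 2 3 - c 0 4 5 + c 2 4 6 - c 3 5 6, -c 0 2 5 - c 0 3 4 + c 1 2 4 - c 1 3 5,
      c 0 1 6 - c 0 2 4 + c 0 3 5 - c 1 2 5 - c 1 3 4 - c 2 3 6 + c 4 5 6,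
      c 0 1 4 + c 0 2 6 + c 1 3 6 - c 2 3 4, -c 0 1 5 + c 0 3 6 - c 1 2 6 + c 2 3 5,
      c 0 1 2 + c 0 4 6 + c 1 5 6 + c 2 4 5, -c 0 1 3 + c 0 5 6 - c 1 4 6 - c 3 4 5,
      -c 1 2 3 + c 1 4 5 - c 2 5 6 - c 3 4 6;
    -c 0 1 3 - c 0 5 6 - c 1 4 6 + c 3 4 5, c 0 1 5 + c 0 3 6 - c 1 2 6 - c 2 3 5,
      c 0 1 4 + c 0 2 6 + c 1 3 6 - c 2 3 4,
      -c 0 1 6 + c 0 2 4 + c 0 3 5 - c 1 2 5 + c 1 3 4 + c 2 3 6 + c 4 5 6,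
      -c 0 2 5 + c 0 3 4 - c 1 2 4 - c 1 3 5, -c 1 2 3 - c 1 4 5 + c 2 5 6 - c 3 4 6,
      -c 0 2 3 - c 0 4 5 - c 2 4 6 - c 3 5 6, -c 0 1 2 - c 0 4 6 + c 1 5 6 + c 2 4 5;
    c 0 1 2 - c 0 4 6 + c 1 5 6 - c 2 4 5, c 0 1 4 - c 0 2 6 - c 1 3 6 - c 2 3 4,
      -c 0 1 5 + c 0 3 6 - c 1 2 6 + c 2 3 5, -c 0 2 5 + c 0 3 4 - c 1 2 4 - c 1 3 5,
      -c 0 1 6 - c 0 2 4 - c 0 3 5 + c 1 2 5 - c 1 3 4 + c 2 3 6 + c 4 5 6,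
      -c 0 2 3 - c 0 4 5 + c 2 4 6 + c 3 5 6, c 1 2 3 + c 1 4 5 + c 2 5 6 - c 3 4 6,
      -c 0 1 3 + c 0 5 6 + c 1 4 6 + c 3 4 5;
    c 0 1 5 + c 0 3 6 + c 1 2 6 + c 2 3 5, -c 0 1 3 - c 0 5 6 + c 1 4 6 - c 3 4 5,
      -c 0 1 2 - c 0 4 6 - c 1 5 6 - c 2 4 5, c 1 2 3 + c 1 4 5 - c 2 5 6 + c 3 4 6,
      c 0 2 3 + c 0 4 5 - c 2 4 6 - c 3 5 6,
      -c 0 1 6 + c 0 2 4 + c 0 3 5 + c 1 2 5 - c 1 3 4 - c 2 3 6 - c 4 5 6,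
      c 0 2 5 - c 0 3 4 - c 1 2 4 - c 1 3 5, c 0 1 4 + c 0 2 6 - c 1 3 6 + c 2 3 4;
    -c 0 1 4 + c 0 2 6 - c 1 3 6 - c 2 3 4, -c 0 1 2 + c 0 4 6 + c 1 5 6 - c 2 4 5,
      c 0 1 3 - c 0 5 6 + c 1 4 6 + c 3 4 5, c 0 2 3 + c 0 4 5 + c 2 4 6 + c 3 5 6,
      -c 1 2 3 - c 1 4 5 - c 2 5 6 + c 3 4 6, c 0 2 5 - c 0 3 4 - c 1 2 4 - c 1 3 5,
      -c 0 1 6 - c 0 2 4 - c 0 3 5 - c 1 2 5 + c 1 3 4 - c 2 3 6 - c 4 5 6,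
      c 0 1 5 - c 0 3 6 - c 1 2 6 + c 2 3 5;
    -c 0 2 5 - c 0 3 4 - c 1 2 4 + c 1 3 5, c 0 2 3 - c 0 4 5 - c 2 4 6 + c 3 5 6,
      c 1 2 3 - c 1 4 5 + c 2 5 6 + c 3 4 6, c 0 1 2 + c 0 4 6 - c 1 5 6 - c 2 4 5,
      c 0 1 3 - c 0 5 6 - c 1 4 6 - c 3 4 5, c 0 1 4 + c 0 2 6 - c 1 3 6 + c 2 3 4,
      c 0 1 5 - c 0 3 6 - c 1 2 6 + c 2 3 5,
      c 0 1 6 - c 0 2 4 + c 0 3 5 + c 1 2 5 + c 1 3 4 + c 2 3 6 - c 4 5 6]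

/-- The sign of a permutation of the indices of a basis, given as a map; it is computable, so that
its values on explicit maps can be decided. -/
def levi (p : Fin 7 → Fin 7) : ℤ := ∏ a, ∏ b ∈ Finset.Ioi a, if p a < p b then 1 else -1

lemma exists_perm_sign_eq_levi {p : Fin 7 → Fin 7} (hp : Function.Injective p) :
    ∃ σ : Equiv.Perm (Fin 7), ⇑σ = p ∧ (Equiv.Perm.sign σ : ℤ) = levi p := by
  refine ⟨Equiv.ofBijective p (Finite.injective_iff_bijective.mp hp), rfl, ?_⟩
  rw [Equiv.Perm.sign_eq_prod_prod_Ioi]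
  simp only [Units.coe_prod, levi, Equiv.ofBijective_apply]
  exact Finset.prod_congr rfl fun a _ => Finset.prod_congr rfl fun b _ => by split_ifs <;> rfl

set_option maxHeartbeats 4000000 in
/-- The Clifford square of a three-form has only components of the degrees zero and three. The
latter one, `d`, is given by its contracted products, dualized; it is described by a hypothesis for
all orders `p` of the indices, with the sign `s` of `p`. -/
lemma spinorMatrix_mul_self (w d : Fin 7 → Fin 7 → Fin 7 → ℝ)
    (hd : ∀ (p : Fin 7 → Fin 7) (s : ℤ), Function.Injective p ∧ levi p = s →
      d (p 4) (p 5) (p 6) = -(s * (eps (p 4) * eps (p 5) * eps (p 6))) *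
        (2 * ∑ m, eps m *
          (antisymm w m (p 0) (p 1) * antisymm w m (p 2) (p 3)
          - antisymm w m (p 0) (p 2) * antisymm w m (p 1) (p 3)
          + antisymm w m (p 0) (p 3) * antisymm w m (p 1) (p 2)))) :
    spinorMatrix w * spinorMatrix w =
      (-((6 : ℝ)⁻¹ * ∑ i, ∑ j, ∑ k, eps i * eps j * eps k * antisymm w i j k ^ 2)) • 1
      + spinorMatrix d := by
  have d012 := hd ![3, 4, 5, 6, 0, 1, 2] 1 (by decide)
  have d013 := hd ![2, 4, 5, 6, 0, 1, 3] (-1) (by decide)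
  have d014 := hd ![2, 3, 5, 6, 0, 1, 4] 1 (by decide)
  have d015 := hd ![2, 3, 4, 6, 0, 1, 5] (-1) (by decide)
  have d016 := hd ![2, 3, 4, 5, 0, 1, 6] 1 (by decide)
  have d023 := hd ![1, 4, 5, 6, 0, 2, 3] 1 (by decide)
  have d024 := hd ![1, 3, 5, 6, 0, 2, 4] (-1) (by decide)
  have d025 := hd ![1, 3, 4, 6, 0, 2, 5] 1 (by decide)
  have d026 := hd ![1, 3, 4, 5, 0, 2, 6] (-1) (by decide)
  have d034 := hd ![1, 2, 5, 6, 0, 3, 4] 1 (by decide)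
  have d035 := hd ![1, 2, 4, 6, 0, 3, 5] (-1) (by decide)
  have d036 := hd ![1, 2, 4, 5, 0, 3, 6] 1 (by decide)
  have d045 := hd ![1, 2, 3, 6, 0, 4, 5] 1 (by decide)
  have d046 := hd ![1, 2, 3, 5, 0, 4, 6] (-1) (by decide)
  have d056 := hd ![1, 2, 3, 4, 0, 5, 6] 1 (by decide)
  have d123 := hd ![0, 4, 5, 6, 1, 2, 3] (-1) (by decide)
  have d124 := hd ![0, 3, 5, 6, 1, 2, 4] 1 (by decide)
  have d125 := hd ![0, 3, 4, 6, 1, 2, 5] (-1) (by decide)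
  have d126 := hd ![0, 3, 4, 5, 1, 2, 6] 1 (by decide)
  have d134 := hd ![0, 2, 5, 6, 1, 3, 4] (-1) (by decide)
  have d135 := hd ![0, 2, 4, 6, 1, 3, 5] 1 (by decide)
  have d136 := hd ![0, 2, 4, 5, 1, 3, 6] (-1) (by decide)
  have d145 := hd ![0, 2, 3, 6, 1, 4, 5] (-1) (by decide)
  have d146 := hd ![0, 2, 3, 5, 1, 4, 6] 1 (by decide)
  have d156 := hd ![0, 2, 3, 4, 1, 5, 6] (-1) (by decide)
  have d234 := hd ![0, 1, 5, 6, 2, 3, 4] 1 (by decide)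
  have d235 := hd ![0, 1, 4, 6, 2, 3, 5] (-1) (by decide)
  have d236 := hd ![0, 1, 4, 5, 2, 3, 6] 1 (by decide)
  have d245 := hd ![0, 1, 3, 6, 2, 4, 5] 1 (by decide)
  have d246 := hd ![0, 1, 3, 5, 2, 4, 6] (-1) (by decide)
  have d256 := hd ![0, 1, 3, 4, 2, 5, 6] 1 (by decide)
  have d345 := hd ![0, 1, 2, 6, 3, 4, 5] (-1) (by decide)
  have d346 := hd ![0, 1, 2, 5, 3, 4, 6] 1 (by decide)
  have d356 := hd ![0, 1, 2, 4, 3, 5, 6] (-1) (by decide)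
  have d456 := hd ![0, 1, 2, 3, 4, 5, 6] 1 (by decide)
  simp only [Matrix.cons_val, eps, antisymm, Fin.sum_univ_seven, Fin.reduceLT, and_true,
    and_false, and_self, if_true, if_false, Matrix.cons_val_zero, Matrix.cons_val_one, Fin.isValue,
    mul_zero, zero_mul, add_zero, zero_add, sub_zero, Int.cast_one, Int.cast_neg,
    Int.reduceNeg, one_mul, mul_one]
    at d012 d013 d014 d015 d016 d023 d024 d025 d026 d034 d035 d036 d045 d046 d056 d123 d124 d125
      d126 d134 d135 d136 d145 d146 d156 d234 d235 d236 d245 d246 d256 d345 d346 d356 d456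
  have hn : ∑ i, ∑ j, ∑ k, eps i * eps j * eps k * antisymm w i j k ^ 2 =
      6 * (w 0 1 2 ^ 2 + w 0 1 3 ^ 2 - w 0 1 4 ^ 2 - w 0 1 5 ^ 2 - w 0 1 6 ^ 2 + w 0 2 3 ^ 2 - w 0
        2 4 ^ 2 - w 0 2 5 ^ 2 - w 0 2 6 ^ 2 - w 0 3 4 ^ 2 - w 0 3 5 ^ 2 - w 0 3 6 ^ 2 +
        w 0 4 5 ^ 2 + w 0 4 6 ^ 2 + w 0 5 6 ^ 2 + w 1 2 3 ^ 2 - w 1 2 4 ^ 2 - w 1 2 5 ^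
        2 - w 1 2 6 ^ 2 - w 1 3 4 ^ 2 - w 1 3 5 ^ 2 - w 1 3 6 ^ 2 + w 1 4 5 ^ 2 + w 1 4
        6 ^ 2 + w 1 5 6 ^ 2 - w 2 3 4 ^ 2 - w 2 3 5 ^ 2 - w 2 3 6 ^ 2 + w 2 4 5 ^ 2 +
        w 2 4 6 ^ 2 + w 2 5 6 ^ 2 + w 3 4 5 ^ 2 + w 3 4 6 ^ 2 + w 3 5 6 ^ 2 - w 4 5 6 ^
        2) := by
    simp only [Matrix.cons_val, eps, antisymm, Fin.sum_univ_seven, Fin.reduceLT, and_true,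
      and_false, and_self, if_true, if_false, Matrix.cons_val_zero, Matrix.cons_val_one,
      Fin.isValue, one_mul, mul_one]
    ring
  rw [hn]
  clear hn hd
  simp only [spinorMatrix, *]
  ext a b
  rw [Matrix.mul_apply, Fin.sum_univ_eight, Matrix.add_apply, Matrix.smul_apply, smul_eq_mul,
    Matrix.one_apply]
  fin_cases a <;> fin_cases b <;>
    simp only [Fin.zero_eta, Fin.mk_one, Fin.reduceFinMk, Fin.isValue, Matrix.of_apply,
      Matrix.cons_val, Matrix.cons_val_zero, Matrix.cons_val_one, Fin.reduceEq, if_true,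
      if_false] <;> ring

/-! ### Reflections and Clifford modules -/

section Reflection

variable {V : Type*} [AddCommGroup V] [Module ℝ V]

/-- The reflection of `(V, h)` in the hyperplane orthogonal to a non-null vector `a`. -/
noncomputable def hyperplaneReflection (h : LinearMap.BilinForm ℝ V) (a : V) (ha : h a a ≠ 0) :
    V ≃ₗ[ℝ] V :=
  Module.reflection (x := a) (f := (2 / h a a) • h a) (by
    rw [LinearMap.smul_apply, smul_eq_mul, div_mul_cancel₀ _ ha])

lemma hyperplaneReflection_apply (h : LinearMap.BilinForm ℝ V) (a : V) (ha : h a a ≠ 0) (x : V) :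
    hyperplaneReflection h a ha x = x - (2 / h a a * h a x) • a := by
  rw [hyperplaneReflection, Module.reflection_apply, LinearMap.smul_apply, smul_eq_mul]

lemma hyperplaneReflection_isometry {h : LinearMap.BilinForm ℝ V} (hs : h.IsSymm) (a : V)
    (ha : h a a ≠ 0) (x y : V) :
    h (hyperplaneReflection h a ha x) (hyperplaneReflection h a ha y) = h x y := by
  simp only [hyperplaneReflection_apply, map_sub, map_smul, LinearMap.sub_apply,
    LinearMap.smul_apply, smul_eq_mul]
  rw [hs.eq a x]
  field_simp
  ring

end Reflection

section CliffordModule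

variable {V W : Type*} [AddCommGroup V] [Module ℝ V] [AddCommGroup W] [Module ℝ W]

/-- A module `W` over the Clifford algebra of `(V, h)`, given by the multiplication `Γ` with
vectors, and a symmetric bilinear form `B` on it for which vectors act skew-symmetrically. -/
structure IsSkewClifford (h : LinearMap.BilinForm ℝ V) (Γ : V →ₗ[ℝ] Module.End ℝ W)
    (B : LinearMap.BilinForm ℝ W) : Prop where
  sq : ∀ x s, Γ x (Γ x s) = h x x • s
  symm : ∀ s u, B s u = B u s
  skew : ∀ x s u, B (Γ x s) u = -B s (Γ x u)

namespace IsSkewClifford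

variable {h : LinearMap.BilinForm ℝ V} {Γ : V →ₗ[ℝ] Module.End ℝ W} {B : LinearMap.BilinForm ℝ W}

lemma anticomm (H : IsSkewClifford h Γ B) (hs : h.IsSymm) (x y : V) (s : W) :
    Γ x (Γ y s) = (2 * h x y) • s - Γ y (Γ x s) := by
  have h1 := H.sq (x + y) s
  have h2 := hs.eq x y
  simp only [map_add, LinearMap.add_apply, H.sq, add_smul] at h1
  rw [← h2] at h1
  rw [two_mul, add_smul, eq_sub_iff_add_eq]
  have h3 := sub_eq_zero.mpr h1
  rw [← sub_eq_zero, ← h3]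
  abel

lemma apply_self (H : IsSkewClifford h Γ B) (x : V) (s : W) : B s (Γ x s) = 0 := by
  have := H.skew x s s
  rw [H.symm (Γ x s) s] at this
  linarith

/-- The three-form `(x, y, z) ↦ B(η, x y z η)` of a spinor `η`. -/
def threeForm (H : IsSkewClifford h Γ B) (hs : h.IsSymm) (η : W) : ExtForm V 3 where
  toFun v := B η (Γ (v 0) (Γ (v 1) (Γ (v 2) η)))
  map_update_add' := by
    intro inst v i x y
    obtain rfl : inst = instDecidableEqFin 3 := Subsingleton.elim _ _
    fin_cases i <;> simp [Function.update]
  map_update_smul' := by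
    intro inst v i c x
    obtain rfl : inst = instDecidableEqFin 3 := Subsingleton.elim _ _
    fin_cases i <;> simp [Function.update]
  map_eq_zero_of_eq' v i j hv hij := by
    have h01 : ∀ x z, B η (Γ x (Γ x (Γ z η))) = 0 := fun x z => by
      rw [H.sq, map_smul, H.apply_self, smul_zero]
    have h12 : ∀ x z, B η (Γ z (Γ x (Γ x η))) = 0 := fun x z => by
      rw [H.sq, map_smul, map_smul, H.apply_self, smul_zero]
    have h02 : ∀ x z, B η (Γ x (Γ z (Γ x η))) = 0 := fun x z => by
      rw [H.anticomm hs x z, map_sub, map_smul, H.apply_self, h12, smul_zero, sub_zero]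
    fin_cases i <;> fin_cases j <;> simp at hv hij ⊢ <;> simp [hv, h01, h12, h02]

lemma threeForm_apply (H : IsSkewClifford h Γ B) (hs : h.IsSymm) (η : W) (x y z : V) :
    H.threeForm hs η ![x, y, z] = B η (Γ x (Γ y (Γ z η))) := rfl

lemma clifford_reflection (H : IsSkewClifford h Γ B) (hs : h.IsSymm) (a : V) (ha : h a a ≠ 0)
    (x : V) (s : W) : Γ a (Γ x s) = -Γ (hyperplaneReflection h a ha x) (Γ a s) := by
  rw [hyperplaneReflection_apply, map_sub, map_smul, LinearMap.sub_apply, LinearMap.smul_apply,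
    H.sq, smul_smul, H.anticomm hs]
  have : 2 / h a a * h a x * h a a = 2 * h a x := by field_simp
  rw [this]; abel

/-- Clifford multiplication of a spinor by a non-null vector reflects its three-form. -/
lemma threeForm_clifford (H : IsSkewClifford h Γ B) (hs : h.IsSymm) (a : V) (ha : h a a ≠ 0)
    (η : W) : H.threeForm hs (Γ a η) =
      h a a • (H.threeForm hs η).compLinearMap (hyperplaneReflection h a ha : V →ₗ[ℝ] V) := by
  ext v
  rw [threeForm_eq, AlternatingMap.smul_apply, smul_eq_mul]
  change B (Γ a η) (Γ (v 0) (Γ (v 1) (Γ (v 2) (Γ a η)))) = h a a * B η (Γ _ (Γ _ (Γ _ η)))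
  rw [H.skew, H.clifford_reflection hs a ha, H.clifford_reflection hs a ha,
    H.clifford_reflection hs a ha, H.sq]
  simp only [map_neg, map_smul, smul_eq_mul, neg_neg]
  rfl

lemma form_clifford (H : IsSkewClifford h Γ B) (a : V) (s : W) :
    B (Γ a s) (Γ a s) = -(h a a * B s s) := by
  rw [H.skew, H.sq, map_smul, smul_eq_mul]

end IsSkewClifford

/-- A symmetric traceless endomorphism of an eight-dimensional space with eigenvalues `7t` and `-t`
is given by a non-null eigenvector, since its trace makes the eigenvalue `7t` simple. -/
lemma exists_eigenvector_of_mul_self [FiniteDimensional ℝ W] (h8 : finrank ℝ W = 8)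
    {B : LinearMap.BilinForm ℝ W} (hB : ∀ s u, B s u = B u s) (hnd : ∀ s, (∀ u, B s u = 0) → s = 0)
    {S : Module.End ℝ W} (hS : ∀ s u, B (S s) u = B s (S u)) (htr : LinearMap.trace ℝ W S = 0)
    {t : ℝ} (ht : t ≠ 0) (hsq : S * S = (7 * t ^ 2) • 1 + (6 * t) • S) :
    ∃ η, B η η ≠ 0 ∧ ∀ s, S s = t • ((8 / B η η * B η s) • η - s) := by
  -- the projection onto the eigenspace of `7t`
  obtain ⟨P, hP⟩ : ∃ P : Module.End ℝ W, P = (8 * t)⁻¹ • (S + t • 1) := ⟨_, rfl⟩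
  have h8t : (8 * t) ≠ 0 := mul_ne_zero (by norm_num) ht
  have hSP : S = (8 * t) • P - t • 1 := by
    rw [hP, smul_smul, mul_inv_cancel₀ h8t, one_smul]; abel
  have hidem : IsIdempotentElem P := by
    have h1 : (S + t • 1) * (S + t • 1) = (8 * t) • (S + t • (1 : Module.End ℝ W)) := by
      rw [mul_add, add_mul, add_mul, hsq]
      simp only [smul_mul_assoc, mul_smul_comm, one_mul, mul_one, smul_add, smul_smul]
      module
    rw [IsIdempotentElem, hP, smul_mul_assoc, mul_smul_comm, h1, smul_smul, smul_smul]
    congr 1; field_simp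
  have htrP : LinearMap.trace ℝ W P = 1 := by
    rw [hP, map_smul, map_add, map_smul, htr, LinearMap.trace_one, h8]
    simp only [smul_eq_mul]; field_simp; ring
  have hrank : finrank ℝ (LinearMap.range P) = 1 := by
    have := (LinearMap.IsIdempotentElem.isProj_range P hidem).trace
    rw [htrP] at this
    exact_mod_cast this.symm
  obtain ⟨⟨η, hη⟩, hη0, hspan⟩ := finrank_eq_one_iff'.mp hrank
  have hη0 : η ≠ 0 := fun H => hη0 (Subtype.ext H)
  have hPη : P η = η := (LinearMap.IsIdempotentElem.mem_range_iff hidem).mp hη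
  have hPs : ∀ s, ∃ c : ℝ, P s = c • η := by
    intro s
    obtain ⟨c, hc⟩ := hspan ⟨P s, LinearMap.mem_range_self P s⟩
    exact ⟨c, (congrArg Subtype.val hc).symm⟩
  have hPsymm : ∀ s u, B (P s) u = B s (P u) := by
    intro s u
    simp [hP, hS]
  choose l hl using hPs
  have hlB : ∀ s u, l s * B η u = l u * B η s := by
    intro s u
    have := hPsymm s u
    rw [hl, hl] at this
    simp only [map_smul, LinearMap.smul_apply, smul_eq_mul] at this
    rw [this, hB s η]
  have hlη : l η = 1 := by
    have h1 : (l η - 1) • η = 0 := by rw [sub_smul, one_smul, ← hl, hPη, sub_self]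
    rcases smul_eq_zero.mp h1 with h2 | h2
    · linarith
    · exact absurd h2 hη0
  have hN : B η η ≠ 0 := by
    intro h0
    refine hη0 (hnd η fun u => ?_)
    have := hlB η u
    rwa [hlη, h0, one_mul, mul_zero] at this
  refine ⟨η, hN, fun s => ?_⟩
  have h1 := hlB s η
  rw [hlη, one_mul] at h1
  rw [hSP, LinearMap.sub_apply, LinearMap.smul_apply, LinearMap.smul_apply, hl,
    Module.End.one_apply, ← h1]
  have h2 : 8 / B η η * (l s * B η η) = 8 * l s := by field_simp
  rw [h2, smul_sub, smul_smul, smul_smul]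
  congr 2; ring

end CliffordModule

/-! ### The form on spinors and the Fierz identity -/

section Spinor

open Matrix

/-- The signs of the neutral form on the spinors `ℝ ⊕ ℝ⁷`: it is `1` on the first summand and `-h`
on the second one. -/
def delta : Fin 8 → ℝ := ![1, -1, -1, -1, -1, 1, 1, 1]

/-- The neutral symmetric bilinear form on spinors. -/
def spinorForm : LinearMap.BilinForm ℝ (Fin 8 → ℝ) :=
  LinearMap.mk₂ ℝ (fun s u => ∑ a, delta a * s a * u a)
    (fun s s' u => by simp only [Pi.add_apply, mul_add, add_mul, Finset.sum_add_distrib])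
    (fun c s u => by
      simp only [Pi.smul_apply, smul_eq_mul, Finset.mul_sum]
      exact Finset.sum_congr rfl fun _ _ => by ring)
    (fun s u u' => by simp only [Pi.add_apply, mul_add, Finset.sum_add_distrib])
    (fun c s u => by
      simp only [Pi.smul_apply, smul_eq_mul, Finset.mul_sum]
      exact Finset.sum_congr rfl fun _ _ => by ring)

lemma spinorForm_apply (s u : Fin 8 → ℝ) : spinorForm s u = s 0 * u 0 - s 1 * u 1 - s 2 * u 2
    - s 3 * u 3 - s 4 * u 4 + s 5 * u 5 + s 6 * u 6 + s 7 * u 7 := by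
  change ∑ a, delta a * s a * u a = _
  simp [Fin.sum_univ_eight, delta]
  ring

lemma spinorForm_symm (s u : Fin 8 → ℝ) : spinorForm s u = spinorForm u s := by
  rw [spinorForm_apply, spinorForm_apply]; ring

lemma spinorForm_nondegenerate (s : Fin 8 → ℝ) (H : ∀ u, spinorForm s u = 0) : s = 0 := by
  funext a
  have := H (Pi.single a 1)
  rw [spinorForm_apply] at this
  fin_cases a <;> simpa [Pi.single_apply] using this

lemma gamma_add (v w : Fin 7 → ℝ) : gamma (v + w) = gamma v + gamma w := by
  ext a b
  fin_cases a <;> fin_cases b <;> simp [gamma] <;> ring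

lemma gamma_smul (c : ℝ) (v : Fin 7 → ℝ) : gamma (c • v) = c • gamma v := by
  ext a b
  fin_cases a <;> fin_cases b <;> simp [gamma]

lemma gamma_mulVec (v : Fin 7 → ℝ) (s : Fin 8 → ℝ) : gamma v *ᵥ s =
    ![v 0 * s 1 + v 1 * s 2 + v 2 * s 3 + v 3 * s 4 - v 4 * s 5 - v 5 * s 6 - v 6 * s 7,
      v 0 * s 0 + v 6 * s 2 + v 4 * s 3 - v 5 * s 4 - v 2 * s 5 + v 3 * s 6 - v 1 * s 7,
      v 1 * s 0 - v 6 * s 1 - v 5 * s 3 - v 4 * s 4 + v 3 * s 5 + v 2 * s 6 + v 0 * s 7,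
      v 2 * s 0 - v 4 * s 1 + v 5 * s 2 + v 6 * s 4 + v 0 * s 5 - v 1 * s 6 - v 3 * s 7,
      v 3 * s 0 + v 5 * s 1 + v 4 * s 2 - v 6 * s 3 - v 1 * s 5 - v 0 * s 6 + v 2 * s 7,
      v 4 * s 0 - v 2 * s 1 + v 3 * s 2 + v 0 * s 3 - v 1 * s 4 + v 6 * s 6 - v 5 * s 7,
      v 5 * s 0 + v 3 * s 1 + v 2 * s 2 - v 1 * s 3 - v 0 * s 4 - v 6 * s 5 + v 4 * s 7,
      v 6 * s 0 - v 1 * s 1 + v 0 * s 2 - v 3 * s 3 + v 2 * s 4 + v 5 * s 5 - v 4 * s 6] := by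
  funext a
  fin_cases a <;> simp [gamma, mulVec, dotProduct, Fin.sum_univ_eight] <;> ring

lemma gamma_gamma_mulVec (v : Fin 7 → ℝ) (s : Fin 8 → ℝ) :
    gamma v *ᵥ (gamma v *ᵥ s) = (∑ i, eps i * v i * v i) • s := by
  simp only [gamma_mulVec]
  funext a
  fin_cases a <;> simp [eps, Fin.sum_univ_seven] <;> ring

lemma gamma_skew (v : Fin 7 → ℝ) (s u : Fin 8 → ℝ) :
    spinorForm (gamma v *ᵥ s) u = -spinorForm s (gamma v *ᵥ u) := by
  simp [gamma_mulVec, spinorForm_apply]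
  ring

lemma spinorMatrix_symm (c : Fin 7 → Fin 7 → Fin 7 → ℝ) (s u : Fin 8 → ℝ) :
    spinorForm (spinorMatrix c *ᵥ s) u = spinorForm s (spinorMatrix c *ᵥ u) := by
  simp [spinorForm_apply, spinorMatrix, dotProduct, Fin.sum_univ_eight]
  ring

lemma spinorMatrix_trace (c : Fin 7 → Fin 7 → Fin 7 → ℝ) : (spinorMatrix c).trace = 0 := by
  simp [trace, spinorMatrix, Fin.sum_univ_eight]
  ring

lemma spinorMatrix_smul (r : ℝ) (c : Fin 7 → Fin 7 → Fin 7 → ℝ) :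
    spinorMatrix (r • c) = r • spinorMatrix c := by
  ext a b
  fin_cases a <;> fin_cases b <;>
    simp only [spinorMatrix, Fin.zero_eta, Fin.mk_one, Fin.reduceFinMk, Fin.isValue,
      Matrix.smul_apply, of_apply, cons_val, cons_val_zero, cons_val_one, Pi.smul_apply,
      smul_eq_mul] <;> ring

/-- Three-forms are determined by their action on spinors. The entries of the matrix fall into eight
blocks, which involve disjoint sets of components. -/
lemma eq_of_spinorMatrix_eq {c d : Fin 7 → Fin 7 → Fin 7 → ℝ}
    (H : spinorMatrix c = spinorMatrix d) (i j k : Fin 7) (hij : i < j) (hjk : j < k) :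
    c i j k = d i j k := by
  have h := fun a b => congrFun (congrFun H a) b
  clear H
  simp [spinorMatrix, Fin.forall_fin_succ] at h
  obtain ⟨⟨h00, h01, h02, h03, h04, h05, h06, h07⟩, ⟨-, h11, h12, h13, h14, h15, h16, h17⟩,
    ⟨-, -, h22, h23, h24, h25, h26, h27⟩, ⟨-, -, -, h33, h34, h35, h36, h37⟩,
    ⟨-, -, -, -, h44, h45, h46, h47⟩, ⟨-, -, -, -, -, h55, h56, h57⟩,
    ⟨-, -, -, -, -, -, h66, h67⟩, -, -, -, -, -, -, -, h77⟩ := h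
  obtain ⟨e016, e024, e035, e125, e134, e236, e456⟩ :
      c 0 1 6 = d 0 1 6 ∧ c 0 2 4 = d 0 2 4 ∧ c 0 3 5 = d 0 3 5 ∧ c 1 2 5 = d 1 2 5 ∧
      c 1 3 4 = d 1 3 4 ∧ c 2 3 6 = d 2 3 6 ∧ c 4 5 6 = d 4 5 6 := by
    refine ⟨?_, ?_, ?_, ?_, ?_, ?_, ?_⟩ <;> linarith only [h00, h11, h22, h33, h44, h55, h66, h77]
  obtain ⟨e123, e145, e256, e346⟩ :
      c 1 2 3 = d 1 2 3 ∧ c 1 4 5 = d 1 4 5 ∧ c 2 5 6 = d 2 5 6 ∧ c 3 4 6 = d 3 4 6 := by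
    refine ⟨?_, ?_, ?_, ?_⟩ <;> linarith only [h01, h27, h35, h46]
  obtain ⟨e023, e045, e246, e356⟩ :
      c 0 2 3 = d 0 2 3 ∧ c 0 4 5 = d 0 4 5 ∧ c 2 4 6 = d 2 4 6 ∧ c 3 5 6 = d 3 5 6 := by
    refine ⟨?_, ?_, ?_, ?_⟩ <;> linarith only [h02, h17, h36, h45]
  obtain ⟨e013, e056, e146, e345⟩ :
      c 0 1 3 = d 0 1 3 ∧ c 0 5 6 = d 0 5 6 ∧ c 1 4 6 = d 1 4 6 ∧ c 3 4 5 = d 3 4 5 := by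
    refine ⟨?_, ?_, ?_, ?_⟩ <;> linarith only [h03, h15, h26, h47]
  obtain ⟨e012, e046, e156, e245⟩ :
      c 0 1 2 = d 0 1 2 ∧ c 0 4 6 = d 0 4 6 ∧ c 1 5 6 = d 1 5 6 ∧ c 2 4 5 = d 2 4 5 := by
    refine ⟨?_, ?_, ?_, ?_⟩ <;> linarith only [h04, h16, h25, h37]
  obtain ⟨e015, e036, e126, e235⟩ :
      c 0 1 5 = d 0 1 5 ∧ c 0 3 6 = d 0 3 6 ∧ c 1 2 6 = d 1 2 6 ∧ c 2 3 5 = d 2 3 5 := by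
    refine ⟨?_, ?_, ?_, ?_⟩ <;> linarith only [h05, h13, h24, h67]
  obtain ⟨e014, e026, e136, e234⟩ :
      c 0 1 4 = d 0 1 4 ∧ c 0 2 6 = d 0 2 6 ∧ c 1 3 6 = d 1 3 6 ∧ c 2 3 4 = d 2 3 4 := by
    refine ⟨?_, ?_, ?_, ?_⟩ <;> linarith only [h06, h14, h23, h57]
  obtain ⟨e025, e034, e124, e135⟩ :
      c 0 2 5 = d 0 2 5 ∧ c 0 3 4 = d 0 3 4 ∧ c 1 2 4 = d 1 2 4 ∧ c 1 3 5 = d 1 3 5 := by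
    refine ⟨?_, ?_, ?_, ?_⟩ <;> linarith only [h07, h12, h34, h56]
  fin_cases i <;> fin_cases j <;> first
    | exact absurd hij (by decide)
    | fin_cases k <;> first
      | exact absurd hjk (by decide)
      | assumption

/-- The spinors `γ_v η` span the orthogonal complement of `η`: the projection to it, explicitly. -/
lemma gamma_mulVec_dual (η ζ : Fin 8 → ℝ) :
    gamma (fun i => eps i * spinorForm (gamma (Pi.single i 1) *ᵥ η) ζ) *ᵥ η =
      spinorForm η ζ • η - spinorForm η η • ζ := by
  rw [gamma_mulVec]
  simp only [gamma_mulVec, spinorForm_apply, eps]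
  funext a
  fin_cases a <;> simp <;> ring

/-- A spinor orthogonal to a non-null spinor `η` is the Clifford product of `η` with a vector. -/
lemma exists_gamma_mulVec_eq {η ζ : Fin 8 → ℝ} (hN : spinorForm η η ≠ 0)
    (hζ : spinorForm η ζ = 0) : ∃ v, gamma v *ᵥ η = ζ := by
  refine ⟨(-(spinorForm η η)⁻¹) • fun i => eps i * spinorForm (gamma (Pi.single i 1) *ᵥ η) ζ, ?_⟩
  rw [gamma_smul, smul_mulVec, gamma_mulVec_dual, hζ, zero_smul, zero_sub, smul_neg, neg_smul,
    neg_neg, smul_smul, inv_mul_cancel₀ hN, one_smul]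

/-- The Fierz identity: the endomorphism of the three-form of a spinor `η` is, up to a multiple
of the identity, the projection onto `η`. -/
lemma spinorMatrix_threeForm (η : Fin 8 → ℝ) :
    spinorMatrix (fun i j k => spinorForm η (gamma (Pi.single i 1) *ᵥ (gamma (Pi.single j 1) *ᵥ
      (gamma (Pi.single k 1) *ᵥ η)))) =
      spinorForm η η • (1 : Matrix (Fin 8) (Fin 8) ℝ) -
        of fun a b => 8 * η a * (delta b * η b) := by
  have g0 : ∀ s, gamma (Pi.single 0 1) *ᵥ s =
      ![s 1, s 0, s 7, s 5, -s 6, s 3, -s 4, s 2] := fun s => by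
    rw [gamma_mulVec]; simp
  have g1 : ∀ s, gamma (Pi.single 1 1) *ᵥ s =
      ![s 2, -s 7, s 0, -s 6, -s 5, -s 4, -s 3, -s 1] := fun s => by
    rw [gamma_mulVec]; simp
  have g2 : ∀ s, gamma (Pi.single 2 1) *ᵥ s =
      ![s 3, -s 5, s 6, s 0, s 7, -s 1, s 2, s 4] := fun s => by
    rw [gamma_mulVec]; simp
  have g3 : ∀ s, gamma (Pi.single 3 1) *ᵥ s =
      ![s 4, s 6, s 5, -s 7, s 0, s 2, s 1, -s 3] := fun s => by
    rw [gamma_mulVec]; simp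
  have g4 : ∀ s, gamma (Pi.single 4 1) *ᵥ s =
      ![-s 5, s 3, -s 4, -s 1, s 2, s 0, s 7, -s 6] := fun s => by
    rw [gamma_mulVec]; simp
  have g5 : ∀ s, gamma (Pi.single 5 1) *ᵥ s =
      ![-s 6, -s 4, -s 3, s 2, s 1, -s 7, s 0, s 5] := fun s => by
    rw [gamma_mulVec]; simp
  have g6 : ∀ s, gamma (Pi.single 6 1) *ᵥ s =
      ![-s 7, s 2, -s 1, s 4, -s 3, s 6, -s 5, s 0] := fun s => by
    rw [gamma_mulVec]; simp
  simp only [spinorMatrix, spinorForm_apply, g0, g1, g2, g3, g4, g5, g6, cons_val, cons_val_zero,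
    cons_val_one, Fin.isValue]
  ext a b
  rw [Matrix.sub_apply, Matrix.smul_apply, smul_eq_mul, one_apply]
  fin_cases a <;> fin_cases b <;>
    simp only [Fin.zero_eta, Fin.mk_one, Fin.reduceFinMk, Fin.isValue, of_apply, cons_val,
      cons_val_zero, cons_val_one, Fin.reduceEq, if_true, if_false, delta] <;> ring

end Spinor

/-! ### The eigenvalue equation characterizes the canonical three-forms -/

section Canonical

variable {V : Type*} [AddCommGroup V] [Module ℝ V]

/-- The minor of three coordinate vectors with column indices `i`, `j`, `k`. -/
def minor (x y z : Fin 7 → ℝ) (i j k : Fin 7) : ℝ :=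
  x i * (y j * z k - y k * z j) - x j * (y i * z k - y k * z i) + x k * (y i * z j - y j * z i)

/-- The canonical three-form in coordinates. -/
def canonicalPoly (x y z : Fin 7 → ℝ) : ℝ :=
  -minor x y z 0 1 6 - minor x y z 0 2 4 + minor x y z 0 3 5 + minor x y z 1 2 5
    + minor x y z 1 3 4 - minor x y z 2 3 6 + minor x y z 4 5 6

lemma basisThreeForm_apply (e : Basis (Fin 7) ℝ V) (i j k : Fin 7) (x : Fin 3 → V) :
    basisThreeForm e i j k x =
      minor (e.equivFun (x 0)) (e.equivFun (x 1)) (e.equivFun (x 2)) i j k := by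
  refine (Matrix.det_fin_three (Matrix.of fun a =>
    LinearMap.pi ![e.coord i, e.coord j, e.coord k] (x a))).trans ?_
  simp [minor]
  ring

lemma canonicalThreeForm_apply (e : Basis (Fin 7) ℝ V) (x : Fin 3 → V) :
    canonicalThreeForm e x =
      canonicalPoly (e.equivFun (x 0)) (e.equivFun (x 1)) (e.equivFun (x 2)) := by
  simp only [canonicalThreeForm, canonicalPoly, AlternatingMap.add_apply, AlternatingMap.sub_apply,
    AlternatingMap.neg_apply, basisThreeForm_apply]

lemma canonicalThreeForm_map (e : Basis (Fin 7) ℝ V) (A : V ≃ₗ[ℝ] V) :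
    (canonicalThreeForm (e.map A)).compLinearMap (A : V →ₗ[ℝ] V) = canonicalThreeForm e := by
  ext x
  rw [AlternatingMap.compLinearMap_apply, canonicalThreeForm_apply, canonicalThreeForm_apply]
  simp [Basis.equivFun]

end Canonical

section SpinorV

variable {V : Type*} [AddCommGroup V] [Module ℝ V]

/-- Clifford multiplication of the spinors `ℝ⁸` with the vectors of a space with a
pseudo-orthonormal basis `e`. -/
noncomputable def cliffordMul (e : Basis (Fin 7) ℝ V) : V →ₗ[ℝ] Module.End ℝ (Fin 8 → ℝ) where
  toFun x := Matrix.toLin' (gamma (e.equivFun x))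
  map_add' x y := by rw [map_add, gamma_add, map_add]
  map_smul' c x := by rw [map_smul, gamma_smul, map_smul]; rfl

lemma cliffordMul_apply (e : Basis (Fin 7) ℝ V) (x : V) (s : Fin 8 → ℝ) :
    cliffordMul e x s = (gamma (e.equivFun x)).mulVec s := Matrix.toLin'_apply _ _

lemma IsOrthonormalBasis.isSkewClifford {h : LinearMap.BilinForm ℝ V} {e : Basis (Fin 7) ℝ V}
    (he : IsOrthonormalBasis h e) : IsSkewClifford h (cliffordMul e) spinorForm where
  sq x s := by
    rw [cliffordMul_apply, cliffordMul_apply, gamma_gamma_mulVec, he.apply_eq_sum]; rfl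
  symm := spinorForm_symm
  skew x s u := by rw [cliffordMul_apply, cliffordMul_apply, gamma_skew]

/-- The spinor whose three-form is the canonical one. -/
def spinorOne : Fin 8 → ℝ := Pi.single 0 1

lemma threeForm_spinorOne {h : LinearMap.BilinForm ℝ V} {e : Basis (Fin 7) ℝ V}
    (he : IsOrthonormalBasis h e) (hs : h.IsSymm) :
    he.isSkewClifford.threeForm hs spinorOne = canonicalThreeForm e := by
  ext x
  rw [threeForm_eq, IsSkewClifford.threeForm_apply, canonicalThreeForm_apply]
  simp only [cliffordMul_apply, gamma_mulVec, spinorForm_apply, spinorOne]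
  simp [canonicalPoly, minor]
  ring

/-- Any two non-null spinors are related, up to scale, by the product of two non-null vectors;
hence the three-form of a non-null spinor is canonical in some pseudo-orthonormal basis. -/
lemma exists_basis_threeForm_eq {h : LinearMap.BilinForm ℝ V} {e : Basis (Fin 7) ℝ V}
    (he : IsOrthonormalBasis h e) (hs : h.IsSymm) {η : Fin 8 → ℝ} (hN : spinorForm η η ≠ 0) :
    ∃ e', IsOrthonormalBasis h e' ∧
      he.isSkewClifford.threeForm hs η = spinorForm η η • canonicalThreeForm e' := by
  have H := he.isSkewClifford
  -- a non-null spinor orthogonal to both `η` and `spinorOne`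
  obtain ⟨ζ, hζ0, hζ, hζN⟩ : ∃ ζ : Fin 8 → ℝ, ζ 0 = 0 ∧ spinorForm η ζ = 0 ∧
      spinorForm ζ ζ ≠ 0 := by
    by_cases h12 : η 1 = 0 ∧ η 2 = 0
    · refine ⟨![0, 1, 0, 0, 0, 0, 0, 0], rfl, ?_, ?_⟩ <;> simp [spinorForm_apply, h12.1]
    · refine ⟨![0, -η 2, η 1, 0, 0, 0, 0, 0], rfl, ?_, ?_⟩
      · simp [spinorForm_apply]; ring
      · simp only [spinorForm_apply]
        simp
        intro h0
        refine h12 ⟨?_, ?_⟩ <;> nlinarith [sq_nonneg (η 1), sq_nonneg (η 2)]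
  obtain ⟨v', hv'⟩ := exists_gamma_mulVec_eq hN hζ
  obtain ⟨v, rfl⟩ := e.equivFun.surjective v'
  have h1N : spinorForm spinorOne spinorOne = 1 := by simp [spinorForm_apply, spinorOne]
  obtain ⟨w', hw'⟩ := exists_gamma_mulVec_eq (η := spinorOne) (ζ := ζ)
    (by rw [h1N]; exact one_ne_zero) (by simp [spinorForm_apply, spinorOne, hζ0])
  obtain ⟨w, rfl⟩ := e.equivFun.surjective w'
  rw [← cliffordMul_apply] at hv' hw'
  have hv := H.form_clifford v η
  have hw := H.form_clifford w spinorOne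
  rw [hv'] at hv
  rw [hw', h1N, mul_one] at hw
  have hv0 : h v v ≠ 0 := fun h0 => hζN (by rw [hv, h0]; ring)
  have hw0 : h w w ≠ 0 := fun h0 => hζN (by rw [hw, h0]; ring)
  have e1 := H.threeForm_clifford hs v hv0 η
  have e2 := H.threeForm_clifford hs w hw0 spinorOne
  rw [hv'] at e1
  rw [hw', e1, threeForm_spinorOne he hs] at e2
  have hwv : h w w = h v v * spinorForm η η := by linarith
  set R := hyperplaneReflection h v hv0
  set Q := hyperplaneReflection h w hw0
  refine ⟨(e.map Q).map R, ?_, ?_⟩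
  · intro i j
    rw [Basis.map_apply, Basis.map_apply, Basis.map_apply, Basis.map_apply,
      hyperplaneReflection_isometry hs, hyperplaneReflection_isometry hs, he]
  · have hRR : ∀ x, R (R x) = x := Module.involutive_reflection _
    have hQQ : ∀ x, Q (Q x) = x := Module.involutive_reflection _
    have e3 := canonicalThreeForm_map (e.map Q) R
    have e4 := canonicalThreeForm_map e Q
    have e5 : (canonicalThreeForm e).compLinearMap (Q : V →ₗ[ℝ] V) =
        canonicalThreeForm (e.map Q) := by
      rw [← e4]; ext x
      simp only [AlternatingMap.compLinearMap_apply, LinearEquiv.coe_coe, hQQ]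
    rw [e5, ← e3, hwv, mul_smul] at e2
    have e6 := smul_right_injective _ hv0 e2
    ext x
    have := DFunLike.congr_fun e6 (fun a => R (x a))
    simpa only [AlternatingMap.compLinearMap_apply, AlternatingMap.smul_apply, LinearEquiv.coe_coe,
      hRR] using this

end SpinorV

section Eigen

variable {V : Type*} [AddCommGroup V] [Module ℝ V] [Fact (finrank ℝ V = 7)]

/-- The Clifford square of a three-form: its parts of degree zero and three are the square norm and
the form `*(φ △₁ φ)`. -/
theorem IsOrthonormalBasis.spinorMatrix_mul_self {h : LinearMap.BilinForm ℝ V}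
    {f : Basis (Fin 7) ℝ V} (hf : IsOrthonormalBasis h f) {o : Orientation ℝ V (Fin 7)} {s : ℝ}
    (hs : s * s = 1) (hvol : volumeForm h o = s • f.det) (φ : ExtForm V 3) :
    spinorMatrix (fun i j k => φ ![f i, f j, f k]) *
        spinorMatrix (fun i j k => φ ![f i, f j, f k]) =
      (-formInner h φ φ) • 1 +
        spinorMatrix (s • fun i j k => hodgeFour h o (triangleOne h φ φ) ![f i, f j, f k]) := by
  set c : Fin 7 → Fin 7 → Fin 7 → ℝ := fun i j k => φ ![f i, f j, f k] with hc
  have hanti : ∀ i j k, φ ![f i, f j, f k] = antisymm c i j k := antisymm_basis φ f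
  have hsq := SplitG2.spinorMatrix_mul_self c
    (s • fun i j k => hodgeFour h o (triangleOne h φ φ) ![f i, f j, f k]) (by
    rintro p s' ⟨hp, hs'⟩
    obtain ⟨σ, rfl, hσ⟩ := exists_perm_sign_eq_levi hp
    have h1 := hf.hodgeFour_apply_perm hvol (triangleOne h φ φ) σ
    rw [hf.triangleOne_apply, hσ, hs'] at h1
    simp only [Matrix.cons_val_zero, Matrix.cons_val_one, Matrix.cons_val, hanti] at h1
    have h2 : ∏ i, eps (σ i) = -1 := by
      rw [Equiv.prod_comp σ eps]; simp [Fin.prod_univ_succ, eps]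
    rw [Fin.prod_univ_seven] at h2
    have h3 : eps (σ 0) * eps (σ 1) * eps (σ 2) * eps (σ 3) =
        -(eps (σ 4) * eps (σ 5) * eps (σ 6)) := by
      have := eps_mul_self (σ 4)
      have := eps_mul_self (σ 5)
      have := eps_mul_self (σ 6)
      grind
    change s * hodgeFour h o (triangleOne h φ φ) ![f (σ 4), f (σ 5), f (σ 6)] = _
    have h4 : ∀ a b : ℝ, s * (s * s' * (-a * b)) = -(s' * a) * b := fun a b => by
      linear_combination (-(s' : ℝ) * a * b) * hs
    rw [h1, h3]
    exact h4 _ _)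
  have hnorm := hf.formInner_eq φ
  simp only [hanti] at hnorm
  rw [hsq, hnorm]

/-- The eigenvalue equation `*(φ △₁ φ) = 6 t φ` with `⟨φ, φ⟩ = -7 t² ≠ 0` forces `φ` to be a
multiple of the canonical three-form of a pseudo-orthonormal basis: the endomorphism `S` of the
spinors defined by `φ` satisfies `S² = 7 t² + 6 t S`, so that it has a simple eigenvalue, and `φ` is
a multiple of the three-form of an eigenvector `η`. -/
theorem exists_canonical_of_hodge_eq {h : LinearMap.BilinForm ℝ V} (hh : HasSignature43 h)
    (o : Orientation ℝ V (Fin 7)) (φ : ExtForm V 3) {t : ℝ} (ht : t ≠ 0)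
    (hn : formInner h φ φ = -(7 * t ^ 2))
    (hφ : hodgeFour h o (triangleOne h φ φ) = (6 * t) • φ) :
    ∃ e, IsOrthonormalBasis h e ∧ φ = (-t) • canonicalThreeForm e := by
  obtain ⟨f₀, hf₀⟩ := hh.exists_orthonormalBasis
  obtain ⟨f, hf, hfo⟩ : ∃ f, IsOrthonormalBasis h f ∧ f.orientation = o :=
    ⟨_, hf₀.adjustToOrientation o, Basis.orientation_adjustToOrientation _ _⟩
  have hvol : volumeForm h o = (1 : ℝ) • f.det := by
    rw [SplitG2.volumeForm_eq h o f hfo, hf.toMatrix_det]; simp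
  set c : Fin 7 → Fin 7 → Fin 7 → ℝ := fun i j k => φ ![f i, f j, f k] with hc
  have hsq := hf.spinorMatrix_mul_self (one_mul 1) hvol φ
  have hd : ((1 : ℝ) • fun i j k => hodgeFour h o (triangleOne h φ φ) ![f i, f j, f k]) =
      (6 * t) • c := by
    rw [hφ, one_smul]; rfl
  rw [hd, hn, neg_neg, spinorMatrix_smul] at hsq
  obtain ⟨η, hN, hη⟩ := exists_eigenvector_of_mul_self (S := Matrix.toLin' (spinorMatrix c))
    (by simp) spinorForm_symm spinorForm_nondegenerate
    (fun s u => by rw [Matrix.toLin'_apply, Matrix.toLin'_apply, spinorMatrix_symm])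
    (by rw [Matrix.trace_toLin'_eq, spinorMatrix_trace]) ht
    (by rw [Module.End.mul_eq_comp, ← Matrix.toLin'_mul, hsq, map_add, map_smul, map_smul,
      Matrix.toLin'_one]; rfl)
  obtain ⟨e, he, heφ⟩ := exists_basis_threeForm_eq hf hh.1 hN
  refine ⟨e, he, ?_⟩
  set b : Fin 7 → Fin 7 → Fin 7 → ℝ := fun i j k =>
    spinorForm η ((gamma (Pi.single i 1)).mulVec ((gamma (Pi.single j 1)).mulVec
      ((gamma (Pi.single k 1)).mulVec η))) with hb
  have hS : spinorMatrix c = spinorMatrix ((-t / spinorForm η η) • b) := by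
    rw [spinorMatrix_smul, hb, spinorMatrix_threeForm]
    apply Matrix.toLin'.injective
    refine LinearMap.ext fun s => ?_
    rw [hη, Matrix.toLin'_apply]
    funext a
    simp only [Pi.smul_apply, Pi.sub_apply, smul_eq_mul, Matrix.smul_mulVec, Matrix.sub_mulVec,
      Matrix.one_mulVec]
    have hsum : (Matrix.of fun a b => 8 * η a * (delta b * η b)).mulVec s a =
        8 * η a * spinorForm η s := by
      change ∑ b, 8 * η a * (delta b * η b) * s b = 8 * η a * ∑ b, delta b * η b * s b
      rw [Finset.mul_sum]
      exact Finset.sum_congr rfl fun b _ => by ring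
    rw [hsum]
    field_simp
    ring
  have hφη : φ = (-t / spinorForm η η) • hf.isSkewClifford.threeForm hh.1 η := by
    refine threeForm_ext f fun i j k hij hjk => ?_
    refine (eq_of_spinorMatrix_eq hS i j k hij hjk).trans ?_
    rw [AlternatingMap.smul_apply, IsSkewClifford.threeForm_apply, cliffordMul_apply,
      cliffordMul_apply, cliffordMul_apply]
    have hfs : ∀ i, f.equivFun (f i) = Pi.single i 1 := fun i => by
      simp [Basis.equivFun, Finsupp.single_eq_pi_single]
    simp only [hfs]
    rfl
  rw [hφη, heφ, smul_smul, div_mul_cancel₀ _ hN]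

end Eigen

/-! ### Reflections and the identity component of the isometries -/

section Component

variable {V : Type*} [AddCommGroup V] [Module ℝ V] {h : LinearMap.BilinForm ℝ V}

lemma SO0.isometry {A : V ≃ₗ[ℝ] V} (hA : A ∈ SO0 h) (x y : V) : h (A x) (A y) = h x y :=
  (@connectedComponentIn_subset _ (moduleTopology ℝ (Module.End ℝ V)) _ _ _ hA :
    (A : V →ₗ[ℝ] V) ∈ isometries h) x y

/-- A continuous function without zeros on the isometries has constant sign on `SO₀`. -/
lemma SO0.pos_of_continuous {f : Module.End ℝ V → ℝ}
    (hf : @Continuous _ _ (moduleTopology ℝ (Module.End ℝ V)) _ f)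
    (h0 : ∀ A ∈ isometries h, f A ≠ 0) (h1 : 0 < f 1) {A : V ≃ₗ[ℝ] V} (hA : A ∈ SO0 h) :
    0 < f (A : V →ₗ[ℝ] V) := by
  let _ : TopologicalSpace (Module.End ℝ V) := moduleTopology ℝ (Module.End ℝ V)
  by_contra hneg
  obtain ⟨B, hB, hB0⟩ := (isPreconnected_connectedComponentIn
    (F := isometries h) (x := (1 : Module.End ℝ V))).intermediate_value
    hA (one_mem_isometryComponent h) hf.continuousOn ⟨not_lt.mp hneg, h1.le⟩
  exact h0 B (connectedComponentIn_subset _ _ hB) hB0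

lemma hyperplaneReflection_mul_self (a : V) (ha : h a a ≠ 0) :
    hyperplaneReflection h a ha * hyperplaneReflection h a ha = 1 :=
  LinearEquiv.ext fun x => Module.involutive_reflection _ x

lemma mul_hyperplaneReflection {g : V ≃ₗ[ℝ] V} (hg : ∀ x y, h (g x) (g y) = h x y) (a : V)
    (ha : h a a ≠ 0) :
    g * hyperplaneReflection h a ha = hyperplaneReflection h (g a) (by rwa [hg]) * g := by
  ext x
  simp only [LinearEquiv.mul_apply, hyperplaneReflection_apply, map_sub, map_smul, hg]

/-- The reflections in `a` and in `b` are joined by those in the points of the segment from `a` to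
`b` or `-b`, provided that `a` and `b` have squares of the same sign. -/
lemma hyperplaneReflection_mul_mem_SO0 (hs : h.IsSymm) {a b : V} (ha : h a a ≠ 0) (hb : h b b ≠ 0)
    (hab : 0 < h a a * h b b) :
    hyperplaneReflection h a ha * hyperplaneReflection h b hb ∈ SO0 h := by
  wlog hpos : 0 ≤ h a b * h a a generalizing b
  · have hb' : h (-b) (-b) ≠ 0 := by simpa using hb
    have hR : hyperplaneReflection h b hb = hyperplaneReflection h (-b) hb' := by
      ext x; simp [hyperplaneReflection_apply]
    rw [hR]
    refine this hb' (by simpa using hab) ?_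
    rw [map_neg, neg_mul]
    linarith
  let _ : TopologicalSpace (Module.End ℝ V) := moduleTopology ℝ (Module.End ℝ V)
  have : IsModuleTopology ℝ (Module.End ℝ V) := ⟨rfl⟩
  have : ContinuousSMul ℝ (Module.End ℝ V) := IsModuleTopology.toContinuousSMul ℝ _
  have : IsTopologicalAddGroup (Module.End ℝ V) := IsModuleTopology.topologicalAddGroup ℝ _
  -- the points of the segment are not null, by the choice of the sign of `b`
  let c : ℝ → V := fun t => (1 - t) • a + t • b
  have hcc : ∀ t, h (c t) (c t) = (1 - t) ^ 2 * h a a + 2 * t * (1 - t) * h a b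
      + t ^ 2 * h b b := by
    intro t
    simp only [c, map_add, map_smul, LinearMap.add_apply, LinearMap.smul_apply, smul_eq_mul]
    rw [hs.eq b a]; ring
  have hc0 : ∀ t ∈ Set.Icc (0 : ℝ) 1, h (c t) (c t) ≠ 0 := by
    rintro t ⟨h0, h1⟩ hz
    have h2 : h (c t) (c t) * h a a = (1 - t) ^ 2 * h a a ^ 2 + 2 * t * (1 - t) * (h a b * h a a)
      + t ^ 2 * (h a a * h b b) := by rw [hcc]; ring
    rw [hz, zero_mul] at h2
    have h3 : 0 ≤ 2 * t * (1 - t) * (h a b * h a a) :=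
      mul_nonneg (mul_nonneg (by linarith) (by linarith)) hpos
    have h4 : 0 ≤ t ^ 2 * (h a a * h b b) := by positivity
    have h5 : 0 ≤ (1 - t) ^ 2 * h a a ^ 2 := by positivity
    have h6 : t ^ 2 * (h a a * h b b) = 0 := by linarith
    have h7 : (1 - t) ^ 2 * h a a ^ 2 = 0 := by linarith
    have h8 : t = 0 := by
      rcases mul_eq_zero.mp h6 with h | h
      · exact pow_eq_zero_iff (two_ne_zero) |>.mp h
      · exact absurd h hab.ne'
    rw [h8] at h7
    simp [ha] at h7
  -- the reflection in `c t` depends continuously on `t`, as a function with values in `End V`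
  let E : V → V → Module.End ℝ V := fun u v => (h u).smulRight v
  let F : ℝ → Module.End ℝ V := fun t => (1 - (2 / h (c t) (c t)) • ((1 - t) ^ 2 • E a a
    + (t * (1 - t)) • (E a b + E b a) + t ^ 2 • E b b)) *
      (hyperplaneReflection h b hb : V →ₗ[ℝ] V)
  have hF : ∀ t (ht : t ∈ Set.Icc (0 : ℝ) 1), F t =
      ((hyperplaneReflection h (c t) (hc0 t ht) * hyperplaneReflection h b hb : V ≃ₗ[ℝ] V) :
        V →ₗ[ℝ] V) := by
    intro t ht
    ext x
    change _ = hyperplaneReflection h (c t) (hc0 t ht) (hyperplaneReflection h b hb x)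
    rw [hyperplaneReflection_apply _ (c t)]
    simp only [F, E, Module.End.mul_apply, LinearMap.sub_apply, LinearMap.smul_apply,
      LinearMap.add_apply, LinearMap.smulRight_apply, Module.End.one_apply, LinearEquiv.coe_coe]
    generalize 2 / h (c t) (c t) = r
    simp only [c, map_add, map_smul, LinearMap.add_apply, LinearMap.smul_apply, smul_eq_mul]
    module
  have hFc : ContinuousOn F (Set.Icc 0 1) := by
    have hmul : Continuous (fun C : Module.End ℝ V =>
        C * (hyperplaneReflection h b hb : V →ₗ[ℝ] V)) :=
      IsModuleTopology.continuous_of_linearMap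
        (LinearMap.mulRight ℝ (hyperplaneReflection h b hb : V →ₗ[ℝ] V))
    refine hmul.comp_continuousOn (continuousOn_const.sub (ContinuousOn.fun_smul ?_ ?_))
    · refine continuousOn_const.div ?_ hc0
      simp only [hcc]
      fun_prop
    · fun_prop
  have hp := isPreconnected_Icc.image F hFc
  have hsub : F '' Set.Icc 0 1 ⊆ isometries h := by
    rintro _ ⟨t, ht, rfl⟩ x y
    rw [hF t ht]
    exact (hyperplaneReflection_isometry hs _ (hc0 t ht) _ _).trans
      (hyperplaneReflection_isometry hs _ _ _ _)
  have h1 : F 1 = 1 := by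
    rw [hF 1 (by simp)]
    have : c 1 = b := by simp [c]
    simp only [this, hyperplaneReflection_mul_self]
    rfl
  have h2 := hp.subset_connectedComponentIn (x := 1) ⟨1, by simp, h1⟩ hsub
  have h3 := h2 ⟨0, by simp, rfl⟩
  rw [hF 0 (by simp)] at h3
  have : c 0 = a := by simp [c]
  simp only [this] at h3
  exact h3

end Component

section Cosets

variable {V : Type*} [AddCommGroup V] [Module ℝ V] {h : LinearMap.BilinForm ℝ V}
  {e : Basis (Fin 7) ℝ V}

/-- Every isometry is a product of reflections, in the form of an induction principle. -/
lemma IsOrthonormalBasis.isometry_induction (he : IsOrthonormalBasis h e) (hs : h.IsSymm)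
    (P : (V ≃ₗ[ℝ] V) → Prop) (h1 : P 1)
    (hR : ∀ a (ha : h a a ≠ 0) (A : V ≃ₗ[ℝ] V), P (hyperplaneReflection h a ha * A) → P A)
    (A : V ≃ₗ[ℝ] V) (hA : ∀ x y, h (A x) (A y) = h x y) : P A := by
  -- induction on the number `n` of basis vectors that are not known to be fixed
  suffices H : ∀ n k : ℕ, n + k = 7 → ∀ A : V ≃ₗ[ℝ] V, (∀ x y, h (A x) (A y) = h x y) →
      (∀ j : Fin 7, (j : ℕ) < k → A (e j) = e j) → P A from
    H 7 0 rfl A hA fun j hj => absurd hj (Nat.not_lt_zero _)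
  intro n
  induction n with
  | zero =>
    intro k hk A _ hfix
    have : A = 1 := by
      apply LinearEquiv.toLinearMap_injective
      exact e.ext fun j => hfix j (by omega)
    rwa [this]
  | succ n ih =>
    intro k hk A hA hfix
    set i : Fin 7 := ⟨k, by omega⟩ with hi
    have hnext : ∀ A : V ≃ₗ[ℝ] V, (∀ x y, h (A x) (A y) = h x y) →
        (∀ j : Fin 7, (j : ℕ) < k → A (e j) = e j) → A (e i) = e i → P A := by
      intro A hA hfix hAi
      refine ih (k + 1) (by omega) A hA fun j hj => ?_
      rcases Nat.lt_succ_iff_lt_or_eq.mp hj with h2 | h2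
      · exact hfix j h2
      · rwa [show j = i from Fin.ext h2]
    have hort : ∀ j : Fin 7, (j : ℕ) < k → h (A (e i)) (e j) = 0 ∧ h (e i) (e j) = 0 := by
      intro j hj
      have hij : i ≠ j := fun H => by rw [← H] at hj; exact lt_irrefl _ hj
      have h0 : h (e i) (e j) = 0 := by rw [he, if_neg hij]
      refine ⟨?_, h0⟩
      conv_lhs => rw [← hfix j hj]
      rw [hA, h0]
    have huu : h (A (e i)) (A (e i)) = h (e i) (e i) := hA _ _
    have hww : h (e i) (e i) ≠ 0 := by rw [he, if_pos rfl]; exact eps_ne_zero i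
    have hcomm := hs.eq (A (e i)) (e i)
    -- reflect in the difference of `e i` and its image, or, if it is null, in their sum
    by_cases hm : h (A (e i) - e i) (A (e i) - e i) = 0
    · have hp : h (A (e i) + e i) (A (e i) + e i) ≠ 0 := by
        simp only [map_sub, map_add, LinearMap.sub_apply, LinearMap.add_apply] at hm ⊢
        intro H
        exact hww (by linarith)
      refine hR _ hp _ (hR _ hww _ (hnext _ ?_ ?_ ?_))
      · intro x y
        simp only [LinearEquiv.mul_apply, hyperplaneReflection_isometry hs, hA]
      · intro j hj
        simp only [LinearEquiv.mul_apply, hfix j hj, hyperplaneReflection_apply, map_add,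
          LinearMap.add_apply, hort j hj]
        simp [hort j hj]
      · have h3 : 2 / h (A (e i) + e i) (A (e i) + e i) * h (A (e i) + e i) (A (e i)) = 1 := by
          rw [div_mul_eq_mul_div, div_eq_one_iff_eq hp]
          simp only [map_add, LinearMap.add_apply]
          linarith
        have h4 : hyperplaneReflection h _ hp (A (e i)) = -e i := by
          rw [hyperplaneReflection_apply, h3, one_smul]; abel
        rw [LinearEquiv.mul_apply, LinearEquiv.mul_apply, h4, hyperplaneReflection_apply, map_neg,
          mul_neg, div_mul_cancel₀ _ hww]
        module
    · refine hR _ hm _ (hnext _ ?_ ?_ ?_)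
      · intro x y
        simp only [LinearEquiv.mul_apply, hyperplaneReflection_isometry hs, hA]
      · intro j hj
        simp only [LinearEquiv.mul_apply, hfix j hj, hyperplaneReflection_apply, map_sub,
          LinearMap.sub_apply, hort j hj]
        simp
      · have h3 : 2 / h (A (e i) - e i) (A (e i) - e i) * h (A (e i) - e i) (A (e i)) = 1 := by
          rw [div_mul_eq_mul_div, div_eq_one_iff_eq hm]
          simp only [map_sub, LinearMap.sub_apply]
          linarith
        rw [LinearEquiv.mul_apply, hyperplaneReflection_apply, h3, one_smul]; abel

/-- The isometries form at most four cosets of `SO₀`, represented by the products of the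
reflections in a positive vector `p` and in a negative vector `n`. -/
lemma IsOrthonormalBasis.mem_SO0_cosets (he : IsOrthonormalBasis h e) (hs : h.IsSymm) {p n : V}
    (hp : 0 < h p p) (hn : h n n < 0) (A : V ≃ₗ[ℝ] V) (hA : ∀ x y, h (A x) (A y) = h x y) :
    A ∈ SO0 h ∨ hyperplaneReflection h p hp.ne' * A ∈ SO0 h ∨
      hyperplaneReflection h n hn.ne * A ∈ SO0 h ∨
      hyperplaneReflection h n hn.ne * (hyperplaneReflection h p hp.ne' * A) ∈ SO0 h := by
  refine he.isometry_induction hs (fun A => A ∈ SO0 h ∨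
    hyperplaneReflection h p hp.ne' * A ∈ SO0 h ∨ hyperplaneReflection h n hn.ne * A ∈ SO0 h ∨
    hyperplaneReflection h n hn.ne * (hyperplaneReflection h p hp.ne' * A) ∈ SO0 h)
    (Or.inl (one_mem _)) (fun a ha A => ?_) A hA
  -- `R` and `Q` stand for the reflections in `p` and in `n`
  set R := hyperplaneReflection h p hp.ne' with hR
  set Q := hyperplaneReflection h n hn.ne with hQ
  set S := hyperplaneReflection h a ha with hS
  have hRR : ∀ B, R * (R * B) = B := fun B => by
    rw [← mul_assoc, hyperplaneReflection_mul_self, one_mul]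
  have hQQ : ∀ B, Q * (Q * B) = B := fun B => by
    rw [← mul_assoc, hyperplaneReflection_mul_self, one_mul]
  have hRi : ∀ x y, h (R x) (R y) = h x y := hyperplaneReflection_isometry hs _ _
  have hQi : ∀ x y, h (Q x) (Q y) = h x y := hyperplaneReflection_isometry hs _ _
  have hSS : ∀ B, S * (S * B) = B := fun B => by
    rw [← mul_assoc, hyperplaneReflection_mul_self, one_mul]
  obtain ⟨B, rfl⟩ : ∃ B, A = S * B := ⟨S * A, (hSS A).symm⟩
  rw [hSS]
  rcases lt_or_gt_of_ne ha with ha' | ha'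
  · have hS' : ∀ B, R * (S * B) =
        hyperplaneReflection h (R a) (by rwa [hRi]) * (R * B) := fun B => by
      rw [← mul_assoc, mul_hyperplaneReflection hRi, mul_assoc]
    have hra : h (R a) (R a) < 0 := by rwa [hRi]
    rintro (hB | hB | hB | hB)
    · right; right; left
      rw [← mul_assoc]
      exact mul_mem (hyperplaneReflection_mul_mem_SO0 hs _ _ (mul_pos_of_neg_of_neg hn ha')) hB
    · right; right; right
      rw [hS', ← mul_assoc]
      exact mul_mem (hyperplaneReflection_mul_mem_SO0 hs _ _ (mul_pos_of_neg_of_neg hn hra)) hB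
    · left
      rw [← hQQ B, ← mul_assoc]
      exact mul_mem (hyperplaneReflection_mul_mem_SO0 hs _ _ (mul_pos_of_neg_of_neg ha' hn)) hB
    · right; left
      rw [hS', ← hQQ (R * B), ← mul_assoc]
      exact mul_mem (hyperplaneReflection_mul_mem_SO0 hs _ _ (mul_pos_of_neg_of_neg hra hn)) hB
  · have hS' : ∀ B, Q * (S * B) =
        hyperplaneReflection h (Q a) (by rwa [hQi]) * (Q * B) := fun B => by
      rw [← mul_assoc, mul_hyperplaneReflection hQi, mul_assoc]
    have hR' : ∀ B, Q * (R * B) = hyperplaneReflection h (Q p) (by rw [hQi]; exact hp.ne') *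
        (Q * B) := fun B => by
      rw [← mul_assoc, mul_hyperplaneReflection hQi, mul_assoc]
    have hqa : 0 < h (Q a) (Q a) := by rwa [hQi]
    have hqp : 0 < h (Q p) (Q p) := by rwa [hQi]
    rintro (hB | hB | hB | hB)
    · right; left
      rw [← mul_assoc]
      exact mul_mem (hyperplaneReflection_mul_mem_SO0 hs _ _ (mul_pos hp ha')) hB
    · left
      rw [← hRR B, ← mul_assoc]
      exact mul_mem (hyperplaneReflection_mul_mem_SO0 hs _ _ (mul_pos ha' hp)) hB
    · right; right; right
      rw [hR', hS', ← mul_assoc]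
      exact mul_mem (hyperplaneReflection_mul_mem_SO0 hs _ _ (mul_pos hqp hqa)) hB
    · right; right; left
      rw [hS', ← hRR B, hR', ← mul_assoc]
      exact mul_mem (hyperplaneReflection_mul_mem_SO0 hs _ _ (mul_pos hqa hqp)) hB

end Cosets

/-! ### The stabilizer of the canonical three-form -/

section TripleWedge

variable {V : Type*} [AddCommGroup V] [Module ℝ V]

lemma basisThreeForm_apply_eq_zero (e : Basis (Fin 7) ℝ V) {i j k m : Fin 7} (x : Fin 3 → V)
    (a : Fin 3) (ha : x a = e m) (hi : m ≠ i) (hj : m ≠ j) (hk : m ≠ k) :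
    basisThreeForm e i j k x = 0 := by
  refine Matrix.det_eq_zero_of_row_eq_zero (A := Matrix.of fun a =>
    LinearMap.pi ![e.coord i, e.coord j, e.coord k] (x a)) a fun b => ?_
  rw [Matrix.of_apply, ha]
  fin_cases b <;> simp [hi, hj, hk]

lemma wedge_four_three_apply (α : ExtForm V 4) (β : ExtForm V 3) (x : Fin 7 → V)
    (H : ∀ (y : Fin 3 → V) (a : Fin 3) (b : Fin 4), y a = x (Fin.castAdd 3 b) → β y = 0) :
    (wedge α β : ExtForm V 7) x = α ![x 0, x 1, x 2, x 3] * β ![x 4, x 5, x 6] := by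
  have h1 := wedge_apply_of_unique_shuffle α β x fun σ a b hab =>
    H _ a b (by rw [hab]; rfl)
  have h2 : (fun a => x (Fin.castAdd 3 a)) = ![x 0, x 1, x 2, x 3] := by
    funext a; fin_cases a <;> rfl
  have h3 : (fun a => x (Fin.natAdd 4 a)) = ![x 4, x 5, x 6] := by
    funext a; fin_cases a <;> rfl
  rw [h2, h3] at h1
  exact h1

/-- The only shuffle that contributes to the value of `α ∧ eⁱʲᵏ` on the basis vectors, in an order
that ends with `i`, `j`, `k`, is the identity. -/
lemma wedge_basisThreeForm_apply (e : Basis (Fin 7) ℝ V) (α : ExtForm V 4)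
    {p : Fin 7 → Fin 7} {s : ℤ} (hp : Function.Injective p ∧ levi p = s) :
    (wedge α (basisThreeForm e (p 4) (p 5) (p 6)) : ExtForm V 7) e =
      s * α ![e (p 0), e (p 1), e (p 2), e (p 3)] := by
  obtain ⟨τ, rfl, hτ⟩ := exists_perm_sign_eq_levi hp.1
  rw [hp.2] at hτ
  have h2 := wedge_four_three_apply α (basisThreeForm e (τ 4) (τ 5) (τ 6)) (e ∘ τ) (by
    intro y a b hab
    refine basisThreeForm_apply_eq_zero e y a hab ?_ ?_ ?_
    all_goals
      intro H
      exact absurd (τ.injective H) (by clear * -; revert b; decide))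
  have h45 : τ 4 ≠ τ 5 := fun H => absurd (τ.injective H) (by decide)
  have h46 : τ 4 ≠ τ 6 := fun H => absurd (τ.injective H) (by decide)
  have h56 : τ 5 ≠ τ 6 := fun H => absurd (τ.injective H) (by decide)
  have h3 : basisThreeForm e (τ 4) (τ 5) (τ 6) ![e (τ 4), e (τ 5), e (τ 6)] = 1 := by
    rw [basisThreeForm_apply]
    simp [minor, h45, h46, h56, h45.symm, h46.symm, h56.symm]
  simp only [Function.comp_apply, h3, mul_one] at h2
  rw [← h2, AlternatingMap.map_perm, Units.smul_def, hτ, zsmul_eq_mul, ← mul_assoc]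
  have hss : (s : ℝ) * s = 1 := by
    rw [← hτ]
    rcases Int.units_eq_one_or (Equiv.Perm.sign τ) with h | h <;> rw [h] <;> simp
  rw [hss, one_mul]

lemma eq_smul_det_of_apply_basis {e : Basis (Fin 7) ℝ V} {ω : ExtForm V 7} {c : ℝ} (H : ω e = c) :
    ω = c • e.det := by
  rw [← H]; exact AlternatingMap.eq_smul_basis_det e ω

lemma contract_canonicalThreeForm_apply (e : Basis (Fin 7) ℝ V) (u : V) (i j : Fin 7) :
    contract u (canonicalThreeForm e) ![e i, e j] =
      canonicalPoly (e.equivFun u) (Pi.single i 1) (Pi.single j 1) := by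
  have hfs : ∀ i, e.equivFun (e i) = Pi.single i 1 := fun i => by
    simp [Basis.equivFun, Finsupp.single_eq_pi_single]
  rw [contract_apply, canonicalThreeForm_apply, ← hfs, ← hfs]
  rfl

/-- The metric induced by the canonical three-form is, up to the orientation, the one for which the
basis is pseudo-orthonormal. -/
theorem IsOrthonormalBasis.wedge_contract_canonicalThreeForm {h : LinearMap.BilinForm ℝ V}
    {e : Basis (Fin 7) ℝ V} (he : IsOrthonormalBasis h e) (u v : V) :
    wedge (wedge (contract u (canonicalThreeForm e)) (contract v (canonicalThreeForm e)))
      (canonicalThreeForm e) = (-6 * h u v) • e.det := by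
  set α : ExtForm V 4 :=
    wedge (contract u (canonicalThreeForm e)) (contract v (canonicalThreeForm e)) with hα
  have hα' : ∀ i j k l, α ![e i, e j, e k, e l] = _ := fun i j k l =>
    wedge_two_two_apply _ _ ![e i, e j, e k, e l]
  simp only [Matrix.cons_val_zero, Matrix.cons_val_one, Matrix.cons_val,
    contract_canonicalThreeForm_apply] at hα'
  refine eq_smul_det_of_apply_basis ?_
  have hneg : ∀ β : ExtForm V 3, wedge α (-β) = -wedge α β := fun β => by
    rw [← neg_one_smul ℝ β, wedge_smul_right]; exact neg_one_smul ℝ (wedge α β)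
  rw [canonicalThreeForm]
  simp only [sub_eq_add_neg, wedge_add_right, hneg]
  simp only [AlternatingMap.add_apply, AlternatingMap.neg_apply]
  have h1 := wedge_basisThreeForm_apply e α (p := ![2, 3, 4, 5, 0, 1, 6]) (s := 1) (by decide)
  have h2 := wedge_basisThreeForm_apply e α (p := ![1, 3, 5, 6, 0, 2, 4]) (s := -1) (by decide)
  have h3 := wedge_basisThreeForm_apply e α (p := ![1, 2, 4, 6, 0, 3, 5]) (s := -1) (by decide)
  have h4 := wedge_basisThreeForm_apply e α (p := ![0, 3, 4, 6, 1, 2, 5]) (s := -1) (by decide)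
  have h5 := wedge_basisThreeForm_apply e α (p := ![0, 2, 5, 6, 1, 3, 4]) (s := -1) (by decide)
  have h6 := wedge_basisThreeForm_apply e α (p := ![0, 1, 4, 5, 2, 3, 6]) (s := 1) (by decide)
  have h7 := wedge_basisThreeForm_apply e α (p := ![0, 1, 2, 3, 4, 5, 6]) (s := 1) (by decide)
  simp only [Matrix.cons_val_zero, Matrix.cons_val_one, Matrix.cons_val, hα']
    at h1 h2 h3 h4 h5 h6 h7
  rw [h1, h2, h3, h4, h5, h6, h7, he.apply_eq_sum]
  simp only [← Basis.equivFun_apply]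
  generalize e.equivFun u = x
  generalize e.equivFun v = y
  simp [canonicalPoly, minor, Fin.sum_univ_seven, eps]
  ring

/-- The metric for which the basis `e` is pseudo-orthonormal. -/
noncomputable def standardMetric (e : Basis (Fin 7) ℝ V) : LinearMap.BilinForm ℝ V :=
  Matrix.toBilin e (Matrix.diagonal eps)

lemma isOrthonormalBasis_standardMetric (e : Basis (Fin 7) ℝ V) :
    IsOrthonormalBasis (standardMetric e) e := fun i j => by
  rw [← LinearMap.BilinForm.toMatrix_apply, standardMetric, LinearMap.BilinForm.toMatrix_toBilin,
    Matrix.diagonal_apply]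

end TripleWedge

section Stabilizer

variable {V : Type*} [AddCommGroup V] [Module ℝ V]

lemma contract_compLinearMap {k : ℕ} (φ : ExtForm V (k + 1)) (A : V →ₗ[ℝ] V) (u : V) :
    (contract (A u) φ).compLinearMap A = contract u (φ.compLinearMap A) := by
  ext x
  rw [AlternatingMap.compLinearMap_apply, contract_apply, contract_apply,
    AlternatingMap.compLinearMap_apply]
  congr 1
  funext a
  refine Fin.cases ?_ (fun a => ?_) a <;> rfl

lemma tripleWedge_compLinearMap (φ : ExtForm V 3) (A : V →ₗ[ℝ] V) (u v : V) :
    (wedge (wedge (contract (A u) φ) (contract (A v) φ)) φ).compLinearMap A =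
      wedge (wedge (contract u (φ.compLinearMap A)) (contract v (φ.compLinearMap A)))
        (φ.compLinearMap A) := by
  rw [← wedge_compLinearMap, ← wedge_compLinearMap, contract_compLinearMap, contract_compLinearMap]

/-- The triple product `ι_u φ ∧ ι_v φ ∧ φ` is natural, so that the stabilizer of the canonical
three-form preserves its induced metric up to the inverse of the determinant `d`; a comparison of
the determinants of the Gram matrices shows that `d ^ 9 = 1`. -/
theorem IsOrthonormalBasis.isometry_and_det_of_mem_stabilizer {h : LinearMap.BilinForm ℝ V}
    {e : Basis (Fin 7) ℝ V} (he : IsOrthonormalBasis h e) {A : V ≃ₗ[ℝ] V}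
    (hA : A ∈ stabilizer (canonicalThreeForm e)) :
    (∀ x y, h (A x) (A y) = h x y) ∧ LinearMap.det (A : V →ₗ[ℝ] V) = 1 := by
  have hA' : (canonicalThreeForm e).compLinearMap (A : V →ₗ[ℝ] V) = canonicalThreeForm e := hA
  set d := LinearMap.det (A : V →ₗ[ℝ] V) with hd
  have key : ∀ u v, d * h (A u) (A v) = h u v := by
    intro u v
    have h1 := he.wedge_contract_canonicalThreeForm u v
    have h2 := he.wedge_contract_canonicalThreeForm (A u) (A v)
    have h3 := tripleWedge_compLinearMap (canonicalThreeForm e) (A : V →ₗ[ℝ] V) u v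
    rw [hA'] at h3
    have h4 := congrArg (fun ω : ExtForm V 7 => ω.compLinearMap (A : V →ₗ[ℝ] V)) h2
    have h5 : (-6 * h u v) • e.det =
        ((-6 * h (A u) (A v)) • e.det).compLinearMap (A : V →ₗ[ℝ] V) :=
      h1.symm.trans (h3.symm.trans h4)
    have h6 := DFunLike.congr_fun h5 ⇑e
    simp only [AlternatingMap.smul_apply, AlternatingMap.compLinearMap_apply, smul_eq_mul,
      Basis.det_self, mul_one] at h6
    have h7 : e.det (fun i => (A : V →ₗ[ℝ] V) (e i)) = d := by
      have := e.det_comp (A : V →ₗ[ℝ] V) e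
      rw [Basis.det_self, mul_one] at this
      exact this
    rw [h7] at h6
    linarith
  have hd1 : d = 1 := by
    have h1 : LinearMap.BilinForm.toMatrix e h =
        d • LinearMap.BilinForm.toMatrix e (h.comp (A : V →ₗ[ℝ] V) (A : V →ₗ[ℝ] V)) := by
      ext i j
      rw [Matrix.smul_apply, LinearMap.BilinForm.toMatrix_apply, LinearMap.BilinForm.toMatrix_apply,
        smul_eq_mul]
      exact (key _ _).symm
    have h2 := congrArg Matrix.det h1
    rw [LinearMap.BilinForm.toMatrix_comp e e, Matrix.det_smul, Matrix.det_mul, Matrix.det_mul,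
      Matrix.det_transpose, LinearMap.det_toMatrix, he.toMatrix_det, Fintype.card_fin, ← hd] at h2
    have h3 : d ^ 9 = 1 ^ 9 := by linear_combination h2
    exact (Odd.strictMono_pow (by decide : Odd 9)).injective h3
  refine ⟨fun x y => ?_, hd1⟩
  have := key x y
  rwa [hd1, one_mul] at this

lemma IsOrthonormalBasis.apply_equivFun {h : LinearMap.BilinForm ℝ V}
    {e : Basis (Fin 7) ℝ V} (he : IsOrthonormalBasis h e) (x y : V) :
    h x y = ∑ i, eps i * e.equivFun x i * e.equivFun y i := he.apply_eq_sum x y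

/-- The cross product of two vectors, defined by `h(u × v, x) = φ(u, v, x)`. -/
lemma IsOrthonormalBasis.exists_crossProduct {h : LinearMap.BilinForm ℝ V}
    {e : Basis (Fin 7) ℝ V} (he : IsOrthonormalBasis h e) (u v : V) :
    ∃ w, (∀ x, h w x = canonicalThreeForm e ![u, v, x]) ∧
      h w w = -(h u u * h v v - h u v ^ 2) := by
  refine ⟨e.equivFun.symm fun i =>
    eps i * canonicalPoly (e.equivFun u) (e.equivFun v) (Pi.single i 1), fun x => ?_, ?_⟩
  · rw [he.apply_equivFun, LinearEquiv.apply_symm_apply, canonicalThreeForm_apply]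
    simp only [Matrix.cons_val_zero, Matrix.cons_val_one, Matrix.cons_val]
    generalize e.equivFun u = u
    generalize e.equivFun v = v
    generalize e.equivFun x = x
    simp [canonicalPoly, minor, Fin.sum_univ_seven, eps]
    ring
  · simp only [he.apply_equivFun, LinearEquiv.apply_symm_apply]
    generalize e.equivFun u = u
    generalize e.equivFun v = v
    simp [canonicalPoly, minor, Fin.sum_univ_seven, eps]
    ring

/-- An isometry cannot map the negative basis vectors to vectors on which the canonical three-form
vanishes: the cross product of two of them would be a fourth negative direction. -/
lemma IsOrthonormalBasis.canonicalThreeForm_negative_ne_zero {h : LinearMap.BilinForm ℝ V}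
    {e : Basis (Fin 7) ℝ V} (he : IsOrthonormalBasis h e) {A : V ≃ₗ[ℝ] V}
    (hA : ∀ x y, h (A x) (A y) = h x y) :
    canonicalThreeForm e ![A (e 4), A (e 5), A (e 6)] ≠ 0 := by
  intro H
  obtain ⟨w, hw, hww⟩ := he.exists_crossProduct (A (e 4)) (A (e 5))
  obtain ⟨x, rfl⟩ := A.surjective w
  have h4 : h (A x) (A (e 4)) = 0 := by
    rw [hw]; exact AlternatingMap.map_eq_zero_of_eq _ _ (i := 0) (j := 2) rfl (by decide)
  have h5 : h (A x) (A (e 5)) = 0 := by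
    rw [hw]; exact AlternatingMap.map_eq_zero_of_eq _ _ (i := 1) (j := 2) rfl (by decide)
  have h6 := (hw (A (e 6))).trans H
  rw [hA, he.apply_equivFun] at h4 h5 h6
  rw [hA, hA, hA, hA, he 4 4, he 5 5, he 4 5, he.apply_equivFun] at hww
  simp [Fin.sum_univ_seven, eps] at h4 h5 h6 hww
  rw [h4, h5, h6] at hww
  nlinarith [sq_nonneg (e.repr x 0), sq_nonneg (e.repr x 1), sq_nonneg (e.repr x 2),
    sq_nonneg (e.repr x 3)]

lemma IsOrthonormalBasis.det_hyperplaneReflection {h : LinearMap.BilinForm ℝ V}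
    {e : Basis (Fin 7) ℝ V} (he : IsOrthonormalBasis h e) (i : Fin 7) (hi : h (e i) (e i) ≠ 0) :
    LinearMap.det (hyperplaneReflection h (e i) hi : V →ₗ[ℝ] V) = -1 := by
  have h1 := e.det_comp (hyperplaneReflection h (e i) hi : V →ₗ[ℝ] V) e
  rw [Basis.det_self, mul_one] at h1
  rw [← h1]
  have h2 : (hyperplaneReflection h (e i) hi : V →ₗ[ℝ] V) ∘ e = Function.update e i (-e i) := by
    funext j
    rw [Function.comp_apply, LinearEquiv.coe_coe, hyperplaneReflection_apply]
    by_cases hij : j = i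
    · subst hij
      rw [Function.update_self, div_mul_cancel₀ _ hi]
      module
    · rw [Function.update_of_ne hij, he i j, if_neg (Ne.symm hij)]
      simp
  rw [h2, AlternatingMap.map_update_neg, Function.update_eq_self, Basis.det_self]

lemma IsOrthonormalBasis.exists_linearEquiv_of_mem_isometries {h : LinearMap.BilinForm ℝ V}
    {e : Basis (Fin 7) ℝ V} (he : IsOrthonormalBasis h e) {B : Module.End ℝ V}
    (hB : B ∈ isometries h) : ∃ B' : V ≃ₗ[ℝ] V, (B' : V →ₗ[ℝ] V) = B := by
  have : FiniteDimensional ℝ V := Module.Basis.finiteDimensional_of_finite e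
  refine ⟨LinearEquiv.ofInjectiveEndo B ((injective_iff_map_eq_zero B).mpr fun x hx => ?_), by
    ext; rfl⟩
  refine e.equivFun.injective (funext fun i => ?_)
  have h1 := hB x (e i)
  rw [hx, map_zero, LinearMap.zero_apply, he.apply_equivFun] at h1
  have h2 := eps_ne_zero i
  simp at h1
  simpa [h2] using h1

lemma IsOrthonormalBasis.det_pos_of_mem_SO0 {h : LinearMap.BilinForm ℝ V}
    {e : Basis (Fin 7) ℝ V} (he : IsOrthonormalBasis h e) {A : V ≃ₗ[ℝ] V} (hA : A ∈ SO0 h) :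
    0 < LinearMap.det (A : V →ₗ[ℝ] V) := by
  let _ : TopologicalSpace (Module.End ℝ V) := moduleTopology ℝ (Module.End ℝ V)
  have : IsModuleTopology ℝ (Module.End ℝ V) := ⟨rfl⟩
  refine SO0.pos_of_continuous (f := LinearMap.det) ?_ ?_ ?_ hA
  · have h1 : Continuous fun B : Module.End ℝ V => LinearMap.toMatrix e e B :=
      IsModuleTopology.continuous_of_linearMap (LinearMap.toMatrix e e).toLinearMap
    exact h1.matrix_det.congr fun B => LinearMap.det_toMatrix e B
  · intro B hB
    obtain ⟨B, rfl⟩ := he.exists_linearEquiv_of_mem_isometries hB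
    exact (LinearEquiv.isUnit_det' B).ne_zero
  · rw [map_one]; exact one_pos

lemma IsOrthonormalBasis.canonicalThreeForm_negative_pos {h : LinearMap.BilinForm ℝ V}
    {e : Basis (Fin 7) ℝ V} (he : IsOrthonormalBasis h e) {A : V ≃ₗ[ℝ] V} (hA : A ∈ SO0 h) :
    0 < canonicalThreeForm e ![A (e 4), A (e 5), A (e 6)] := by
  let _ : TopologicalSpace (Module.End ℝ V) := moduleTopology ℝ (Module.End ℝ V)
  have : IsModuleTopology ℝ (Module.End ℝ V) := ⟨rfl⟩
  have key := SO0.pos_of_continuous (h := h) (A := A)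
    (f := fun B => canonicalThreeForm e ![B (e 4), B (e 5), B (e 6)]) ?_ ?_ ?_ hA
  · exact key
  · have h3 : ∀ i j, Continuous fun B : Module.End ℝ V => e.equivFun (B (e i)) j :=
      fun i j => IsModuleTopology.continuous_of_linearMap
        ((e.coord j).comp (LinearMap.applyₗ (e i)))
    simp only [canonicalThreeForm_apply, canonicalPoly, minor, Matrix.cons_val_zero,
      Matrix.cons_val_one, Matrix.cons_val]
    fun_prop
  · intro B hB
    obtain ⟨B, rfl⟩ := he.exists_linearEquiv_of_mem_isometries hB
    exact he.canonicalThreeForm_negative_ne_zero hB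
  · rw [canonicalThreeForm_apply]
    simp [canonicalPoly, minor]

/-- The stabilizer of the canonical three-form of a pseudo-orthonormal basis is contained in
`SO₀`: the other three components of the isometries are excluded by the signs of the determinant
and of `A ↦ φ(A e₅, A e₆, A e₇)`. -/
theorem IsOrthonormalBasis.stabilizer_le_SO0 {h : LinearMap.BilinForm ℝ V}
    {e : Basis (Fin 7) ℝ V} (he : IsOrthonormalBasis h e) :
    stabilizer (canonicalThreeForm e) ≤ SO0 h := by
  intro A hA
  obtain ⟨hiso, hdet⟩ := he.isometry_and_det_of_mem_stabilizer hA
  have hs : h.IsSymm := isSymm_of_diagonal e he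
  have hp : 0 < h (e 0) (e 0) := by rw [he]; simp [eps]
  have hn : h (e 4) (e 4) < 0 := by rw [he]; simp [eps]
  have hdet' : ∀ i (hi : h (e i) (e i) ≠ 0), hyperplaneReflection h (e i) hi * A ∉ SO0 h := by
    intro i hi hB
    have h2 := he.det_pos_of_mem_SO0 hB
    have h3 : LinearMap.det ((hyperplaneReflection h (e i) hi * A : V ≃ₗ[ℝ] V) : V →ₗ[ℝ] V) =
        -1 * 1 := by
      rw [← he.det_hyperplaneReflection i hi, ← hdet, ← LinearMap.det_comp]; rfl
    linarith
  rcases he.mem_SO0_cosets hs hp hn A hiso with h1 | h1 | h1 | h1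
  · exact h1
  · exact absurd h1 (hdet' 0 hp.ne')
  · exact absurd h1 (hdet' 4 hn.ne)
  · exfalso
    -- the inverse of the element of `SO₀` maps `e 4` to `-A⁻¹ (e 4)`
    have hC : (hyperplaneReflection h (e 4) hn.ne *
        (hyperplaneReflection h (e 0) hp.ne' * A))⁻¹ =
        A⁻¹ * (hyperplaneReflection h (e 0) hp.ne' * hyperplaneReflection h (e 4) hn.ne) := by
      simp only [mul_inv_rev, inv_eq_of_mul_eq_one_right (hyperplaneReflection_mul_self _ _),
        mul_assoc]
    have h3 := he.canonicalThreeForm_negative_pos (inv_mem h1)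
    have hAi : (canonicalThreeForm e).compLinearMap ((A⁻¹ : V ≃ₗ[ℝ] V) : V →ₗ[ℝ] V) =
        canonicalThreeForm e := inv_mem hA
    have h4 : ∀ x y z, canonicalThreeForm e ![A⁻¹ x, A⁻¹ y, A⁻¹ z] =
        canonicalThreeForm e ![x, y, z] := fun x y z => by
      conv_rhs => rw [← hAi, AlternatingMap.compLinearMap_apply]
      congr 1
      funext a
      fin_cases a <;> rfl
    have hCe : ∀ i, hyperplaneReflection h (e 0) hp.ne' (hyperplaneReflection h (e 4) hn.ne (e i)) =
        if i = 0 ∨ i = 4 then -e i else e i := by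
      intro i
      simp only [hyperplaneReflection_apply, map_sub, map_smul, he _ _]
      fin_cases i <;> simp [eps] <;> module
    rw [hC] at h3
    simp only [LinearEquiv.mul_apply, hCe] at h3
    rw [h4, canonicalThreeForm_apply] at h3
    simp [canonicalPoly, minor] at h3
    linarith

end Stabilizer

/-! ### Invariants of the stabilizer -/

section Elements

/-- The signs of three diagonal maps that preserve the canonical three-form: each of them is `1` on
the vectors of one of the index triples `567`, `127`, `135` of that form and `-1` on the other basis
vectors. -/
def lineSigns : Fin 3 → Fin 7 → ℤ :=
  ![![-1, -1, -1, -1, 1, 1, 1], ![1, 1, -1, -1, -1, -1, 1], ![1, -1, 1, -1, 1, -1, -1]]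

/-- Three involutions that preserve the canonical three-form. Each of them maps two planes of
signature `(1,1)` to themselves and acts there as a hyperbolic reflection. -/
noncomputable def boost : Fin 3 → Matrix (Fin 7) (Fin 7) ℝ := ![
  !![5/4, 0, 0, 0, -3/4, 0, 0;
    0, 5/4, 0, 0, 0, -3/4, 0;
    0, 0, -1, 0, 0, 0, 0;
    0, 0, 0, -1, 0, 0, 0;
    3/4, 0, 0, 0, -5/4, 0, 0;
    0, 3/4, 0, 0, 0, -5/4, 0;
    0, 0, 0, 0, 0, 0, 1],
  !![5/4, 0, 0, 0, 0, -3/4, 0;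
    0, -1, 0, 0, 0, 0, 0;
    0, 0, 5/4, 0, 0, 0, -3/4;
    0, 0, 0, -1, 0, 0, 0;
    0, 0, 0, 0, 1, 0, 0;
    3/4, 0, 0, 0, 0, -5/4, 0;
    0, 0, 3/4, 0, 0, 0, -5/4],
  !![5/4, 0, 0, 0, 0, 0, -3/4;
    0, -1, 0, 0, 0, 0, 0;
    0, 0, -1, 0, 0, 0, 0;
    0, 0, 0, 5/4, 3/4, 0, 0;
    0, 0, 0, -3/4, -5/4, 0, 0;
    0, 0, 0, 0, 0, 1, 0;
    3/4, 0, 0, 0, 0, 0, -5/4]]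

variable {V : Type*} [AddCommGroup V] [Module ℝ V]

lemma exists_mem_stabilizer_of_matrix (e : Basis (Fin 7) ℝ V) {M : Matrix (Fin 7) (Fin 7) ℝ}
    (hM : ∀ x, M.mulVec (M.mulVec x) = x)
    (hφ : ∀ x y z, canonicalPoly (M.mulVec x) (M.mulVec y) (M.mulVec z) = canonicalPoly x y z) :
    ∃ A ∈ stabilizer (canonicalThreeForm e), ∀ j, A (e j) = ∑ i, M i j • e i := by
  have h1 : ∀ x, e.equivFun (Matrix.toLin e e M x) = M.mulVec (e.equivFun x) := fun x =>
    Matrix.repr_toLin e e M x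
  refine ⟨LinearEquiv.ofInvolutive (Matrix.toLin e e M) fun x => e.equivFun.injective (by
    rw [h1, h1, hM]), ?_, fun j => Matrix.toLin_self e e M j⟩
  change AlternatingMap.compLinearMap _ _ = _
  ext x
  rw [AlternatingMap.compLinearMap_apply, canonicalThreeForm_apply, canonicalThreeForm_apply]
  change canonicalPoly (e.equivFun (Matrix.toLin e e M (x 0)))
    (e.equivFun (Matrix.toLin e e M (x 1))) (e.equivFun (Matrix.toLin e e M (x 2))) = _
  rw [h1, h1, h1, hφ]

lemma exists_sign_mem_stabilizer (e : Basis (Fin 7) ℝ V) (a : Fin 3) :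
    ∃ A ∈ stabilizer (canonicalThreeForm e), ∀ j, A (e j) = (lineSigns a j : ℝ) • e j := by
  have hmul : ∀ x : Fin 7 → ℝ, (Matrix.diagonal fun j => (lineSigns a j : ℝ)).mulVec x =
      fun j => (lineSigns a j : ℝ) * x j := fun x => by
    ext j; rw [Matrix.mulVec_diagonal]
  obtain ⟨A, hA, h⟩ := exists_mem_stabilizer_of_matrix e
    (M := Matrix.diagonal fun j => (lineSigns a j : ℝ))
    (fun x => by
      have hs : ∀ j, lineSigns a j * lineSigns a j = 1 := by clear * -; revert a; decide
      ext j
      rw [hmul, hmul]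
      beta_reduce
      rw [← mul_assoc, ← Int.cast_mul, hs, Int.cast_one, one_mul])
    (fun x y z => by
      simp only [hmul]
      fin_cases a <;> simp [canonicalPoly, minor, lineSigns] <;> ring)
  refine ⟨A, hA, fun j => (h j).trans ?_⟩
  rw [Finset.sum_eq_single j (fun i _ hij => by rw [Matrix.diagonal_apply_ne _ hij, zero_smul])
    (by simp), Matrix.diagonal_apply_eq]

lemma exists_boost_mem_stabilizer (e : Basis (Fin 7) ℝ V) (a : Fin 3) :
    ∃ A ∈ stabilizer (canonicalThreeForm e), ∀ j, A (e j) = ∑ i, boost a i j • e i := by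
  have hmul : ∀ x i, (boost a).mulVec x i = ∑ j, boost a i j * x j := fun _ _ => rfl
  refine exists_mem_stabilizer_of_matrix e (fun x => ?_) fun x y z => ?_
  · ext i
    simp only [hmul, Fin.sum_univ_seven]
    fin_cases a <;> fin_cases i <;> simp [boost] <;> ring
  · simp only [canonicalPoly, minor, hmul, Fin.sum_univ_seven]
    fin_cases a <;> simp [boost] <;> ring

end Elements

section Invariants

variable {V : Type*} [AddCommGroup V] [Module ℝ V]

lemma threeForm_add_left (φ : ExtForm V 3) (x x' y z : V) :
    φ ![x + x', y, z] = φ ![x, y, z] + φ ![x', y, z] :=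
  φ.map_vecCons_add ![y, z] x x'

lemma threeForm_smul_left (φ : ExtForm V 3) (c : ℝ) (x y z : V) :
    φ ![c • x, y, z] = c * φ ![x, y, z] :=
  φ.map_vecCons_smul ![y, z] c x

lemma threeForm_rotate (φ : ExtForm V 3) (x y z : V) : φ ![x, y, z] = φ ![y, z, x] := by
  rw [threeForm_swap_left φ y x z, threeForm_swap_right φ y z x]; ring

lemma threeForm_add_middle (φ : ExtForm V 3) (x y y' z : V) :
    φ ![x, y + y', z] = φ ![x, y, z] + φ ![x, y', z] := by
  rw [threeForm_rotate, threeForm_add_left, ← threeForm_rotate φ x, ← threeForm_rotate φ x]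

lemma threeForm_smul_middle (φ : ExtForm V 3) (c : ℝ) (x y z : V) :
    φ ![x, c • y, z] = c * φ ![x, y, z] := by
  rw [threeForm_rotate, threeForm_smul_left, ← threeForm_rotate φ x]

lemma threeForm_add_right (φ : ExtForm V 3) (x y z z' : V) :
    φ ![x, y, z + z'] = φ ![x, y, z] + φ ![x, y, z'] := by
  rw [← threeForm_rotate, threeForm_add_left, threeForm_rotate, threeForm_rotate φ z']

lemma threeForm_smul_right (φ : ExtForm V 3) (c : ℝ) (x y z : V) :
    φ ![x, y, c • z] = c * φ ![x, y, z] := by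
  rw [← threeForm_rotate, threeForm_smul_left, threeForm_rotate]

/-- An increasing triple on whose product all three vectors of signs are `1` is one of the seven
index triples of the canonical three-form. -/
lemma mem_lines_of_lineSigns : ∀ i j k : Fin 7, i < j → j < k →
    (∀ a, lineSigns a i * lineSigns a j * lineSigns a k = 1) →
    (i, j, k) ∈ ([(0, 1, 6), (0, 2, 4), (0, 3, 5), (1, 2, 5), (1, 3, 4), (2, 3, 6), (4, 5, 6)] :
      List (Fin 7 × Fin 7 × Fin 7)) := by
  decide

lemma threeForm_apply_of_mem_stabilizer {ψ : ExtForm V 3} {A : V ≃ₗ[ℝ] V}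
    (hA : A ∈ stabilizer ψ) (x y z : V) : ψ ![A x, A y, A z] = ψ ![x, y, z] := by
  have hA' : ψ.compLinearMap (A : V →ₗ[ℝ] V) = ψ := hA
  conv_rhs => rw [← hA', AlternatingMap.compLinearMap_apply]
  exact congrArg ψ (by funext a; fin_cases a <;> rfl)

/-- An invariant three-form has no components but those of the canonical one, by the invariance
under the changes of signs, and the involutions `boost` relate these seven components. -/
lemma eq_zero_of_stabilizer_le {e : Basis (Fin 7) ℝ V} {ψ : ExtForm V 3}
    (hψ : stabilizer (canonicalThreeForm e) ≤ stabilizer ψ) (h0 : ψ ![e 4, e 5, e 6] = 0) :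
    ψ = 0 := by
  set c : Fin 7 → Fin 7 → Fin 7 → ℝ := fun i j k => ψ ![e i, e j, e k] with hc
  have hanti : ∀ i j k, ψ ![e i, e j, e k] = antisymm c i j k := antisymm_basis ψ e
  have hline : ∀ i j k, (∃ a, lineSigns a i * lineSigns a j * lineSigns a k ≠ 1) →
      c i j k = 0 := by
    rintro i j k ⟨a, ha⟩
    obtain ⟨A, hA, hAe⟩ := exists_sign_mem_stabilizer e a
    have h1 := threeForm_apply_of_mem_stabilizer (hψ hA) (e i) (e j) (e k)
    rw [hAe, hAe, hAe, threeForm_smul_left, threeForm_smul_middle, threeForm_smul_right] at h1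
    have h2 : lineSigns a i * lineSigns a j * lineSigns a k = -1 := by
      revert ha; clear * -; revert a i j k; decide
    have h3 : (lineSigns a i : ℝ) * lineSigns a j * lineSigns a k = -1 := by exact_mod_cast h2
    have h4 : c i j k = -c i j k := by
      calc c i j k = (lineSigns a i : ℝ) * lineSigns a j * lineSigns a k * c i j k := by
            rw [← mul_assoc, ← mul_assoc] at h1; exact h1.symm
        _ = -c i j k := by rw [h3]; ring
    linarith
  have hboost : ∀ a i j k, ψ ![∑ m, boost a m i • e m, ∑ m, boost a m j • e m,
      ∑ m, boost a m k • e m] = c i j k := by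
    intro a i j k
    obtain ⟨A, hA, hAe⟩ := exists_boost_mem_stabilizer e a
    rw [← hAe, ← hAe, ← hAe]
    exact threeForm_apply_of_mem_stabilizer (hψ hA) _ _ _
  have r1 := hboost 0 0 1 6
  have r2 := hboost 0 0 3 5
  have r3 := hboost 1 0 2 4
  have r4 := hboost 1 0 1 6
  have r5 := hboost 2 0 3 5
  have r6 := hboost 2 0 2 4
  have h456 : c 4 5 6 = 0 := h0
  have hneg : ∀ x y z, ψ ![x, -y, z] = -ψ ![x, y, z] := fun x y z => by
    rw [← neg_one_smul ℝ y, threeForm_smul_middle, neg_one_mul]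
  simp [boost, Fin.sum_univ_seven, hneg, threeForm_add_left, threeForm_add_middle,
    threeForm_add_right, threeForm_smul_left, threeForm_smul_middle, threeForm_smul_right, hanti,
    antisymm, h456]
    at r1 r2 r3 r4 r5 r6
  rw [hline 1 4 6 (by decide), hline 0 5 6 (by decide)] at r1
  rw [hline 0 1 3 (by decide), hline 3 4 5 (by decide)] at r2
  rw [hline 2 4 5 (by decide), hline 0 4 6 (by decide)] at r3
  rw [hline 0 1 2 (by decide), hline 1 5 6 (by decide)] at r4
  rw [hline 3 5 6 (by decide), hline 0 4 5 (by decide)] at r5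
  rw [hline 0 2 3 (by decide), hline 2 4 6 (by decide)] at r6
  refine threeForm_ext e fun i j k hij hjk => ?_
  change c i j k = 0
  by_cases hl : ∃ a, lineSigns a i * lineSigns a j * lineSigns a k ≠ 1
  · exact hline i j k hl
  · push Not at hl
    have := mem_lines_of_lineSigns i j k hij hjk hl
    simp only [List.mem_cons, Prod.mk.injEq, List.not_mem_nil, or_false] at this
    rcases this with ⟨rfl, rfl, rfl⟩ | ⟨rfl, rfl, rfl⟩ | ⟨rfl, rfl, rfl⟩ | ⟨rfl, rfl, rfl⟩ |
      ⟨rfl, rfl, rfl⟩ | ⟨rfl, rfl, rfl⟩ | ⟨rfl, rfl, rfl⟩ <;> linarith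

/-- Every three-form that is invariant under the stabilizer of the canonical one is a multiple of
it. -/
theorem exists_smul_of_stabilizer_le {e : Basis (Fin 7) ℝ V} {φ : ExtForm V 3}
    (hφ : stabilizer (canonicalThreeForm e) ≤ stabilizer φ) :
    ∃ c : ℝ, φ = c • canonicalThreeForm e := by
  refine ⟨φ ![e 4, e 5, e 6], sub_eq_zero.mp (eq_zero_of_stabilizer_le (e := e) ?_ ?_)⟩
  · intro A hA
    have h1 : φ.compLinearMap (A : V →ₗ[ℝ] V) = φ := hφ hA
    have h2 : (canonicalThreeForm e).compLinearMap (A : V →ₗ[ℝ] V) = canonicalThreeForm e := hA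
    change AlternatingMap.compLinearMap _ _ = _
    ext x
    have h3 := DFunLike.congr_fun h1 x
    have h4 := DFunLike.congr_fun h2 x
    rw [AlternatingMap.compLinearMap_apply] at h3 h4 ⊢
    simp only [AlternatingMap.sub_apply, AlternatingMap.smul_apply, h3, h4]
  · rw [AlternatingMap.sub_apply, AlternatingMap.smul_apply, canonicalThreeForm_apply]
    simp [canonicalPoly, minor]

/-- An invariant bilinear form is diagonal, by the invariance under the changes of signs, and the
involutions `boost` relate its diagonal entries to one another. -/
lemma bilin_eq_zero_of_stabilizer_invariant {e : Basis (Fin 7) ℝ V} {h : LinearMap.BilinForm ℝ V}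
    (hh : ∀ A ∈ stabilizer (canonicalThreeForm e), ∀ x y, h (A x) (A y) = h x y)
    (h0 : h (e 0) (e 0) = 0) : h = 0 := by
  have hoff : ∀ i j, i ≠ j → h (e i) (e j) = 0 := by
    intro i j hij
    obtain ⟨a, ha⟩ : ∃ a, lineSigns a i * lineSigns a j = -1 := by
      revert hij; clear * -; revert i j; decide
    obtain ⟨A, hA, hAe⟩ := exists_sign_mem_stabilizer e a
    have h1 := hh A hA (e i) (e j)
    rw [hAe, hAe, map_smul, map_smul, LinearMap.smul_apply, smul_eq_mul, smul_eq_mul,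
      ← mul_assoc, mul_comm (lineSigns a j : ℝ)] at h1
    have h3 : (lineSigns a i : ℝ) * lineSigns a j = -1 := by exact_mod_cast ha
    rw [h3] at h1
    linarith
  have hboost : ∀ a i, h (∑ m, boost a m i • e m) (∑ m, boost a m i • e m) = h (e i) (e i) := by
    intro a i
    obtain ⟨A, hA, hAe⟩ := exists_boost_mem_stabilizer e a
    rw [← hAe]
    exact hh A hA _ _
  have hd : ∀ a i, ∑ m, boost a m i ^ 2 * h (e m) (e m) = h (e i) (e i) := by
    intro a i
    rw [← hboost a i]
    simp only [map_sum, map_smul, LinearMap.sum_apply, LinearMap.smul_apply, smul_eq_mul]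
    refine Finset.sum_congr rfl fun m _ => ?_
    rw [Finset.sum_eq_single m (fun k _ hk => by rw [hoff k m hk]; ring) (by simp)]
    ring
  have r1 := hd 0 0
  have r2 := hd 0 1
  have r3 := hd 1 0
  have r4 := hd 1 2
  have r5 := hd 2 0
  have r6 := hd 2 3
  simp [boost, Fin.sum_univ_seven, h0] at r1 r2 r3 r4 r5 r6
  refine LinearMap.ext_basis e e fun i j => ?_
  rw [LinearMap.zero_apply, LinearMap.zero_apply]
  by_cases hij : i = j
  · subst hij
    fin_cases i <;> simp only [Fin.zero_eta, Fin.mk_one, Fin.reduceFinMk, Fin.isValue] <;> linarith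
  · exact hoff i j hij

/-- Every bilinear form that is invariant under the stabilizer of the canonical three-form is a
multiple of the standard metric. -/
theorem exists_smul_of_stabilizer_invariant {e : Basis (Fin 7) ℝ V} {h : LinearMap.BilinForm ℝ V}
    (hh : ∀ A ∈ stabilizer (canonicalThreeForm e), ∀ x y, h (A x) (A y) = h x y) :
    ∃ c : ℝ, ∀ i j, h (e i) (e j) = if i = j then c * eps i else 0 := by
  have hg := isOrthonormalBasis_standardMetric e
  have key := bilin_eq_zero_of_stabilizer_invariant (e := e)
    (h := h - h (e 0) (e 0) • standardMetric e) (fun A hA x y => ?_) ?_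
  · refine ⟨h (e 0) (e 0), fun i j => ?_⟩
    have h1 : h (e i) (e j) - h (e 0) (e 0) * standardMetric e (e i) (e j) = 0 :=
      LinearMap.congr_fun₂ key (e i) (e j)
    rw [hg] at h1
    rw [sub_eq_zero.mp h1]
    split_ifs <;> simp
  · change h (A x) (A y) - h (e 0) (e 0) * standardMetric e (A x) (A y) =
      h x y - h (e 0) (e 0) * standardMetric e x y
    rw [hh A hA, (hg.isometry_and_det_of_mem_stabilizer hA).1]
  · change h (e 0) (e 0) - h (e 0) (e 0) * standardMetric e (e 0) (e 0) = 0
    rw [hg]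
    simp [eps]

end Invariants

/-! ### The equivalences and the induced metric -/

section Rescale

variable {V : Type*} [AddCommGroup V] [Module ℝ V]

/-- The basis whose vectors are the `r`-fold ones of a basis `e`. -/
noncomputable def scaleBasis (e : Basis (Fin 7) ℝ V) {r : ℝ} (hr : r ≠ 0) : Basis (Fin 7) ℝ V :=
  e.map (LinearEquiv.smulOfNeZero ℝ V r hr)

lemma scaleBasis_apply (e : Basis (Fin 7) ℝ V) {r : ℝ} (hr : r ≠ 0) (i : Fin 7) :
    scaleBasis e hr i = r • e i := rfl

lemma canonicalThreeForm_scaleBasis (e : Basis (Fin 7) ℝ V) {r : ℝ} (hr : r ≠ 0) :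
    canonicalThreeForm e = r ^ 3 • canonicalThreeForm (scaleBasis e hr) := by
  rw [← canonicalThreeForm_map e (LinearEquiv.smulOfNeZero ℝ V r hr)]
  ext x
  rw [AlternatingMap.compLinearMap_apply, AlternatingMap.smul_apply]
  change canonicalThreeForm (scaleBasis e hr) (fun i => r • x i) = _
  rw [AlternatingMap.map_smul_univ (c := fun _ => r), Finset.prod_const, Finset.card_fin]

lemma stabilizer_smul {k : ℕ} (φ : ExtForm V k) {c : ℝ} (hc : c ≠ 0) :
    stabilizer (c • φ) = stabilizer φ := by
  ext A
  change (c • φ).compLinearMap (A : V →ₗ[ℝ] V) = c • φ ↔ φ.compLinearMap (A : V →ₗ[ℝ] V) = φ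
  rw [show (c • φ).compLinearMap (A : V →ₗ[ℝ] V) = c • φ.compLinearMap (A : V →ₗ[ℝ] V) from rfl,
    (smul_right_injective (ExtForm V k) hc).eq_iff]

end Rescale

section NormalForm

variable {V : Type*} [AddCommGroup V] [Module ℝ V]

/-- `φ` is a non-zero multiple of the canonical three-form of a basis that is pseudo-orthonormal
for `h`. -/
def IsSplitG2Form (h : LinearMap.BilinForm ℝ V) (φ : ExtForm V 3) : Prop :=
  ∃ e : Basis (Fin 7) ℝ V, IsOrthonormalBasis h e ∧ ∃ c : ℝ, c ≠ 0 ∧ φ = c • canonicalThreeForm e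

lemma IsSplitG2Form.stabilizer_le_SO0 {h : LinearMap.BilinForm ℝ V} {φ : ExtForm V 3}
    (H : IsSplitG2Form h φ) : stabilizer φ ≤ SO0 h := by
  obtain ⟨e, he, c, hc, rfl⟩ := H
  rw [stabilizer_smul _ hc]
  exact he.stabilizer_le_SO0

lemma IsSplitG2Form.isG2Star {h : LinearMap.BilinForm ℝ V} {φ : ExtForm V 3}
    (H : IsSplitG2Form h φ) : IsG2Star h (stabilizer φ) := by
  refine ⟨H.stabilizer_le_SO0, ?_⟩
  obtain ⟨e, he, c, hc, rfl⟩ := H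
  exact ⟨e, stabilizer_smul _ hc⟩

/-- The metric and the three-form are recovered up to scale from the group `G₂*` as its invariants.
The multiple of the three-form does not vanish because `SO₀` is larger than `G₂*`. -/
theorem IsG2Star.isSplitG2Form {h : LinearMap.BilinForm ℝ V} (hh : HasSignature43 h)
    {φ : ExtForm V 3} {H : Subgroup (V ≃ₗ[ℝ] V)} (hH : IsG2Star h H) (hφ : H ≤ stabilizer φ)
    (hφ' : stabilizer φ ⊓ SO0 h ≤ H) : IsSplitG2Form h φ := by
  obtain ⟨hle, e, rfl⟩ := hH
  obtain ⟨c, rfl⟩ := exists_smul_of_stabilizer_le hφ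
  obtain ⟨m, hm⟩ := exists_smul_of_stabilizer_invariant (e := e) (h := h) fun A hA =>
    SO0.isometry (hle hA)
  have hm0 : 0 < m := pos_of_smul_hasSignature hm hh
  have hc : c ≠ 0 := by
    rintro rfl
    have h0 : 0 < h (e 0) (e 0) := by rw [hm]; simpa [eps] using hm0
    have h1 : 0 < h (e 1) (e 1) := by rw [hm]; simpa [eps] using hm0
    have hmem : hyperplaneReflection h (e 0) h0.ne' * hyperplaneReflection h (e 1) h1.ne' ∈
        stabilizer (canonicalThreeForm e) := by
      refine hφ' ⟨?_, hyperplaneReflection_mul_mem_SO0 hh.1 _ _ (mul_pos h0 h1)⟩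
      change AlternatingMap.compLinearMap _ _ = _
      ext x
      rw [AlternatingMap.compLinearMap_apply, zero_smul]
      rfl
    have h2 := threeForm_apply_of_mem_stabilizer hmem (e 0) (e 2) (e 4)
    have h3 : ∀ i, hyperplaneReflection h (e 0) h0.ne' (hyperplaneReflection h (e 1) h1.ne' (e i)) =
        if i = 0 ∨ i = 1 then -e i else e i := by
      intro i
      simp only [hyperplaneReflection_apply, map_sub, map_smul, hm]
      fin_cases i <;> simp [eps, hm0.ne'] <;> module
    simp only [LinearEquiv.mul_apply, h3] at h2
    rw [canonicalThreeForm_apply, canonicalThreeForm_apply] at h2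
    simp [canonicalPoly, minor] at h2
    linarith
  have hr : (√m)⁻¹ ≠ 0 := inv_ne_zero (Real.sqrt_pos.mpr hm0).ne'
  refine ⟨scaleBasis e hr, fun i j => ?_, c * (√m)⁻¹ ^ 3,
    mul_ne_zero hc (pow_ne_zero _ hr), ?_⟩
  · simp only [scaleBasis_apply, map_smul, LinearMap.smul_apply, smul_eq_mul, hm]
    split_ifs
    · have hmm : (√m)⁻¹ * (√m)⁻¹ * m = 1 := by
        rw [← mul_inv, Real.mul_self_sqrt hm0.le, inv_mul_cancel₀ hm0.ne']
      linear_combination eps i * hmm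
    · simp
  · rw [mul_smul, ← canonicalThreeForm_scaleBasis]

end NormalForm

section Equation

variable {V : Type*} [AddCommGroup V] [Module ℝ V]

lemma IsOrthonormalBasis.spinorMatrix_canonicalThreeForm {h : LinearMap.BilinForm ℝ V}
    {e : Basis (Fin 7) ℝ V} (he : IsOrthonormalBasis h e) :
    spinorMatrix (fun i j k => canonicalThreeForm e ![e i, e j, e k]) =
      Matrix.diagonal ![-7, 1, 1, 1, 1, 1, 1, 1] := by
  have hfs : ∀ i, e.equivFun (e i) = Pi.single i 1 := fun i => by
    simp [Basis.equivFun, Finsupp.single_eq_pi_single]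
  have h1 : (fun i j k => canonicalThreeForm e ![e i, e j, e k]) = fun i j k =>
      spinorForm spinorOne ((gamma (Pi.single i 1)).mulVec ((gamma (Pi.single j 1)).mulVec
        ((gamma (Pi.single k 1)).mulVec spinorOne))) := by
    funext i j k
    rw [← threeForm_spinorOne he (isSymm_of_diagonal e he), IsSkewClifford.threeForm_apply,
      cliffordMul_apply, cliffordMul_apply, cliffordMul_apply]
    simp only [hfs]
  rw [h1, spinorMatrix_threeForm]
  ext a b
  rw [Matrix.sub_apply, Matrix.smul_apply, Matrix.of_apply, Matrix.one_apply,
    Matrix.diagonal_apply, spinorForm_apply]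
  split_ifs with hab
  · subst hab
    fin_cases a <;> simp [spinorOne, delta]
    norm_num
  · by_cases ha : a = 0
    · have hb : b ≠ 0 := fun hb => hab (ha.trans hb.symm)
      simp [spinorOne, hb]
    · simp [spinorOne, ha]

variable [Fact (finrank ℝ V = 7)]

/-- The endomorphism `S` of the spinors defined by the canonical three-form satisfies
`S² = 7 - 6 S`. The trace of its square yields the square norm, and its remaining part the form
`*(φ △₁ φ)`. -/
lemma IsOrthonormalBasis.formInner_hodgeFour_canonical {h : LinearMap.BilinForm ℝ V}
    {e : Basis (Fin 7) ℝ V} (he : IsOrthonormalBasis h e) {o : Orientation ℝ V (Fin 7)} {s : ℝ}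
    (hs : s * s = 1) (hvol : volumeForm h o = s • e.det) (c : ℝ) :
    formInner h (c • canonicalThreeForm e) (c • canonicalThreeForm e) = -(7 * c ^ 2) ∧
      hodgeFour h o (triangleOne h (c • canonicalThreeForm e) (c • canonicalThreeForm e)) =
        (-(6 * s * c)) • (c • canonicalThreeForm e) := by
  set φ := c • canonicalThreeForm e with hφ
  have hS : spinorMatrix (fun i j k => φ ![e i, e j, e k]) =
      c • Matrix.diagonal ![-7, 1, 1, 1, 1, 1, 1, 1] := by
    rw [← he.spinorMatrix_canonicalThreeForm, ← spinorMatrix_smul]; rfl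
  have hD : (Matrix.diagonal ![-7, 1, 1, 1, 1, 1, 1, 1] : Matrix (Fin 8) (Fin 8) ℝ) *
      Matrix.diagonal ![-7, 1, 1, 1, 1, 1, 1, 1] =
      (7 : ℝ) • 1 - (6 : ℝ) • Matrix.diagonal ![-7, 1, 1, 1, 1, 1, 1, 1] := by
    rw [Matrix.diagonal_mul_diagonal, ← Matrix.diagonal_one, ← Matrix.diagonal_smul,
      ← Matrix.diagonal_smul, Matrix.diagonal_sub]
    congr 1
    funext a
    fin_cases a <;> simp <;> norm_num
  have hsq := he.spinorMatrix_mul_self hs hvol φ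
  rw [hS, smul_mul_smul_comm, hD] at hsq
  have hn : formInner h φ φ = -(7 * c ^ 2) := by
    have h1 := congrArg Matrix.trace hsq
    rw [Matrix.trace_add, spinorMatrix_trace] at h1
    simp [Matrix.trace, Fin.sum_univ_eight] at h1
    linarith
  refine ⟨hn, threeForm_ext e fun i j k hij hjk => ?_⟩
  have hS' : spinorMatrix (s • fun i j k => hodgeFour h o (triangleOne h φ φ) ![e i, e j, e k]) =
      spinorMatrix ((-(6 * c)) • fun i j k => φ ![e i, e j, e k]) := by
    rw [spinorMatrix_smul (-(6 * c)), hS]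
    rw [hn] at hsq
    rw [← sub_eq_iff_eq_add'] at hsq
    rw [← hsq]
    module
  have h1 : s * hodgeFour h o (triangleOne h φ φ) ![e i, e j, e k] =
      -(6 * c) * φ ![e i, e j, e k] := eq_of_spinorMatrix_eq hS' i j k hij hjk
  rw [AlternatingMap.smul_apply, smul_eq_mul]
  linear_combination s * h1 - hodgeFour h o (triangleOne h φ φ) ![e i, e j, e k] * hs

theorem isSplitG2Form_iff {h : LinearMap.BilinForm ℝ V} (hh : HasSignature43 h)
    (o : Orientation ℝ V (Fin 7)) {l : ℝ} (hl : l = 1 ∨ l = -1) (φ : ExtForm V 3) :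
    IsSplitG2Form h φ ↔ formInner h φ φ < 0 ∧ ∃ κ : ℝ, (κ = 1 ∨ κ = -1) ∧
      (6 * κ * √(-formInner h φ φ / 7)) • φ = l • hodgeFour h o (triangleOne h φ φ) := by
  have hll : l * l = 1 := by rcases hl with rfl | rfl <;> norm_num
  constructor
  · rintro ⟨e, he, c, hc, rfl⟩
    obtain ⟨s, hs, hvol⟩ := he.volumeForm_eq o
    have hss : s * s = 1 := by rcases hs with rfl | rfl <;> norm_num
    obtain ⟨h1, h2⟩ := he.formInner_hodgeFour_canonical hss hvol c
    have hc2 : 0 < c ^ 2 := by positivity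
    rw [h1, h2, show -(-(7 * c ^ 2)) / 7 = c ^ 2 by ring, Real.sqrt_sq_eq_abs]
    refine ⟨by linarith, ?_⟩
    rcases abs_choice c with hc' | hc'
    · refine ⟨-(l * s), ?_, ?_⟩
      · rcases hl with rfl | rfl <;> rcases hs with rfl | rfl <;> norm_num
      · rw [hc', smul_smul l]; congr 1; ring
    · refine ⟨l * s, ?_, ?_⟩
      · rcases hl with rfl | rfl <;> rcases hs with rfl | rfl <;> norm_num
      · rw [hc', smul_smul l]; congr 1; ring
  · rintro ⟨hneg, κ, hκ, H⟩
    have hκ2 : κ ^ 2 = 1 := by rcases hκ with rfl | rfl <;> norm_num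
    have hpos : 0 < -formInner h φ φ / 7 := by linarith
    have hsq := Real.sq_sqrt hpos.le
    obtain ⟨e, he, hφ⟩ := exists_canonical_of_hodge_eq hh o φ
      (t := l * κ * √(-formInner h φ φ / 7)) (by
        have := (Real.sqrt_pos.mpr hpos).ne'
        rcases hl with rfl | rfl <;> rcases hκ with rfl | rfl <;> simpa using this)
      (by rw [mul_pow, mul_pow, hsq, hκ2, sq l, hll]; ring)
      (by
        have h1 := congrArg (fun ψ => l • ψ) H
        simp only [smul_smul, hll, one_smul] at h1
        rw [← h1]; congr 1; ring)
    refine ⟨e, he, _, fun h0 => ?_, hφ⟩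
    rw [h0, zero_smul] at hφ
    rw [hφ] at hneg
    have : formInner h (0 : ExtForm V 3) 0 = 0 := by simp [formInner]
    rw [this] at hneg
    exact lt_irrefl _ hneg

end Equation

section InducedMetric

variable {V : Type*} [AddCommGroup V] [Module ℝ V] [Fact (finrank ℝ V = 7)]

lemma IsOrthonormalBasis.volumeForm_orientation {g : LinearMap.BilinForm ℝ V}
    {e : Basis (Fin 7) ℝ V} (he : IsOrthonormalBasis g e) :
    volumeForm g e.orientation = e.det := by
  rw [SplitG2.volumeForm_eq g _ e rfl, he.toMatrix_det]
  simp

/-- Uniqueness of the induced metric: two induced metrics are proportional by a factor `k > 0`, and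
the comparison of their volume forms yields `k ^ 9 = 1`. -/
theorem IsOrthonormalBasis.isInducedMetric_iff {g : LinearMap.BilinForm ℝ V}
    {e : Basis (Fin 7) ℝ V} (he : IsOrthonormalBasis g e) (g' : LinearMap.BilinForm ℝ V) :
    IsInducedMetric ((-1 : ℝ) • canonicalThreeForm e) g' ↔ g' = g := by
  have hW : ∀ u v, wedge (wedge (contract u ((-1 : ℝ) • canonicalThreeForm e))
      (contract v ((-1 : ℝ) • canonicalThreeForm e))) ((-1 : ℝ) • canonicalThreeForm e) =
        (6 * g u v) • e.det := by
    intro u v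
    have h1 : ∀ u, contract u ((-1 : ℝ) • canonicalThreeForm e) =
        (-1 : ℝ) • contract u (canonicalThreeForm e) := fun u => rfl
    rw [h1, h1, wedge_smul_right, wedge_smul_left, wedge_smul_right, wedge_smul_left,
      wedge_smul_left, he.wedge_contract_canonicalThreeForm]
    simp only [smul_smul]
    congr 1
    ring
  constructor
  · rintro ⟨hsig, o, ho⟩
    set b := e.adjustToOrientation o with hb
    have hbg : IsOrthonormalBasis g b := he.adjustToOrientation o
    set q := √|(LinearMap.BilinForm.toMatrix b g').det| with hq
    have hvol : volumeForm g' o = q • b.det :=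
      SplitG2.volumeForm_eq g' o b (e.orientation_adjustToOrientation o)
    obtain ⟨d, hd, hdet⟩ : ∃ d : ℝ, (d = 1 ∨ d = -1) ∧ e.det = d • b.det := by
      rcases e.det_adjustToOrientation o with h1 | h1
      · exact ⟨1, Or.inl rfl, by rw [hb, h1, one_smul]⟩
      · exact ⟨-1, Or.inr rfl, by rw [hb, h1]; simp⟩
    have key : ∀ u v, g' u v * q = d * g u v := by
      intro u v
      have h1 := DFunLike.congr_fun ((ho u v).symm.trans (hW u v)) ⇑b
      rw [hvol, hdet] at h1
      simp only [AlternatingMap.smul_apply, smul_eq_mul, Basis.det_self, mul_one] at h1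
      linarith
    have hd0 : d ≠ 0 := by rcases hd with rfl | rfl <;> norm_num
    have hq0 : q ≠ 0 := by
      intro h0
      have := key (b 0) (b 0)
      rw [h0, hbg] at this
      simp [eps] at this
      exact hd0 this.symm
    have hqpos : 0 < q := lt_of_le_of_ne (Real.sqrt_nonneg _) hq0.symm
    have hg' : ∀ i j, g' (b i) (b j) = if i = j then d / q * eps i else 0 := by
      intro i j
      have := key (b i) (b j)
      rw [hbg] at this
      rw [eq_div_of_mul_eq hq0 this]
      split_ifs
      · ring
      · simp
    have hk : 0 < d / q := pos_of_smul_hasSignature hg' hsig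
    have hd1 : d = 1 := by
      rcases hd with h1 | h1
      · exact h1
      · rw [h1, lt_div_iff₀ hqpos] at hk; linarith
    have hdetg : (LinearMap.BilinForm.toMatrix b g').det = -(d / q) ^ 7 := by
      have : LinearMap.BilinForm.toMatrix b g' = (d / q) • LinearMap.BilinForm.toMatrix b g := by
        ext i j
        rw [Matrix.smul_apply, LinearMap.BilinForm.toMatrix_apply,
          LinearMap.BilinForm.toMatrix_apply, hg', hbg, smul_eq_mul, mul_ite, mul_zero]
      rw [this, Matrix.det_smul, hbg.toMatrix_det, Fintype.card_fin]; ring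
    have hq2 : q ^ 2 = (1 / q) ^ 7 := by
      rw [hq, Real.sq_sqrt (abs_nonneg _), ← hq, hdetg, abs_neg, abs_of_pos (by positivity), hd1]
    have hq9 : q ^ 9 = 1 ^ 9 := by
      field_simp at hq2
      linarith
    have hq1 : q = 1 := (Odd.strictMono_pow (by decide : Odd 9)).injective hq9
    refine LinearMap.ext₂ fun u v => ?_
    have := key u v
    rwa [hq1, hd1, mul_one, one_mul] at this
  · rintro rfl
    refine ⟨he.hasSignature, e.orientation, fun u v => ?_⟩
    rw [he.volumeForm_orientation]
    exact hW u v

/-- The `c`-fold canonical three-form induces exactly the metric `r⁻² h`, where `r³ = -c⁻¹`. -/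
theorem IsOrthonormalBasis.exists_isInducedMetric_iff {h : LinearMap.BilinForm ℝ V}
    {e : Basis (Fin 7) ℝ V} (he : IsOrthonormalBasis h e) {c : ℝ} (hc : c ≠ 0) :
    ∃ r : ℝ, r ≠ 0 ∧ c * r ^ 3 = -1 ∧ ∀ g : LinearMap.BilinForm ℝ V,
      IsInducedMetric (c • canonicalThreeForm e) g ↔ g = (r⁻¹ ^ 2) • h := by
  obtain ⟨r, hr⟩ : ∃ r : ℝ, r ^ 3 = -c⁻¹ := by
    have hs := Real.rpow_inv_natCast_pow (x := |c|⁻¹) (n := 3) (by positivity) (by norm_num)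
    rcases abs_choice c with h1 | h1 <;> rw [h1] at hs
    · exact ⟨-_, (by rw [neg_pow, hs]; norm_num)⟩
    · exact ⟨_, by rw [hs, inv_neg]⟩
  have hr0 : r ≠ 0 := by
    rintro rfl
    simp at hr
    exact hc hr
  have hcr : c * r ^ 3 = -1 := by rw [hr]; field_simp
  refine ⟨r, hr0, hcr, fun g => ?_⟩
  have hon : IsOrthonormalBasis ((r⁻¹ ^ 2) • h) (scaleBasis e hr0) := by
    intro i j
    simp only [scaleBasis_apply, map_smul, LinearMap.smul_apply, smul_eq_mul, he _ _]
    split_ifs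
    · field_simp
    · simp
  rw [← hon.isInducedMetric_iff g, canonicalThreeForm_scaleBasis e hr0, smul_smul, hcr]

end InducedMetric

end SplitG2

theorem mainTheorem1 {V : Type*} [AddCommGroup V] [Module ℝ V] [Fact (Module.finrank ℝ V = 7)]
    (h : LinearMap.BilinForm ℝ V) (hh : SplitG2.HasSignature43 h) (o : Orientation ℝ V (Fin 7))
    (l : ℝ) (hl : l = 1 ∨ l = -1) (φ : ExtForm V 3) :
    [SplitG2.IsG2Star h (SplitG2.stabilizer φ),
      SplitG2.IsG2Star h (SplitG2.stabilizer φ ⊓ SplitG2.SO0 h),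
      SplitG2.formInner h φ φ < 0 ∧ ∃ κ : ℝ, (κ = 1 ∨ κ = -1) ∧
        (6 * κ * √(-SplitG2.formInner h φ φ / 7)) • φ =
          l • SplitG2.hodgeFour h o (SplitG2.triangleOne h φ φ)].TFAE ∧
    (SplitG2.IsG2Star h (SplitG2.stabilizer φ) →
      (∃ c : ℝ, 0 < c ∧ ∀ g : LinearMap.BilinForm ℝ V,
        SplitG2.IsInducedMetric φ g ↔ g = c • h) ∧
      (SplitG2.formInner h φ φ = -7 → ∀ g : LinearMap.BilinForm ℝ V,
        SplitG2.IsInducedMetric φ g ↔ g = h)) := by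
  have hA : SplitG2.IsG2Star h (SplitG2.stabilizer φ) → SplitG2.IsSplitG2Form h φ := fun H =>
    H.isSplitG2Form hh le_rfl inf_le_left
  refine ⟨?_, fun H => ?_⟩
  · rw [← SplitG2.isSplitG2Form_iff hh o hl φ]
    tfae_have 1 → 2 := fun H => by
      rwa [inf_eq_left.mpr H.1]
    tfae_have 2 → 3 := fun H => H.isSplitG2Form hh inf_le_left le_rfl
    tfae_have 3 → 1 := fun H => H.isG2Star
    tfae_finish
  · obtain ⟨e, he, c, hc, rfl⟩ := hA H
    obtain ⟨r, hr, hcr, hg⟩ := he.exists_isInducedMetric_iff hc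
    refine ⟨⟨r⁻¹ ^ 2, by positivity, hg⟩, fun h7 g => ?_⟩
    obtain ⟨s, hs, hvol⟩ := he.volumeForm_eq o
    have hss : s * s = 1 := by rcases hs with rfl | rfl <;> norm_num
    rw [(he.formInner_hodgeFour_canonical hss hvol c).1] at h7
    -- `c ^ 2 = 1` and `c * r ^ 3 = -1`, so that `r ^ 2 = 1`
    have hr2 : r ^ 2 = 1 := by
      have h1 : (r ^ 2) ^ 3 = 1 ^ 3 := by
        have h2 : c ^ 2 = 1 := by linarith
        have h3 : (c * r ^ 3) ^ 2 = 1 := by rw [hcr]; norm_num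
        rw [mul_pow, h2] at h3
        linarith
      exact (Odd.strictMono_pow (by decide : Odd 3)).injective h1
    rw [hg g, inv_pow, hr2, inv_one, one_smul]
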